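/- Let $R$ be a discrete valuation ring, let $A_1$ be a finitely generated flat $R$-module, and let $I\subset A_1\otimes_R A_1$ be a flat submodule such that $(A_1\otimes_R A_1)/I$ is also flat over $R$. Let $A=\bigoplus_{n\ge 0}A_n=T_R(A_1)/(I)$ be the quadratic algebra of the triple $(A_0,A_1,I)$, $A_0=R$, where $(I)$ is the two-sided ideal generated by $I$. Let $A_1^*=\mathrm{Hom}_R(A_1,R)$, let $I^\perp\subset A_1^*\otimes_R A_1^*$ be the annihilator of $I$ for the pairing $\langle f\otimes g,v\otimes w\rangle=f(v)g(w)$, and let $A^!=T_R(A_1^*)/(I^\perp)$ be the quadratic dual of $A$. A quadratic algebra $B$ over $B_0=R$ is called Koszul if $B_0=B/B_{>0}$ has a resolution $\cdots\to M_2\to M_1\to M_0\to B_0\to 0$ by projective objects of the category of $\mathbb{Z}$-graded left $B$-modules such that each $M_i$ is generated by finitely many elements of degree $i$. Then $A$ is Koszul with all components $A_n$ flat over $R$ if and only if $A^!$ is Koszul with all components $A^!_n$ flat over $R$. In this case: 1. There are $R$-linear isomorphisms $\mathrm{Ext}^i_{A}(A_0,A_0)\cong[(A^!)^{\mathrm{opp}}]_i$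 and $\mathrm{Ext}^i_{A^!}(A_0,A_0)\cong[A^{\mathrm{opp}}]_i$ for all $i\ge 0$, with $\mathrm{Ext}$ taken in the categories of all left modules; for varying $i$ they form isomorphisms of graded algebras, where the Yoneda product of $\alpha$ and $\beta$ is "first $\alpha$, then $\beta$". 2. These groups are concentrated in internal degree $i$: for $M$ a graded module let $M[-d]$ be $M$ with degrees raised by $d$, so that $A_0[-d]$ is $A_0$ placed in degree $d$. In the category of $\mathbb{Z}$-graded left $A$-modules $\mathrm{Ext}^i(A_0,A_0[-d])=0$ for $d\neq i$, and $\mathrm{Ext}^i(A_0,A_0[-i])\cong[(A^!)^{\mathrm{opp}}]_i$ as $R$-modules; likewise for $\mathbb{Z}$-graded left $A^!$-modules, with $[A^{\mathrm{opp}}]_i$ in place of $[(A^!)^{\mathrm{opp}}]_i$. -/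

import Mathlib

open CategoryTheory CategoryTheory.Limits CategoryTheory.Abelian
open scoped TensorProduct ModuleCat.Algebra

universe u

/-! ### Graded modules over a nonnegatively graded algebra -/

/-- A `ℤ`-graded left module over the `ℕ`-graded `R`-algebra `A = ⨁ 𝒜 n`: a family of
`R`-modules `M i` (`i : ℤ`) with `R`-bilinear, unital and associative actions
`𝒜 n × M i → M (n + i)`. -/
structure GrMod {R A : Type u} [CommRing R] [Ring A] [Algebra R A]
    (𝒜 : ℕ → Submodule R A) [SetLike.GradedMonoid 𝒜] where
  obj : ℤ → Type u
  [addCommGroup : ∀ i, AddCommGroup (obj i)]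
  [module : ∀ i, Module R (obj i)]
  act : ∀ {n : ℕ} {i j : ℤ}, (n : ℤ) + i = j → (𝒜 n →ₗ[R] obj i →ₗ[R] obj j)
  one_act : ∀ {i : ℤ} (h : ((0 : ℕ) : ℤ) + i = i) (m : obj i),
    act h ⟨1, SetLike.GradedOne.one_mem⟩ m = m
  mul_act : ∀ {n p : ℕ} {i j k : ℤ} (h : (n : ℤ) + i = j) (h' : (p : ℤ) + j = k)
    (h'' : ((p + n : ℕ) : ℤ) + i = k) (a : 𝒜 n) (b : 𝒜 p) (m : obj i),
    act h'' ⟨(b : A) * (a : A), SetLike.GradedMul.mul_mem b.2 a.2⟩ m = act h' b (act h a m)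

attribute [instance] GrMod.addCommGroup GrMod.module

namespace GrMod

section

variable {R A : Type u} [CommRing R] [Ring A] [Algebra R A]
  {𝒜 : ℕ → Submodule R A} [SetLike.GradedMonoid 𝒜]

/-- Morphisms of graded modules: `A`-linear maps that preserve degrees. -/
@[ext]
structure Hom (M N : GrMod 𝒜) where
  app : ∀ i : ℤ, M.obj i →ₗ[R] N.obj i
  app_act : ∀ {n : ℕ} {i j : ℤ} (h : (n : ℤ) + i = j) (a : 𝒜 n) (m : M.obj i),
    app j (M.act h a m) = N.act h a (app i m)

instance : Category.{u} (GrMod 𝒜) where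
  Hom M N := Hom M N
  id M := { app := fun _ => LinearMap.id, app_act := fun _ _ _ => rfl }
  comp f g :=
    { app := fun i => (g.app i).comp (f.app i)
      app_act := fun h a m => by simp [f.app_act, g.app_act] }

@[ext]
theorem hom_ext {M N : GrMod 𝒜} {f g : M ⟶ N} (h : ∀ i m, f.app i m = g.app i m) : f = g :=
  Hom.ext (funext fun i => LinearMap.ext (h i))

@[simp]
theorem id_app (M : GrMod 𝒜) (i : ℤ) : Hom.app (𝟙 M) i = LinearMap.id := rfl

@[simp]
theorem comp_app {M N P : GrMod 𝒜} (f : M ⟶ N) (g : N ⟶ P) (i : ℤ) :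
    Hom.app (f ≫ g) i = (g.app i).comp (f.app i) := rfl

instance (M N : GrMod 𝒜) : Zero (M ⟶ N) :=
  ⟨{ app := fun _ => 0, app_act := fun _ _ _ => by simp }⟩
instance (M N : GrMod 𝒜) : Add (M ⟶ N) :=
  ⟨fun f g => { app := fun i => f.app i + g.app i
                app_act := fun h a m => by simp [f.app_act, g.app_act] }⟩
instance (M N : GrMod 𝒜) : Neg (M ⟶ N) :=
  ⟨fun f => { app := fun i => -f.app i, app_act := fun h a m => by simp [f.app_act] }⟩
instance (M N : GrMod 𝒜) : SMul R (M ⟶ N) :=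
  ⟨fun r f => { app := fun i => r • f.app i, app_act := fun h a m => by simp [f.app_act] }⟩

@[simp] theorem zero_app (M N : GrMod 𝒜) (i : ℤ) : Hom.app (0 : M ⟶ N) i = 0 := rfl
@[simp] theorem add_app {M N : GrMod 𝒜} (f g : M ⟶ N) (i : ℤ) :
    (f + g).app i = f.app i + g.app i := rfl
@[simp] theorem neg_app {M N : GrMod 𝒜} (f : M ⟶ N) (i : ℤ) : (-f).app i = -f.app i := rfl
@[simp] theorem smul_app {M N : GrMod 𝒜} (r : R) (f : M ⟶ N) (i : ℤ) :
    (r • f).app i = r • f.app i := rfl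

instance (M N : GrMod 𝒜) : AddCommGroup (M ⟶ N) where
  add_assoc f g h := by ext; simp [add_assoc]
  zero_add f := by ext; simp
  add_zero f := by ext; simp
  add_comm f g := by ext; simp [add_comm]
  neg_add_cancel f := by ext; simp
  nsmul := nsmulRec
  zsmul := zsmulRec

instance (M N : GrMod 𝒜) : Module R (M ⟶ N) where
  one_smul f := by ext; simp
  mul_smul r s f := by ext; simp [mul_smul]
  smul_zero r := by ext; simp
  smul_add r f g := by ext; simp
  add_smul r s f := by ext; simp [add_smul]
  zero_smul f := by ext; simp

instance : Preadditive (GrMod 𝒜) where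
  add_comp _ _ _ f g h := by ext; simp
  comp_add _ _ _ f g h := by ext; simp

instance : Linear R (GrMod 𝒜) where
  smul_comp _ _ _ r f g := by ext; simp
  comp_smul _ _ _ f r g := by ext; simp

/-- The graded submodule given by a family of submodules that is stable under the action. -/
@[simps! obj]
def sub (M : GrMod 𝒜) (S : ∀ i, Submodule R (M.obj i))
    (hS : ∀ {n : ℕ} {i j : ℤ} (h : (n : ℤ) + i = j) (a : 𝒜 n) (m : M.obj i),
      m ∈ S i → M.act h a m ∈ S j) : GrMod 𝒜 where
  obj i := S i
  act {n i j} h := LinearMap.mk₂ R (fun a m => ⟨M.act h a m, hS h a m m.2⟩)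
    (fun _ _ _ => Subtype.ext (by simp)) (fun _ _ _ => Subtype.ext (by simp))
    (fun _ _ _ => Subtype.ext (by simp)) (fun _ _ _ => Subtype.ext (by simp))
  one_act h m := Subtype.ext (M.one_act h m)
  mul_act h h' h'' a b m := Subtype.ext (M.mul_act h h' h'' a b m)

/-- The quotient by a graded submodule. -/
@[simps! obj]
def quot (M : GrMod 𝒜) (S : ∀ i, Submodule R (M.obj i))
    (hS : ∀ {n : ℕ} {i j : ℤ} (h : (n : ℤ) + i = j) (a : 𝒜 n) (m : M.obj i),
      m ∈ S i → M.act h a m ∈ S j) : GrMod 𝒜 where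
  obj i := M.obj i ⧸ S i
  act {n i j} h :=
    { toFun := fun a => (S i).mapQ (S j) (M.act h a) (hS h a)
      map_add' := fun a b => by ext; simp
      map_smul' := fun r a => by ext; simp }
  one_act h m := by
    induction m using Submodule.Quotient.induction_on with
    | H m => exact congrArg _ (M.one_act h m)
  mul_act h h' h'' a b m := by
    induction m using Submodule.Quotient.induction_on with
    | H m => exact congrArg _ (M.mul_act h h' h'' a b m)

/-- The direct sum of two graded modules. -/
@[simps! obj]
def prod (M N : GrMod 𝒜) : GrMod 𝒜 where
  obj i := M.obj i × N.obj i
  act {n i j} h := LinearMap.mk₂ R (fun a m => (M.act h a m.1, N.act h a m.2))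
    (fun _ _ _ => by simp) (fun _ _ _ => by simp)
    (fun _ _ _ => by simp) (fun _ _ _ => by simp)
  one_act h m := Prod.ext (M.one_act h m.1) (N.one_act h m.2)
  mul_act h h' h'' a b m := Prod.ext (M.mul_act h h' h'' a b m.1) (N.mul_act h h' h'' a b m.2)

instance : HasZeroObject (GrMod 𝒜) where
  zero := ⟨{ obj := fun _ => PUnit, act := fun _ => 0, one_act := fun _ _ => rfl
             mul_act := fun _ _ _ _ _ _ => rfl },
    { unique_to := fun X => ⟨⟨⟨0⟩, fun f => by
        ext i m; exact (congrArg _ (Subsingleton.elim m 0)).trans ((f.app i).map_zero)⟩⟩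
      unique_from := fun X => ⟨⟨⟨0⟩, fun f => by ext⟩⟩ }⟩

instance : HasBinaryBiproducts (GrMod 𝒜) where
  has_binary_biproduct M N := hasBinaryBiproduct_of_total
    { pt := prod M N
      fst := { app := fun i => LinearMap.fst R _ _, app_act := fun _ _ _ => rfl }
      snd := { app := fun i => LinearMap.snd R _ _, app_act := fun _ _ _ => rfl }
      inl := { app := fun i => LinearMap.inl R _ _
               app_act := fun h a m => Prod.ext rfl (LinearMap.map_zero (N.act h a)).symm }
      inr := { app := fun i => LinearMap.inr R _ _
               app_act := fun h a m => Prod.ext (LinearMap.map_zero (M.act h a)).symm rfl }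
      inl_fst := rfl
      inl_snd := rfl
      inr_fst := rfl
      inr_snd := rfl }
    (by ext i m; exact Prod.ext (add_zero m.1) (zero_add m.2))

instance : HasFiniteProducts (GrMod 𝒜) := hasFiniteProducts_of_has_binary_and_terminal

/-- A degreewise injective morphism with image `ker g` is a kernel of `g`. -/
theorem isLimit_of_exact {K M N : GrMod 𝒜} (k : K ⟶ M) (g : M ⟶ N) (w : k ≫ g = 0)
    (hk : ∀ i, Function.Injective (k.app i)) (hg : ∀ i, Function.Exact (k.app i) (g.app i)) :
    Nonempty (IsLimit (KernelFork.ofι k w)) := by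
  have key : ∀ {T : GrMod 𝒜} (t : T ⟶ M), t ≫ g = 0 → ∃ l : T ⟶ K, l ≫ k = t := by
    intro T t ht
    have hr : ∀ i x, t.app i x ∈ LinearMap.range (k.app i) := fun i x =>
      (hg i _).1 (by simpa using congrArg (fun φ : T ⟶ N => φ.app i x) ht)
    let l : ∀ i, T.obj i →ₗ[R] K.obj i := fun i =>
      (LinearEquiv.ofInjective (k.app i) (hk i)).symm.toLinearMap ∘ₗ
        (t.app i).codRestrict (LinearMap.range (k.app i)) (hr i)
    have hl : ∀ i x, k.app i (l i x) = t.app i x := fun i x =>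
      congrArg Subtype.val ((LinearEquiv.ofInjective (k.app i) (hk i)).apply_symm_apply
        ((t.app i).codRestrict (LinearMap.range (k.app i)) (hr i) x))
    refine ⟨{ app := l, app_act := fun h a m => hk _ ?_ }, ?_⟩
    · rw [hl, k.app_act, hl, t.app_act]
    · ext i x
      exact hl i x
  choose l hl using @key
  exact ⟨KernelFork.IsLimit.ofι k w (fun t ht => l t ht) (fun t ht => hl t ht)
    (fun t ht m hm => by
      ext i x
      refine hk i ?_
      have := congrArg (fun φ => Hom.app φ i x) (hm.trans (hl t ht).symm)
      simpa using this)⟩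

/-- A degreewise surjective morphism with kernel `range k` is a cokernel of `k`. -/
theorem isColimit_of_exact {K M N : GrMod 𝒜} (k : K ⟶ M) (g : M ⟶ N) (w : k ≫ g = 0)
    (hs : ∀ i, Function.Surjective (g.app i)) (hg : ∀ i, Function.Exact (k.app i) (g.app i)) :
    Nonempty (IsColimit (CokernelCofork.ofπ g w)) := by
  have key : ∀ {T : GrMod 𝒜} (t : M ⟶ T), k ≫ t = 0 → ∃ l : N ⟶ T, g ≫ l = t := by
    intro T t ht
    have hr : ∀ i, LinearMap.ker (g.app i) ≤ LinearMap.ker (t.app i) := by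
      intro i x hx
      obtain ⟨y, rfl⟩ := (hg i x).1 hx
      simpa using congrArg (fun φ : K ⟶ T => φ.app i y) ht
    let l : ∀ i, N.obj i →ₗ[R] T.obj i := fun i =>
      (LinearMap.ker (g.app i)).liftQ (t.app i) (hr i) ∘ₗ
        ((g.app i).quotKerEquivOfSurjective (hs i)).symm.toLinearMap
    have hl : ∀ i x, l i (g.app i x) = t.app i x := fun i x => by
      have : ((g.app i).quotKerEquivOfSurjective (hs i)).symm (g.app i x) =
          Submodule.Quotient.mk x := (LinearEquiv.symm_apply_eq _).2 rfl
      change (LinearMap.ker (g.app i)).liftQ (t.app i) (hr i)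
        (((g.app i).quotKerEquivOfSurjective (hs i)).symm (g.app i x)) = _
      rw [this]
      rfl
    refine ⟨{ app := l, app_act := fun h a m => ?_ }, ?_⟩
    · obtain ⟨x, rfl⟩ := hs _ m
      rw [← g.app_act, hl, hl, t.app_act]
    · ext i x
      exact hl i x
  choose l hl using @key
  exact ⟨CokernelCofork.IsColimit.ofπ g w (fun t ht => l t ht) (fun t ht => hl t ht)
    (fun t ht m hm => by
      ext i x
      obtain ⟨x, rfl⟩ := hs i x
      have := congrArg (fun φ => Hom.app φ i x) (hm.trans (hl t ht).symm)
      simpa using this)⟩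

/-- The category of graded modules is abelian. -/
noncomputable instance : Abelian (GrMod 𝒜) := Abelian.mk' fun X Y f => by
  have hK : ∀ {n : ℕ} {i j : ℤ} (h : (n : ℤ) + i = j) (a : 𝒜 n) (m : X.obj i),
      m ∈ LinearMap.ker (f.app i) → X.act h a m ∈ LinearMap.ker (f.app j) := by
    intro n i j h a m hm
    rw [LinearMap.mem_ker] at hm ⊢
    rw [f.app_act, hm, map_zero]
  have hR : ∀ {n : ℕ} {i j : ℤ} (h : (n : ℤ) + i = j) (a : 𝒜 n) (m : Y.obj i),
      m ∈ LinearMap.range (f.app i) → Y.act h a m ∈ LinearMap.range (f.app j) := by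
    rintro n i j h a _ ⟨x, rfl⟩
    exact ⟨X.act h a x, f.app_act h a x⟩
  let K := sub X (fun i => LinearMap.ker (f.app i)) hK
  let I := sub Y (fun i => LinearMap.range (f.app i)) hR
  let Q := quot Y (fun i => LinearMap.range (f.app i)) hR
  let k : K ⟶ X := { app := fun i => (LinearMap.ker (f.app i)).subtype, app_act := fun _ _ _ => rfl }
  let p : X ⟶ I := { app := fun i => (f.app i).rangeRestrict
                     app_act := fun h a m => Subtype.ext (f.app_act h a m) }
  let ι : I ⟶ Y := { app := fun i => (LinearMap.range (f.app i)).subtype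
                     app_act := fun _ _ _ => rfl }
  let q : Y ⟶ Q := { app := fun i => (LinearMap.range (f.app i)).mkQ, app_act := fun _ _ _ => rfl }
  have kf : k ≫ f = 0 := by ext i x; exact x.2
  have fq : f ≫ q = 0 := by
    ext i x; exact (Submodule.Quotient.mk_eq_zero _).2 (LinearMap.mem_range_self (f.app i) x)
  have kp : k ≫ p = 0 := by ext i x; exact Subtype.ext x.2
  have iq : ι ≫ q = 0 := by ext i x; exact (Submodule.Quotient.mk_eq_zero _).2 x.2
  have ek : ∀ i (x : X.obj i), f.app i x = 0 ↔ x ∈ Set.range (k.app i) := fun i x =>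
    ⟨fun h => ⟨⟨x, h⟩, rfl⟩, fun ⟨y, hy⟩ => hy ▸ y.2⟩
  obtain ⟨h1⟩ := isLimit_of_exact k f kf (fun i => Subtype.val_injective) ek
  obtain ⟨h2⟩ := isColimit_of_exact f q fq (fun i => Submodule.mkQ_surjective _)
    (fun i x => (Submodule.Quotient.mk_eq_zero _))
  obtain ⟨h3⟩ := isColimit_of_exact k p kp (fun i => LinearMap.surjective_rangeRestrict _)
    (fun i x => Subtype.ext_iff.trans (ek i x))
  obtain ⟨h4⟩ := isLimit_of_exact ι q iq (fun i => Subtype.val_injective)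
    (fun i x => (Submodule.Quotient.mk_eq_zero _).trans
      ⟨fun h => ⟨⟨x, h⟩, rfl⟩, fun ⟨y, hy⟩ => hy ▸ y.2⟩)
  exact ⟨{ kernelFork := _
           isLimitKernelFork := h1
           cokernelCofork := _
           isColimitCokernelCofork := h2
           image := I
           imageπ := p
           ι_imageπ := kp
           imageIsCokernel := h3
           imageι := ι
           imageι_π := iq
           imageIsKernel := h4
           fac := rfl }⟩

instance : HasExt.{u + 1} (GrMod 𝒜) := HasExt.standard _

/-- `M` is generated, as a graded `A`-module, by finitely many elements of degree `d`. -/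
def FinGeneratedInDegree (M : GrMod 𝒜) (d : ℤ) : Prop :=
  ∃ s : Finset (M.obj d), ∀ j : ℤ,
    Submodule.span R {x : M.obj j | ∃ (n : ℕ) (h : (n : ℤ) + d = j) (a : 𝒜 n) (y : M.obj d),
      y ∈ s ∧ x = M.act h a y} = ⊤

/-- For an algebra homomorphism `ε : A → R` that kills all elements of positive degree, the graded
`A`-module `R`, on which `A` acts through `ε`, placed in degree `d`. -/
def ofAugmentation (ε : A →ₐ[R] R) (hε : ∀ n : ℕ, n ≠ 0 → ∀ a ∈ 𝒜 n, ε a = 0) (d : ℤ) :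
    GrMod 𝒜 where
  obj i := (if i = d then ⊤ else ⊥ : Submodule R R)
  act {n i j} h := LinearMap.mk₂ R
    (fun a m => ⟨ε a * (m : R), by
      by_cases hj : j = d
      · simp [hj]
      · by_cases hi : i = d
        · have hn : n ≠ 0 := by rintro rfl; exact hj (by simpa [hi] using h.symm)
          simp [hε n hn a a.2]
        · have hm : (m : R) = 0 := by
            have key : ∀ x ∈ (if i = d then ⊤ else ⊥ : Submodule R R), x = 0 := by simp [hi]
            exact key m m.2
          simp [hm]⟩)
    (fun _ _ _ => Subtype.ext (by simp [add_mul]))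
    (fun _ _ _ => Subtype.ext (by simp [mul_assoc]))
    (fun _ _ _ => Subtype.ext (by simp [mul_add]))
    (fun _ _ _ => Subtype.ext (by simp [mul_left_comm]))
  one_act h m := Subtype.ext (by simp)
  mul_act h h' h'' a b m := Subtype.ext (by simp [mul_assoc])

end

end GrMod

/-! ### Quadratic algebras -/

section Quadratic

variable {R V : Type u} [CommRing R] [AddCommGroup V] [Module R V]

/-- The canonical map `V ⊗ V → T(V)` onto the part of degree two of the tensor algebra. -/
noncomputable def tensorSquareToTensorAlgebra (R V : Type u) [CommRing R] [AddCommGroup V]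
    [Module R V] : V ⊗[R] V →ₗ[R] TensorAlgebra R V :=
  LinearMap.mul' R (TensorAlgebra R V) ∘ₗ
    TensorProduct.map (TensorAlgebra.ι R) (TensorAlgebra.ι R)

/-- The relations `t = 0` for `t ∈ I ⊆ V ⊗ V`. -/
inductive QuadAlg.Rel (I : Submodule R (V ⊗[R] V)) : TensorAlgebra R V → TensorAlgebra R V → Prop
  | of (t : V ⊗[R] V) (ht : t ∈ I) : QuadAlg.Rel I (tensorSquareToTensorAlgebra R V t) 0

/-- The quadratic algebra of the triple `(R, V, I)`: the quotient of the tensor algebra of `V` over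
`R` by the two-sided ideal generated by `I ⊆ V ⊗ V`. -/
def QuadAlg (I : Submodule R (V ⊗[R] V)) : Type u := RingQuot (QuadAlg.Rel I)

namespace QuadAlg

variable (I : Submodule R (V ⊗[R] V))

noncomputable instance : Ring (QuadAlg I) := inferInstanceAs (Ring (RingQuot (QuadAlg.Rel I)))

noncomputable instance : Algebra R (QuadAlg I) :=
  inferInstanceAs (Algebra R (RingQuot (QuadAlg.Rel I)))

/-- The canonical map `V → A`. -/
noncomputable def ι : V →ₗ[R] QuadAlg I :=
  (RingQuot.mkAlgHom R (QuadAlg.Rel I)).toLinearMap ∘ₗ TensorAlgebra.ι R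

/-- The homogeneous component of degree `n`: the image of `V ^ ⊗ n`. -/
noncomputable def comp (n : ℕ) : Submodule R (QuadAlg I) := LinearMap.range (ι I) ^ n

instance : SetLike.GradedMonoid (comp I) :=
  Submodule.nat_power_gradedMonoid (LinearMap.range (ι I))

/-- The projection `A → A₀ = R`, which sends `V` to zero. -/
noncomputable def aug : QuadAlg I →ₐ[R] R :=
  RingQuot.liftAlgHom R ⟨TensorAlgebra.lift R (0 : V →ₗ[R] R), by
    rintro _ _ ⟨t, -⟩
    rw [map_zero (TensorAlgebra.lift R (0 : V →ₗ[R] R))]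
    induction t using TensorProduct.induction_on with
    | zero => simp
    | tmul v w => simp [tensorSquareToTensorAlgebra]
    | add x y hx hy => rw [map_add, map_add, hx, hy, add_zero]⟩

theorem aug_ι (v : V) : aug I (ι I v) = 0 := by
  refine (RingQuot.liftAlgHom_mkAlgHom_apply R _ _ _).trans ?_
  simp

theorem aug_eq_zero (n : ℕ) (hn : n ≠ 0) (a : QuadAlg I) (ha : a ∈ comp I n) : aug I a = 0 := by
  have h1 : LinearMap.range (ι I) ≤ LinearMap.ker (aug I).toLinearMap := by
    rintro _ ⟨v, rfl⟩
    exact aug_ι I v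
  obtain ⟨m, rfl⟩ := Nat.exists_eq_succ_of_ne_zero hn
  rw [comp, pow_succ] at ha
  refine Submodule.mul_induction_on ha (fun x _ y hy => ?_) (fun x y hx hy => ?_)
  · have : aug I y = 0 := h1 hy
    rw [map_mul, this, mul_zero]
  · rw [map_add, hx, hy, add_zero]

/-- The left `A`-module `A₀ = R`, as an object of the category of all left `A`-modules. -/
noncomputable def baseModule : ModuleCat.{u} (QuadAlg I) :=
  (ModuleCat.restrictScalars (aug I).toRingHom).obj (ModuleCat.of R R)

/-- The graded left `A`-module `A₀[-d]`, that is `A₀ = R` placed in degree `d`. -/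
noncomputable def grBaseModule (d : ℤ) : GrMod (comp I) :=
  GrMod.ofAugmentation (aug I) (aug_eq_zero I) d

/-- `A` is Koszul: the graded left `A`-module `A₀` has a resolution `⋯ → M₁ → M₀ → A₀ → 0` by
projective objects of the category of graded left `A`-modules such that each `Mᵢ` is generated by
finitely many elements of degree `i`. -/
def IsKoszul : Prop :=
  ∃ P : ProjectiveResolution (grBaseModule I 0),
    ∀ i : ℕ, (P.complex.X i).FinGeneratedInDegree (i : ℤ)

/-- All homogeneous components of `A` are flat over `A₀ = R`. -/
def HasFlatComponents : Prop := ∀ n : ℕ, Module.Flat R (comp I n)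

end QuadAlg

/-- The relations of the quadratic dual: those elements of `V* ⊗ V*` whose pairing with all elements
of `I ⊆ V ⊗ V` vanishes, for the pairing `⟨f ⊗ g, v ⊗ w⟩ = f v * g w`. -/
noncomputable def dualRelations (I : Submodule R (V ⊗[R] V)) :
    Submodule R (Module.Dual R V ⊗[R] Module.Dual R V) :=
  I.dualAnnihilator.comap (TensorProduct.dualDistrib R V V)

/-- A family of `R`-linear isomorphisms `Extⁱ_A(A₀, A₀) ≅ Bᵢ`, for all `i`, that is an isomorphism
of graded algebras from the Yoneda algebra to the opposite of `B`. Here `Ext` is taken in the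
category of all left `A`-modules, and `B` is the quadratic algebra with relations `J`. -/
structure ExtAlgEquivOp {W : Type u} [AddCommGroup W] [Module R W]
    (I : Submodule R (V ⊗[R] V)) (J : Submodule R (W ⊗[R] W)) where
  equiv : ∀ i : ℕ,
    Ext.{u} (QuadAlg.baseModule I) (QuadAlg.baseModule I) i ≃ₗ[R] QuadAlg.comp J i
  map_one : (equiv 0 (Ext.mk₀ (𝟙 (QuadAlg.baseModule I))) : QuadAlg J) = 1
  map_comp : ∀ (i j k : ℕ) (h : i + j = k)
    (α : Ext.{u} (QuadAlg.baseModule I) (QuadAlg.baseModule I) i)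
    (β : Ext.{u} (QuadAlg.baseModule I) (QuadAlg.baseModule I) j),
    (equiv k (α.comp β h) : QuadAlg J) = (equiv j β : QuadAlg J) * (equiv i α : QuadAlg J)

/-- For all `i`, the graded group `⨁_d Extⁱ(A₀, A₀[-d])`, formed in the category of graded left
`A`-modules, is concentrated in internal degree `d = i`, where it is isomorphic to `Bᵢ`. -/
def GrExtIsDiagonal {W : Type u} [AddCommGroup W] [Module R W]
    (I : Submodule R (V ⊗[R] V)) (J : Submodule R (W ⊗[R] W)) : Prop :=
  ∀ i : ℕ,
    (∀ d : ℤ, d ≠ i → Subsingleton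
      (Ext.{u + 1} (QuadAlg.grBaseModule I 0) (QuadAlg.grBaseModule I d) i)) ∧
    Nonempty (Ext.{u + 1} (QuadAlg.grBaseModule I 0) (QuadAlg.grBaseModule I (i : ℤ)) i ≃ₗ[R]
      QuadAlg.comp J i)

end Quadratic

/-!
Write `A` for the quadratic algebra of `(V, I)` and `B` for that of the dual data `(V*, I^⊥)`, and
let `vₖ`, `wₖ` be dual bases of `V` and `V*`. The left Koszul complex of `A` has the terms `Hom(Bᵢ,
A)`, which are placed so that the values of elements of degree `j` lie in `A_{j - i}`, and the
differential `ψ ↦ ∑ₖ ψ(wₖ ·) vₖ`. It is the direct sum of strands `⋯ → Hom(Bᵢ₊₁, Aₚ) → Hom(Bᵢ, Aₚ₊₁)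
→ ⋯`. The proof shows, for `A` with free components (over a discrete valuation ring, finitely
generated flat modules are free), that `A` is Koszul if and only if this complex is exact
(`QuadDual.LeftExact`), and that the latter condition is symmetric in `A` and `B`.

*Koszul algebras and exactness.* Modulo torsion `Bᵢ` is free and `A` is torsion free, so `Hom(Bᵢ,
A)` is a finitely generated free graded module with generators in degree `i`
(`QuadDual.CoordFamily`). If the complex is exact, it is therefore a linear resolution
(`QuadDual.isKoszul_of_leftExact`). Conversely, suppose that `A₀` has some linear resolution and
that the complex is exact up to `Hom(Bₙ, A)`, with module of cycles `Z`. The cokernel `N` of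
`Hom(Bₙ₊₁, A) → Z` vanishes in degrees `n` and `n + 1`: in degree `n` there are no cycles, and in
degree `n + 1` exactness follows from the presentation of `B`
(`QuadDual.exists_dl_eq_of_degree_one`). The linear resolution shows that `Extⁿ⁺¹(A₀, N) = 0`, so `Z
→ N` extends to `Hom(Bₙ, A)`, which is generated in degree `n`; thus it is zero, and `N = 0`
(`QuadDual.leftExactAt_of_isKoszul`).

*Symmetry.* If the left Koszul complex is exact, so is the right one, with differential `ψ ↦ ∑ₖ vₖ
ψ(· wₖ)`, by a chase in the double complex `Hom(Bᵢ, Aₚ ⊗ A_q)`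
(`QuadDual.rightExactAt_of_leftExact`). Under the trace pairing of `Hom(Bᵢ, A_q)` and `Hom(A_q, Bᵢ)`
the right Koszul complex of `A` is dual to the left Koszul complex of `B`
(`QuadDual.trace_comp_dr`). Its boundaries are saturated, since they are cycles of a complex of
torsion-free modules, hence direct summands over a principal ideal domain, and exactness passes to
the dual complex. A torsion element of `B` defines an element of the left Koszul complex of `B` that
is orthogonal to all boundaries of the right complex of `A`; in the same way it is a boundary, so
the torsion element vanishes and `B` has free components (`QuadDual.free_comp_of_leftExact`,
`QuadDual.LeftExact.symm`).

*The Ext groups.* The Koszul complex is minimal: every map from `Hom(Bₙ, A)` to `A₀` is the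
evaluation `ψ ↦ ε(ψ(β))` at some `β ∈ Bₙ` and vanishes on cycles. So `Extⁿ(A₀, A₀)` is the module of
these maps (`SyzygySeq.extHomEquiv`), both for all modules and for graded modules, where only the
shift by `n` admits nonzero maps. The class of `β ∈ Bₘ` lifts to the map of complexes `ψ ↦ ψ(· β)`
from `Hom(Bₘ₊ₙ, A)` to `Hom(Bₙ, A)`, so the Yoneda product of `β`, applied first, and `γ`
is the class of `γ β` (`QuadDual.extEquivComp_comp`).
-/

/-! ### The grading of a quadratic algebra -/

namespace QuadAlg

section Basic

open scoped DirectSum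

variable {R V : Type u} [CommRing R] [AddCommGroup V] [Module R V] (I : Submodule R (V ⊗[R] V))

theorem algHom_comp_tensorSquare {S T : Type*} [Semiring S] [Algebra R S] [Semiring T] [Algebra R T]
    (φ : S →ₐ[R] T) (f : V →ₗ[R] S) (t : V ⊗[R] V) :
    φ (LinearMap.mul' R S (TensorProduct.map f f t)) =
      LinearMap.mul' R T (TensorProduct.map (φ.toLinearMap ∘ₗ f) (φ.toLinearMap ∘ₗ f) t) := by
  induction t using TensorProduct.induction_on with
  | zero => simp
  | tmul v w => simp
  | add x y hx hy => simp [hx, hy]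

/-- The universal property of the quadratic algebra. -/
noncomputable def lift {S : Type*} [Semiring S] [Algebra R S] (f : V →ₗ[R] S)
    (hf : ∀ t ∈ I, LinearMap.mul' R S (TensorProduct.map f f t) = 0) : QuadAlg I →ₐ[R] S :=
  RingQuot.liftAlgHom R ⟨TensorAlgebra.lift R f, by
    rintro _ _ ⟨t, ht⟩
    rw [map_zero (TensorAlgebra.lift R f), ← hf t ht, tensorSquareToTensorAlgebra,
      LinearMap.comp_apply, algHom_comp_tensorSquare]
    congr 3 <;> ext v <;> simp⟩

@[simp]
theorem lift_ι {S : Type*} [Semiring S] [Algebra R S] (f : V →ₗ[R] S)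
    (hf : ∀ t ∈ I, LinearMap.mul' R S (TensorProduct.map f f t) = 0) (v : V) :
    lift I f hf (ι I v) = f v := by
  refine (RingQuot.liftAlgHom_mkAlgHom_apply R _ _ _).trans ?_
  simp

theorem algHom_ext {S : Type*} [Semiring S] [Algebra R S] {f g : QuadAlg I →ₐ[R] S}
    (h : ∀ v, f (ι I v) = g (ι I v)) : f = g := by
  refine RingQuot.ringQuot_ext' R f g ?_
  ext v
  exact h v

theorem mul_ι_ι_eq_zero (t : V ⊗[R] V) (ht : t ∈ I) :
    LinearMap.mul' R (QuadAlg I) (TensorProduct.map (ι I) (ι I) t) = 0 := by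
  have h := RingQuot.mkAlgHom_rel R (QuadAlg.Rel.of (I := I) t ht)
  rw [map_zero, tensorSquareToTensorAlgebra, LinearMap.comp_apply,
    algHom_comp_tensorSquare] at h
  exact h

theorem ι_mem (v : V) : ι I v ∈ comp I 1 := by
  rw [comp, pow_one]; exact LinearMap.mem_range_self _ v

theorem algebraMap_mem (r : R) : algebraMap R (QuadAlg I) r ∈ comp I 0 := by
  rw [comp, pow_zero]; exact Submodule.mem_one.2 ⟨r, rfl⟩

theorem ι_mul_mem {n : ℕ} {a : QuadAlg I} (v : V) (ha : a ∈ comp I n) :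
    ι I v * a ∈ comp I (n + 1) := by
  have := SetLike.GradedMul.mul_mem (A := comp I) (ι_mem I v) ha
  rwa [add_comm] at this

theorem comp_induction {p : ∀ (n : ℕ) (a : QuadAlg I), a ∈ comp I n → Prop}
    (h0 : ∀ r, p 0 _ (algebraMap_mem I r))
    (hadd : ∀ n a b (ha : a ∈ comp I n) (hb : b ∈ comp I n), p n a ha → p n b hb →
      p n (a + b) (add_mem ha hb))
    (hmul : ∀ n v a (ha : a ∈ comp I n), p n a ha → p (n + 1) _ (ι_mul_mem I v ha))
    (n : ℕ) (a : QuadAlg I) (ha : a ∈ comp I n) : p n a ha := by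
  refine Submodule.pow_induction_on_left' (LinearMap.range (ι I)) (C := p) h0 ?_ ?_ ha
  · intro x y i hx hy
    exact hadd i x y hx hy
  · rintro _ ⟨v, rfl⟩ i x hx
    exact hmul i v x hx

theorem induction {p : QuadAlg I → Prop} (hR : ∀ r, p (algebraMap R _ r)) (hι : ∀ v, p (ι I v))
    (hadd : ∀ a b, p a → p b → p (a + b)) (hmul : ∀ a b, p a → p b → p (a * b))
    (a : QuadAlg I) : p a := by
  let S : Subalgebra R (QuadAlg I) :=
    { carrier := {a | p a}, mul_mem' := hmul _ _, add_mem' := hadd _ _, algebraMap_mem' := hR }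
  let f : V →ₗ[R] S := (ι I).codRestrict (Subalgebra.toSubmodule S) hι
  have hf : ∀ t ∈ I, LinearMap.mul' R S (TensorProduct.map f f t) = 0 := by
    intro t ht
    apply Subtype.val_injective
    refine (algHom_comp_tensorSquare S.val f t).trans ?_
    exact mul_ι_ι_eq_zero I t ht
  have h : S.val.comp (lift I f hf) = AlgHom.id R _ := algHom_ext I fun v => by
    rw [AlgHom.comp_apply, lift_ι]; rfl
  rw [← AlgHom.id_apply (R := R) a, ← h]
  exact (lift I f hf a).2

/-- The map of `V` to the component of degree one of the direct sum of the components. -/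
noncomputable def gradedι : V →ₗ[R] ⨁ n, comp I n :=
  DirectSum.lof R ℕ (fun n => comp I n) 1 ∘ₗ (ι I).codRestrict _ (ι_mem I)

theorem gradedι_apply (v : V) :
    gradedι I v = DirectSum.of (fun n => comp I n) 1 ⟨ι I v, ι_mem I v⟩ := rfl

theorem mul_gradedι_eq_zero (t : V ⊗[R] V) (ht : t ∈ I) :
    LinearMap.mul' R (⨁ n, comp I n) (TensorProduct.map (gradedι I) (gradedι I) t) = 0 := by
  have h2 : ∀ t : V ⊗[R] V,
      LinearMap.mul' R (QuadAlg I) (TensorProduct.map (ι I) (ι I) t) ∈ comp I 2 := by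
    intro t
    induction t using TensorProduct.induction_on with
    | zero => simp
    | tmul v w => exact SetLike.GradedMul.mul_mem (ι_mem I v) (ι_mem I w)
    | add x y hx hy => simpa using add_mem hx hy
  have key : ∀ t : V ⊗[R] V,
      LinearMap.mul' R (⨁ n, comp I n) (TensorProduct.map (gradedι I) (gradedι I) t) =
        DirectSum.of (fun n => comp I n) 2 ⟨_, h2 t⟩ := by
    intro t
    induction t using TensorProduct.induction_on with
    | zero =>
      simp only [map_zero]
      exact (map_zero (DirectSum.of (fun n => comp I n) 2)).symm
    | tmul v w =>
      simp only [TensorProduct.map_tmul, LinearMap.mul'_apply, gradedι_apply, DirectSum.of_mul_of]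
      rfl
    | add x y hx hy =>
      rw [map_add, map_add, hx, hy, ← map_add]
      congr 1
      exact Subtype.ext (by simp)
  rw [key, ← map_zero (DirectSum.of (fun n => comp I n) 2)]
  congr 1
  exact Subtype.ext (mul_ι_ι_eq_zero I t ht)

theorem lift_gradedι_of_mem (n : ℕ) (x : QuadAlg I) (hx : x ∈ comp I n) :
    lift I (gradedι I) (mul_gradedι_eq_zero I) x =
      DirectSum.of (fun n => comp I n) n ⟨x, hx⟩ := by
  refine comp_induction I (p := fun n x hx => lift I (gradedι I) (mul_gradedι_eq_zero I) x =
      DirectSum.of (fun n => comp I n) n ⟨x, hx⟩) ?_ ?_ ?_ n x hx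
  · intro r
    rw [AlgHom.commutes, DirectSum.algebraMap_apply]; rfl
  · intro n x y hx hy ihx ihy
    rw [map_add, ihx, ihy, ← map_add]
    rfl
  · intro n v x hx ih
    rw [map_mul, ih, lift_ι, gradedι_apply, DirectSum.of_mul_of]
    exact DirectSum.of_eq_of_gradedMonoid_eq (Sigma.subtype_ext (add_comm _ _) rfl)

/-- A quadratic algebra is the direct sum of its components: the universal property gives an algebra
map to the direct sum of the components that inverts the canonical map. -/
noncomputable instance gradedAlgebra : GradedAlgebra (comp I) :=
  GradedAlgebra.ofAlgHom (comp I) (lift I (gradedι I) (mul_gradedι_eq_zero I))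
    (algHom_ext I fun v => by
      rw [AlgHom.comp_apply, lift_ι, gradedι_apply, DirectSum.coeAlgHom_of]
      rfl)
    (fun i x => lift_gradedι_of_mem I i x x.2)

/-- The projection to the component of degree `n`. -/
noncomputable def toComp (n : ℕ) : QuadAlg I →ₗ[R] comp I n :=
  DirectSum.component R ℕ (fun n => comp I n) n ∘ₗ
    (DirectSum.decomposeLinearEquiv (comp I)).toLinearMap

theorem toComp_coe (n : ℕ) (a : comp I n) : toComp I n a = a :=
  Subtype.ext (DirectSum.decompose_of_mem_same (comp I) a.2)

theorem toComp_of_ne {m n : ℕ} (h : m ≠ n) {a : QuadAlg I} (ha : a ∈ comp I m) :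
    toComp I n a = 0 :=
  Subtype.ext (DirectSum.decompose_of_mem_ne (comp I) ha h)

theorem eq_algebraMap_of_mem {a : QuadAlg I} (ha : a ∈ comp I 0) :
    a = algebraMap R (QuadAlg I) (aug I a) := by
  rw [comp, pow_zero] at ha
  obtain ⟨r, rfl⟩ := Submodule.mem_one.1 ha
  rw [AlgHom.commutes]; rfl

/-- The component of degree zero is `R`. -/
noncomputable def compZeroEquiv : comp I 0 ≃ₗ[R] R :=
  LinearEquiv.ofBijective ((aug I).toLinearMap ∘ₗ (comp I 0).subtype)
    ⟨fun a b h => Subtype.ext (by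
        rw [eq_algebraMap_of_mem I a.2, eq_algebraMap_of_mem I b.2]; exact congrArg _ h),
      fun r => ⟨⟨algebraMap R _ r, algebraMap_mem I r⟩, (aug I).commutes r⟩⟩

theorem compZeroEquiv_apply (a : comp I 0) : compZeroEquiv I a = aug I a := rfl

theorem compZeroEquiv_symm_coe (r : R) :
    ((compZeroEquiv I).symm r : QuadAlg I) = algebraMap R _ r := by
  obtain ⟨a, rfl⟩ := (compZeroEquiv I).surjective r
  rw [LinearEquiv.symm_apply_apply]
  exact eq_algebraMap_of_mem I a.2

instance comp_finite [Module.Finite R V] (n : ℕ) : Module.Finite R (comp I n) :=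
  Module.Finite.iff_fg.2 (Submodule.FG.pow (by
    rw [LinearMap.range_eq_map]; exact Module.Finite.fg_top.map (ι I)) n)

/-- Left multiplication by elements of `V`, as a map between components. -/
noncomputable def lmul (n : ℕ) : V →ₗ[R] comp I n →ₗ[R] comp I (n + 1) :=
  LinearMap.mk₂ R (fun v a => ⟨ι I v * a, ι_mul_mem I v a.2⟩)
    (fun _ _ _ => Subtype.ext (by simp [add_mul])) (fun _ _ _ => Subtype.ext (by simp))
    (fun _ _ _ => Subtype.ext (by simp [mul_add])) (fun _ _ _ => Subtype.ext (by simp))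

/-- Right multiplication by elements of `V`, as a map between components. -/
noncomputable def rmul (n : ℕ) : V →ₗ[R] comp I n →ₗ[R] comp I (n + 1) :=
  LinearMap.mk₂ R (fun v a => ⟨a * ι I v, SetLike.GradedMul.mul_mem (A := comp I) a.2 (ι_mem I v)⟩)
    (fun _ _ _ => Subtype.ext (by simp [mul_add])) (fun _ _ _ => Subtype.ext (by simp))
    (fun _ _ _ => Subtype.ext (by simp [add_mul])) (fun _ _ _ => Subtype.ext (by simp))

@[simp]
theorem coe_lmul (n : ℕ) (v : V) (a : comp I n) : (lmul I n v a : QuadAlg I) = ι I v * a := rfl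

@[simp]
theorem coe_rmul (n : ℕ) (v : V) (a : comp I n) : (rmul I n v a : QuadAlg I) = a * ι I v := rfl

theorem lmul_rmul_comm (n : ℕ) (v w : V) (a : comp I n) :
    lmul I (n + 1) v (rmul I n w a) = rmul I (n + 1) w (lmul I n v a) :=
  Subtype.ext (by simp [mul_assoc])

theorem lift_lmul_surjective (n : ℕ) : Function.Surjective (TensorProduct.lift (lmul I n)) := by
  have : ∀ x ∈ comp I (n + 1), ∃ t, (TensorProduct.lift (lmul I n) t : QuadAlg I) = x := by
    intro x hx
    rw [comp, pow_succ'] at hx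
    refine Submodule.mul_induction_on hx ?_ ?_
    · rintro _ ⟨v, rfl⟩ a ha
      exact ⟨v ⊗ₜ ⟨a, ha⟩, by simp⟩
    · rintro x y ⟨s, rfl⟩ ⟨t, rfl⟩
      exact ⟨s + t, by simp⟩
  intro x
  obtain ⟨t, ht⟩ := this x x.2
  exact ⟨t, Subtype.ext ht⟩

theorem lift_rmul_surjective (n : ℕ) : Function.Surjective (TensorProduct.lift (rmul I n)) := by
  have : ∀ x ∈ comp I (n + 1), ∃ t, (TensorProduct.lift (rmul I n) t : QuadAlg I) = x := by
    intro x hx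
    rw [comp, pow_succ] at hx
    refine Submodule.mul_induction_on hx ?_ ?_
    · rintro a ha _ ⟨v, rfl⟩
      exact ⟨v ⊗ₜ ⟨a, ha⟩, by simp⟩
    · rintro x y ⟨s, rfl⟩ ⟨t, rfl⟩
      exact ⟨s + t, by simp⟩
  intro x
  obtain ⟨t, ht⟩ := this x x.2
  exact ⟨t, Subtype.ext ht⟩

/-! ### The presentation of a quadratic algebra as a left module -/

/-- Multiplication `V ⊗ A → A`. -/
noncomputable def mulι : V ⊗[R] QuadAlg I →ₗ[R] QuadAlg I :=
  TensorProduct.lift ((LinearMap.mul R (QuadAlg I)) ∘ₗ ι I)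

@[simp]
theorem mulι_tmul (v : V) (a : QuadAlg I) : mulι I (v ⊗ₜ a) = ι I v * a := by simp [mulι]

/-- The map `(V ⊗ V) ⊗ A → V ⊗ A`, `(v ⊗ w) ⊗ a ↦ v ⊗ w a`. -/
noncomputable def relMap : (V ⊗[R] V) ⊗[R] QuadAlg I →ₗ[R] V ⊗[R] QuadAlg I :=
  (mulι I).lTensor V ∘ₗ (TensorProduct.assoc R V V (QuadAlg I)).toLinearMap

@[simp]
theorem relMap_tmul (v w : V) (a : QuadAlg I) : relMap I ((v ⊗ₜ w) ⊗ₜ a) = v ⊗ₜ (ι I w * a) := by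
  simp [relMap]

/-- The image of `I ⊗ A` in `V ⊗ A`. -/
noncomputable def relRange : Submodule R (V ⊗[R] QuadAlg I) :=
  LinearMap.range (relMap I ∘ₗ I.subtype.rTensor (QuadAlg I))

theorem relMap_mem_relRange {t : V ⊗[R] V} (ht : t ∈ I) (a : QuadAlg I) :
    relMap I (t ⊗ₜ a) ∈ relRange I := ⟨(⟨t, ht⟩ : I) ⊗ₜ a, by simp⟩

theorem mulι_relMap (t : V ⊗[R] V) (a : QuadAlg I) :
    mulι I (relMap I (t ⊗ₜ a)) = LinearMap.mul' R _ (TensorProduct.map (ι I) (ι I) t) * a := by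
  induction t using TensorProduct.induction_on with
  | zero => simp
  | tmul v w => simp [mul_assoc]
  | add x y hx hy => simp [TensorProduct.add_tmul, add_mul, hx, hy]

theorem relRange_le_ker : relRange I ≤ LinearMap.ker (mulι I) := by
  rintro _ ⟨x, rfl⟩
  induction x using TensorProduct.induction_on with
  | zero => simp
  | tmul t a =>
    simp only [LinearMap.comp_apply, LinearMap.rTensor_tmul, Submodule.subtype_apply,
      LinearMap.mem_ker, mulι_relMap]
    rw [mul_ι_ι_eq_zero I t t.2, zero_mul]
  | add x y hx hy => rw [map_add]; exact add_mem hx hy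

/-- The module `R × (V ⊗ A) / (I ⊗ A)`, which turns out to be the free module `A`. -/
abbrev Pres : Type u := R × ((V ⊗[R] QuadAlg I) ⧸ relRange I)

/-- The map `R × (V ⊗ A) / (I ⊗ A) → A`. -/
noncomputable def presMul : Pres I →ₗ[R] QuadAlg I :=
  (Algebra.linearMap R (QuadAlg I)).coprod ((relRange I).liftQ (mulι I) (relRange_le_ker I))

/-- The action of `v ∈ V` on `R × (V ⊗ A) / (I ⊗ A)`. -/
noncomputable def presAct : V →ₗ[R] Module.End R (Pres I) :=
  LinearMap.mk₂ R (fun v x => (0, (relRange I).mkQ (v ⊗ₜ presMul I x)))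
    (fun _ _ _ => by simp [TensorProduct.add_tmul]) (fun _ _ _ => by
      simp [← TensorProduct.smul_tmul'])
    (fun _ _ _ => by simp only [map_add, TensorProduct.tmul_add, Prod.mk_add_mk, add_zero])
    (fun _ _ _ => by
      simp only [map_smul, TensorProduct.tmul_smul, Prod.smul_mk, smul_zero])

theorem presAct_apply (v : V) (x : Pres I) :
    presAct I v x = (0, (relRange I).mkQ (v ⊗ₜ presMul I x)) := rfl

theorem presMul_presAct (v : V) (x : Pres I) :
    presMul I (presAct I v x) = ι I v * presMul I x := by
  rw [presAct_apply]
  simp [presMul]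

theorem presAct_rel (t : V ⊗[R] V) (ht : t ∈ I) :
    LinearMap.mul' R (Module.End R (Pres I)) (TensorProduct.map (presAct I) (presAct I) t) = 0 := by
  have key : ∀ t : V ⊗[R] V, ∀ x : Pres I,
      LinearMap.mul' R (Module.End R (Pres I)) (TensorProduct.map (presAct I) (presAct I) t) x =
        (0, (relRange I).mkQ (relMap I (t ⊗ₜ presMul I x))) := by
    intro t x
    induction t using TensorProduct.induction_on with
    | zero => simp only [map_zero, TensorProduct.zero_tmul, LinearMap.zero_apply]; rfl
    | tmul v w =>
      simp only [TensorProduct.map_tmul, LinearMap.mul'_apply, Module.End.mul_apply, relMap_tmul]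
      rw [presAct_apply, presMul_presAct]
    | add y z hy hz =>
      rw [map_add, map_add, LinearMap.add_apply, hy, hz, TensorProduct.add_tmul, map_add, map_add]
      simp
  refine LinearMap.ext fun x => ?_
  rw [key, Submodule.mkQ_apply,
    (Submodule.Quotient.mk_eq_zero _).2 (relMap_mem_relRange I ht (presMul I x))]
  rfl

/-- The action of `A` on `R × (V ⊗ A) / (I ⊗ A)`. -/
noncomputable def presHom : QuadAlg I →ₐ[R] Module.End R (Pres I) :=
  lift I (presAct I) (presAct_rel I)

theorem presMul_presHom (a : QuadAlg I) (x : Pres I) :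
    presMul I (presHom I a x) = a * presMul I x := by
  induction a using QuadAlg.induction generalizing x with
  | hR r => rw [AlgHom.commutes, Module.algebraMap_end_apply, map_smul, Algebra.smul_def]
  | hι v => rw [presHom, lift_ι, presMul_presAct]
  | hadd a b ha hb => rw [map_add, LinearMap.add_apply, map_add, ha, hb, add_mul]
  | hmul a b ha hb => rw [map_mul, Module.End.mul_apply, ha, hb, mul_assoc]

/-- The kernel of the multiplication `V ⊗ A → A` is the image of `I ⊗ A`: the algebra `A` acts on
`R × (V ⊗ A) / (I ⊗ A)`, and the orbit map of `(1, 0)` recovers the class of `x ∈ V ⊗ A` from its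
product in `A`. -/
theorem ker_mulι : LinearMap.ker (mulι I) = relRange I := by
  refine le_antisymm (fun x hx => ?_) (relRange_le_ker I)
  have key : ∀ x : V ⊗[R] QuadAlg I,
      presHom I (mulι I x) (1, 0) = (0, (relRange I).mkQ x) := by
    intro x
    induction x using TensorProduct.induction_on with
    | zero => simp only [map_zero, LinearMap.zero_apply]; rfl
    | tmul v a =>
      have h : presHom I (ι I v) = presAct I v := lift_ι I _ _ v
      rw [mulι_tmul, map_mul, h, Module.End.mul_apply, presAct_apply, presMul_presHom]
      simp [presMul]
    | add x y hx hy =>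
      rw [map_add, map_add, LinearMap.add_apply, hx, hy, map_add]
      simp
  have h := key x
  rw [LinearMap.mem_ker.1 hx, map_zero, LinearMap.zero_apply] at h
  exact (Submodule.Quotient.mk_eq_zero _).1 (congrArg Prod.snd h).symm

/-- The relations are of degree two, so none is imposed on `V`. -/
theorem ι_injective : Function.Injective (ι I) := by
  rw [← LinearMap.ker_eq_bot, LinearMap.ker_eq_bot']
  intro v hv
  have h1 : v ⊗ₜ[R] (1 : QuadAlg I) ∈ relRange I := by
    rw [← ker_mulι, LinearMap.mem_ker, mulι_tmul, hv, zero_mul]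
  have h2 : ∀ x ∈ relRange I, TensorProduct.rid R V ((aug I).toLinearMap.lTensor V x) = 0 := by
    rintro _ ⟨x, rfl⟩
    have : ∀ y : (V ⊗[R] V) ⊗[R] QuadAlg I,
        TensorProduct.rid R V ((aug I).toLinearMap.lTensor V (relMap I y)) = 0 := by
      intro y
      induction y using TensorProduct.induction_on with
      | zero => simp
      | tmul t a =>
        induction t using TensorProduct.induction_on with
        | zero => simp
        | tmul v w => simp [aug_ι]
        | add x y hx hy => rw [TensorProduct.add_tmul, map_add, map_add, map_add, hx, hy, add_zero]
      | add x y hx hy => rw [map_add, map_add, map_add, hx, hy, add_zero]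
    exact this _
  simpa using h2 _ h1

/-- The component of degree one is `V`. -/
noncomputable def compOneEquiv : V ≃ₗ[R] comp I 1 :=
  LinearEquiv.ofBijective ((ι I).codRestrict _ (ι_mem I))
    ⟨fun _ _ h => ι_injective I (congrArg Subtype.val h), fun a => by
      obtain ⟨v, hv⟩ : (a : QuadAlg I) ∈ LinearMap.range (ι I) := by
        simpa only [comp, pow_one] using a.2
      exact ⟨v, Subtype.ext hv⟩⟩

@[simp]
theorem coe_compOneEquiv (v : V) : (compOneEquiv I v : QuadAlg I) = ι I v := rfl

/-- The map `(V ⊗ V) ⊗ Aₙ → V ⊗ Aₙ₊₁`, `(v ⊗ w) ⊗ a ↦ v ⊗ w a`. -/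
noncomputable def relComp (n : ℕ) : (V ⊗[R] V) ⊗[R] comp I n →ₗ[R] V ⊗[R] comp I (n + 1) :=
  (TensorProduct.lift (lmul I n)).lTensor V ∘ₗ (TensorProduct.assoc R V V (comp I n)).toLinearMap

@[simp]
theorem relComp_tmul (n : ℕ) (v w : V) (a : comp I n) :
    relComp I n ((v ⊗ₜ w) ⊗ₜ a) = v ⊗ₜ lmul I n w a := by
  simp [relComp]

/-- In each degree the relations of `A` as a left module generated by `V ⊗ A` come from `I`. -/
theorem mem_range_of_lift_lmul_eq_zero (n : ℕ) (x : V ⊗[R] comp I (n + 1))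
    (hx : TensorProduct.lift (lmul I (n + 1)) x = 0) :
    x ∈ LinearMap.range (relComp I n ∘ₗ I.subtype.rTensor (comp I n)) := by
  have h1 : mulι I ((comp I (n + 1)).subtype.lTensor V x) =
      TensorProduct.lift (lmul I (n + 1)) x := by
    clear hx
    induction x using TensorProduct.induction_on with
    | zero => simp
    | tmul v a => simp
    | add x y hx hy => simp [hx, hy]
  have h2 : (comp I (n + 1)).subtype.lTensor V x ∈ relRange I := by
    rw [← ker_mulι, LinearMap.mem_ker, h1, hx]; rfl
  obtain ⟨y, hy⟩ := h2
  -- the component of degree `n` of a preimage in `I ⊗ A` is a preimage in `I ⊗ Aₙ`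
  have h3 : ∀ a : QuadAlg I, ∀ w : V, toComp I (n + 1) (ι I w * a) = lmul I n w (toComp I n a) := by
    intro a w
    refine Subtype.ext ?_
    have := DirectSum.coe_decompose_mul_add_of_left_mem (comp I) (i := 1) (j := n) (b := a)
      (ι_mem I w)
    rw [add_comm] at this
    exact this
  have h4 : ∀ z, (toComp I (n + 1)).lTensor V (relMap I z) =
      relComp I n ((toComp I n).lTensor (V ⊗[R] V) z) := by
    intro z
    induction z using TensorProduct.induction_on with
    | zero => simp
    | tmul t a =>
      induction t using TensorProduct.induction_on with
      | zero => simp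
      | tmul v w => simp [h3]
      | add x y hx hy => rw [TensorProduct.add_tmul, map_add, map_add, map_add, hx, hy, map_add]
    | add x y hx hy => rw [map_add, map_add, map_add, hx, hy, map_add]
  refine ⟨(toComp I n).lTensor I y, ?_⟩
  have h5 : (toComp I (n + 1)).lTensor V ((comp I (n + 1)).subtype.lTensor V x) = x := by
    rw [← LinearMap.comp_apply, ← LinearMap.lTensor_comp]
    have : toComp I (n + 1) ∘ₗ (comp I (n + 1)).subtype = LinearMap.id :=
      LinearMap.ext fun a => toComp_coe I _ a
    rw [this, LinearMap.lTensor_id]; rfl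
  rw [← h5, ← hy, LinearMap.comp_apply, LinearMap.comp_apply, h4]
  congr 1
  rw [← LinearMap.comp_apply, ← LinearMap.comp_apply, LinearMap.rTensor_comp_lTensor,
    LinearMap.lTensor_comp_rTensor]

/-- A bilinear map on `V × Aₙ₊₁` that is compatible with the relations factors through the
multiplication `V × Aₙ₊₁ → Aₙ₊₂`. -/
theorem exists_comp_lift {N : Type*} [AddCommGroup N] [Module R N] (n : ℕ)
    (f : V →ₗ[R] comp I (n + 1) →ₗ[R] N)
    (hf : ∀ t ∈ I, ∀ a : comp I n, TensorProduct.lift f (relComp I n (t ⊗ₜ a)) = 0) :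
    ∃ g : comp I (n + 2) →ₗ[R] N, ∀ v a, g (lmul I (n + 1) v a) = f v a := by
  have hk : LinearMap.ker (TensorProduct.lift (lmul I (n + 1))) ≤
      LinearMap.ker (TensorProduct.lift f) := by
    intro x hx
    obtain ⟨y, rfl⟩ := mem_range_of_lift_lmul_eq_zero I n x hx
    clear hx
    induction y using TensorProduct.induction_on with
    | zero => simp
    | tmul t a => exact hf t t.2 a
    | add x y hx hy => rw [map_add]; exact add_mem hx hy
  refine ⟨(LinearMap.ker (TensorProduct.lift (lmul I (n + 1)))).liftQ (TensorProduct.lift f) hk ∘ₗ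
    ((TensorProduct.lift (lmul I (n + 1))).quotKerEquivOfSurjective
      (lift_lmul_surjective I (n + 1))).symm.toLinearMap, fun v a => ?_⟩
  have : ((TensorProduct.lift (lmul I (n + 1))).quotKerEquivOfSurjective
      (lift_lmul_surjective I (n + 1))).symm (lmul I (n + 1) v a) =
      Submodule.Quotient.mk (v ⊗ₜ a) := (LinearEquiv.symm_apply_eq _).2 (by simp)
  rw [LinearMap.comp_apply, LinearEquiv.coe_coe, this]
  simp

end Basic

end QuadAlg

/-! ### Linear algebra over a principal ideal domain -/

section LinearAlgebra

variable {R : Type*} [CommRing R]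

/-- A saturated submodule of a finite module over a principal ideal domain is a direct summand. -/
theorem exists_retraction_of_saturated [IsDomain R] [IsPrincipalIdealRing R] {M : Type*}
    [AddCommGroup M] [Module R M] [Module.Finite R M] (S : Submodule R M)
    (hS : ∀ (r : R) (x : M), r ≠ 0 → r • x ∈ S → x ∈ S) :
    ∃ ρ : M →ₗ[R] M, (∀ x, ρ x ∈ S) ∧ ∀ x ∈ S, ρ x = x := by
  have : Module.IsTorsionFree R (M ⧸ S) := by
    refine Module.IsTorsionFree.of_smul_eq_zero fun r x hx => ?_
    induction x using Submodule.Quotient.induction_on with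
    | H x =>
      rw [← Submodule.Quotient.mk_smul, Submodule.Quotient.mk_eq_zero] at hx
      by_cases hr : r = 0
      · exact Or.inl hr
      · exact Or.inr ((Submodule.Quotient.mk_eq_zero _).2 (hS r x hr hx))
  have : Module.Free R (M ⧸ S) := Module.free_of_finite_type_torsion_free'
  obtain ⟨σ, hσ⟩ := Module.projective_lifting_property S.mkQ LinearMap.id S.mkQ_surjective
  refine ⟨LinearMap.id - σ ∘ₗ S.mkQ, fun x => ?_, fun x hx => ?_⟩
  · rw [← Submodule.Quotient.mk_eq_zero, ← Submodule.mkQ_apply, LinearMap.sub_apply, map_sub,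
      LinearMap.comp_apply]
    exact sub_eq_zero.2 (LinearMap.congr_fun hσ (S.mkQ x)).symm
  · have : S.mkQ x = 0 := (Submodule.Quotient.mk_eq_zero _).2 hx
    simp only [LinearMap.sub_apply, LinearMap.comp_apply, this]
    simp

/-- A functional that vanishes on the kernel of `d` extends along `d` if the image of `d` is
saturated. -/
theorem exists_functional_comp_eq [IsDomain R] [IsPrincipalIdealRing R] {C C' : Type*}
    [AddCommMonoid C] [Module R C] [AddCommMonoid C'] [Module R C'] [Module.Finite R C']
    (d : C →ₗ[R] C') (hd : ∀ (r : R) (x : C'), r ≠ 0 → r • x ∈ LinearMap.range d →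
      x ∈ LinearMap.range d) (l : C →ₗ[R] R) (hl : ∀ x, d x = 0 → l x = 0) :
    ∃ l' : C' →ₗ[R] R, l' ∘ₗ d = l := by
  let _ : AddCommGroup C := Module.addCommMonoidToAddCommGroup R
  let _ : AddCommGroup C' := Module.addCommMonoidToAddCommGroup R
  obtain ⟨ρ, h1, h2⟩ := exists_retraction_of_saturated _ hd
  refine ⟨(LinearMap.ker d).liftQ l (fun x hx => hl x hx) ∘ₗ d.quotKerEquivRange.symm.toLinearMap ∘ₗ
    ρ.codRestrict _ h1, LinearMap.ext fun x => ?_⟩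
  have h3 : ρ.codRestrict (LinearMap.range d) h1 (d x) = ⟨d x, LinearMap.mem_range_self d x⟩ :=
    Subtype.ext (h2 _ (LinearMap.mem_range_self d x))
  have h4 : d.quotKerEquivRange.symm ⟨d x, LinearMap.mem_range_self d x⟩ =
      Submodule.Quotient.mk x := (LinearEquiv.symm_apply_eq _).2 rfl
  simp only [LinearMap.comp_apply, h3, LinearEquiv.coe_coe, h4]
  rfl

variable {M N : Type*} [AddCommGroup M] [Module R M] [AddCommGroup N] [Module R N]
  [Module.Free R N] [Module.Finite R N]

theorem trace_comp_dualTensorHom (θ : M →ₗ[R] N) (f : Module.Dual R N) (m : M) :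
    LinearMap.trace R N (θ ∘ₗ dualTensorHom R N M (f ⊗ₜ m)) = f (θ m) := by
  have : θ ∘ₗ dualTensorHom R N M (f ⊗ₜ m) = dualTensorHom R N N (f ⊗ₜ θ m) := by
    ext; simp
  rw [this, LinearMap.trace_eq_contract_apply, contractLeft_apply]

/-- The trace pairing identifies `Hom(M, N)` with the dual of `Hom(N, M)`. -/
theorem exists_trace_comp_eq (l : (N →ₗ[R] M) →ₗ[R] R) :
    ∃ θ : M →ₗ[R] N, ∀ ψ, l ψ = LinearMap.trace R N (θ ∘ₗ ψ) := by
  let θ : M →ₗ[R] N := (Module.evalEquiv R N).symm.toLinearMap ∘ₗ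
    ((TensorProduct.mk R (Module.Dual R N) M).compr₂ (l ∘ₗ dualTensorHom R N M)).flip
  have hθ : ∀ f m, f (θ m) = l (dualTensorHom R N M (f ⊗ₜ m)) := fun f m => by
    simp [θ]
  refine ⟨θ, fun ψ => ?_⟩
  obtain ⟨x, rfl⟩ := (dualTensorHomEquiv R N M).surjective ψ
  change l (dualTensorHom R N M x) = LinearMap.trace R N (θ ∘ₗ dualTensorHom R N M x)
  induction x using TensorProduct.induction_on with
  | zero => simp
  | tmul f m => rw [trace_comp_dualTensorHom, hθ]
  | add x y hx hy => rw [map_add, map_add, hx, hy, LinearMap.comp_add, map_add]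

/-- The trace pairing is nondegenerate. -/
theorem eq_of_trace_comp_eq (θ θ' : M →ₗ[R] N)
    (h : ∀ ψ : N →ₗ[R] M, LinearMap.trace R N (θ ∘ₗ ψ) = LinearMap.trace R N (θ' ∘ₗ ψ)) :
    θ = θ' := by
  refine LinearMap.ext fun m => ?_
  rw [← sub_eq_zero, ← Module.forall_dual_apply_eq_zero_iff R]
  intro f
  rw [map_sub, sub_eq_zero, ← trace_comp_dualTensorHom, ← trace_comp_dualTensorHom, h]

end LinearAlgebra

/-! ### Dual pairs of quadratic data and their Koszul complexes -/

/-- A dual pair of quadratic data: `V` and `W` have bases `v` and `w` that are regarded as dual to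
each other, and the spaces of relations `I ⊆ V ⊗ V` and `J ⊆ W ⊗ W` are the annihilators of each
other. The pairing of `W ⊗ W` and `V ⊗ V` is written in coordinates, which makes the notion
symmetric in `(V, I)` and `(W, J)`. -/
structure QuadDual {R V W : Type u} [CommRing R] [AddCommGroup V] [Module R V] [AddCommGroup W]
    [Module R W] (I : Submodule R (V ⊗[R] V)) (J : Submodule R (W ⊗[R] W)) where
  rank : ℕ
  v : Module.Basis (Fin rank) R V
  w : Module.Basis (Fin rank) R W
  mem_right : ∀ t, t ∈ J ↔ ∀ s ∈ I,
    ∑ p, (w.tensorProduct w).repr t p * (v.tensorProduct v).repr s p = 0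
  mem_left : ∀ s, s ∈ I ↔ ∀ t ∈ J,
    ∑ p, (w.tensorProduct w).repr t p * (v.tensorProduct v).repr s p = 0

namespace QuadDual

open QuadAlg

variable {R V W : Type u} [CommRing R] [AddCommGroup V] [Module R V] [AddCommGroup W]
  [Module R W] {I : Submodule R (V ⊗[R] V)} {J : Submodule R (W ⊗[R] W)} (D : QuadDual I J)

/-- The dual pair with the two sides interchanged. -/
@[simps]
def symm : QuadDual J I where
  rank := D.rank
  v := D.w
  w := D.v
  mem_right s := by simp only [D.mem_left, mul_comm]
  mem_left t := by simp only [D.mem_right, mul_comm]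

/-- The pairing of `W ⊗ W` and `V ⊗ V`. -/
noncomputable def pair : W ⊗[R] W →ₗ[R] V ⊗[R] V →ₗ[R] R :=
  LinearMap.mk₂ R (fun t s =>
      ∑ p, (D.w.tensorProduct D.w).repr t p * (D.v.tensorProduct D.v).repr s p)
    (fun _ _ _ => by simp [add_mul, Finset.sum_add_distrib])
    (fun _ _ _ => by simp [Finset.mul_sum, mul_assoc])
    (fun _ _ _ => by simp [mul_add, Finset.sum_add_distrib])
    (fun _ _ _ => by simp [Finset.mul_sum, mul_left_comm])

theorem pair_apply (t : W ⊗[R] W) (s : V ⊗[R] V) :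
    D.pair t s = ∑ p, (D.w.tensorProduct D.w).repr t p * (D.v.tensorProduct D.v).repr s p := rfl

theorem pair_eq_zero {t : W ⊗[R] W} {s : V ⊗[R] V} (ht : t ∈ J) (hs : s ∈ I) : D.pair t s = 0 :=
  (D.mem_right t).1 ht s hs

theorem pair_tmul (x y : W) (a b : V) : D.pair (x ⊗ₜ y) (a ⊗ₜ b) =
    (∑ k, D.w.repr x k * D.v.repr a k) * ∑ k, D.w.repr y k * D.v.repr b k := by
  rw [pair_apply, Fintype.sum_prod_type, Finset.sum_mul_sum]
  refine Finset.sum_congr rfl fun i _ => Finset.sum_congr rfl fun j _ => ?_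
  simp
  ring

theorem pair_w_right (x : W) (k : Fin D.rank) (a b : V) :
    D.pair (x ⊗ₜ D.w k) (a ⊗ₜ b) = (∑ k, D.w.repr x k * D.v.repr a k) * D.v.repr b k := by
  rw [pair_tmul]
  congr 1
  simp [Finsupp.single_apply]

theorem pair_v_right (x y : W) (k : Fin D.rank) (a : V) :
    D.pair (x ⊗ₜ y) (a ⊗ₜ D.v k) = (∑ k, D.w.repr x k * D.v.repr a k) * D.w.repr y k := by
  rw [pair_tmul]
  congr 1
  simp [Finsupp.single_apply]

/-- The canonical element `∑ (wₖ ⊗ wₗ) ⊗ (vₖ ⊗ vₗ)` of `(W ⊗ W) ⊗ (V ⊗ V)` vanishes modulo `J` and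
`I`. This is what makes the Koszul differentials square to zero. -/
theorem sum_eq_zero [IsDomain R] [IsPrincipalIdealRing R] {N : Type*} [AddCommGroup N] [Module R N]
    (F : W ⊗[R] W →ₗ[R] V ⊗[R] V →ₗ[R] N) (hJ : ∀ t ∈ J, ∀ s, F t s = 0)
    (hI : ∀ t, ∀ s ∈ I, F t s = 0) :
    ∑ k, ∑ l, F (D.w k ⊗ₜ D.w l) (D.v k ⊗ₜ D.v l) = 0 := by
  have : Module.Finite R V := Module.Finite.of_basis D.v
  obtain ⟨ρ, h1, h2⟩ := exists_retraction_of_saturated I (fun r s hr hs => by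
    rw [D.mem_left] at hs ⊢
    intro t ht
    have h : D.pair t (r • s) = 0 := hs t ht
    rw [map_smul, smul_eq_mul] at h
    exact (mul_eq_zero.1 h).resolve_left hr)
  set v2 := D.v.tensorProduct D.v with hv2
  set w2 := D.w.tensorProduct D.w with hw2
  have e : ∑ k, ∑ l, F (D.w k ⊗ₜ D.w l) (D.v k ⊗ₜ D.v l) = ∑ p, F (w2 p) (v2 p) := by
    rw [Fintype.sum_prod_type]; simp [hv2, hw2]
  rw [e]
  -- modulo `I` each basis vector may be replaced by its projection to a complement of `I`
  have h3 : ∀ p, F (w2 p) (v2 p) = ∑ q, v2.repr (v2 p - ρ (v2 p)) q • F (w2 p) (v2 q) := by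
    intro p
    calc F (w2 p) (v2 p) = F (w2 p) (v2 p - ρ (v2 p)) := by
          rw [map_sub, hI _ _ (h1 _), sub_zero]
      _ = F (w2 p) (∑ q, v2.repr (v2 p - ρ (v2 p)) q • v2 q) := by rw [v2.sum_repr]
      _ = _ := by simp only [map_sum, map_smul]
  simp only [h3]
  rw [Finset.sum_comm]
  refine Finset.sum_eq_zero fun q _ => ?_
  have h4 : ∑ p, v2.repr (v2 p - ρ (v2 p)) q • w2 p ∈ J := by
    rw [D.mem_right]
    intro s hs
    have h5 : v2.repr (s - ρ s) q = 0 := by rw [h2 s hs, sub_self]; simp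
    calc ∑ x, w2.repr (∑ p, v2.repr (v2 p - ρ (v2 p)) q • w2 p) x * v2.repr s x
        = ∑ x, v2.repr s x * v2.repr (v2 x - ρ (v2 x)) q := by
          refine Finset.sum_congr rfl fun x _ => ?_
          rw [mul_comm, w2.repr_sum_self]
      _ = v2.repr (s - ρ s) q := by
          let g : V ⊗[R] V →ₗ[R] R := v2.coord q ∘ₗ (LinearMap.id - ρ)
          calc ∑ x, v2.repr s x * g (v2 x) = g (∑ x, v2.repr s x • v2 x) := by
                simp only [map_sum, map_smul, smul_eq_mul]
            _ = g s := by rw [v2.sum_repr]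
      _ = 0 := h5
  have h6 := hJ _ h4 (v2 q)
  simpa using h6

/-- The differential `Hom(Bᵢ₊₁, Aₚ) → Hom(Bᵢ, Aₚ₊₁)`, `ψ ↦ ∑ₖ ψ(wₖ ·) vₖ`, of the Koszul complex
of left `A`-modules `Hom(Bᵢ, A) = A ⊗ Bᵢ*`. -/
noncomputable def dl {i p : ℕ} :
    (comp J (i + 1) →ₗ[R] comp I p) →ₗ[R] (comp J i →ₗ[R] comp I (p + 1)) :=
  ∑ k, (LinearMap.lcomp R _ (lmul J i (D.w k))).comp (LinearMap.compRight R (rmul I p (D.v k)))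

/-- The differential `Hom(Bᵢ₊₁, Aₚ) → Hom(Bᵢ, Aₚ₊₁)`, `ψ ↦ ∑ₖ vₖ ψ(· wₖ)`, of the Koszul complex
of right `A`-modules. -/
noncomputable def dr {i p : ℕ} :
    (comp J (i + 1) →ₗ[R] comp I p) →ₗ[R] (comp J i →ₗ[R] comp I (p + 1)) :=
  ∑ k, (LinearMap.lcomp R _ (rmul J i (D.w k))).comp (LinearMap.compRight R (lmul I p (D.v k)))

theorem dl_apply {i p : ℕ} (ψ : comp J (i + 1) →ₗ[R] comp I p) (b : comp J i) :
    D.dl ψ b = ∑ k, rmul I p (D.v k) (ψ (lmul J i (D.w k) b)) := by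
  simp [dl, LinearMap.sum_apply]

theorem dr_apply {i p : ℕ} (ψ : comp J (i + 1) →ₗ[R] comp I p) (b : comp J i) :
    D.dr ψ b = ∑ k, lmul I p (D.v k) (ψ (rmul J i (D.w k) b)) := by
  simp [dr, LinearMap.sum_apply]

/-- The Koszul complex of left `A`-modules is exact at all places `Hom(Bᵢ₊₁, Aₚ)` with `p > 0`. -/
def LeftExactAt (i : ℕ) : Prop :=
  ∀ (p : ℕ) (ψ : comp J (i + 1) →ₗ[R] comp I (p + 1)), D.dl ψ = 0 →
    ∃ χ : comp J (i + 2) →ₗ[R] comp I p, D.dl χ = ψ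

/-- The Koszul complex of left `A`-modules is exact at all places `Hom(Bᵢ, Aₚ)` with `i, p > 0`. -/
def LeftExact : Prop := ∀ i : ℕ, D.LeftExactAt i

end QuadDual

namespace QuadAlg

variable {R V : Type u} [CommRing R] [AddCommGroup V] [Module R V] (I : Submodule R (V ⊗[R] V))

/-! ### Products of elements of degree one -/

/-- The product of two elements of degree one. -/
noncomputable def mulTwo : V ⊗[R] V →ₗ[R] QuadAlg I :=
  LinearMap.mul' R (QuadAlg I) ∘ₗ TensorProduct.map (ι I) (ι I)

@[simp]
theorem mulTwo_tmul (x y : V) : mulTwo I (x ⊗ₜ y) = ι I x * ι I y := by simp [mulTwo]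

theorem mulTwo_eq_zero {t : V ⊗[R] V} (ht : t ∈ I) : mulTwo I t = 0 := mul_ι_ι_eq_zero I t ht

theorem mulTwo_mem (t : V ⊗[R] V) : mulTwo I t ∈ comp I 2 := by
  induction t using TensorProduct.induction_on with
  | zero => simp
  | tmul v w => rw [mulTwo_tmul]; exact SetLike.GradedMul.mul_mem (ι_mem I v) (ι_mem I w)
  | add x y hx hy => rw [map_add]; exact add_mem hx hy

/-- The unit, as an element of the component of degree zero. -/
noncomputable def oneComp : comp I 0 := ⟨1, SetLike.GradedOne.one_mem⟩

@[simp]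
theorem coe_oneComp : (oneComp I : QuadAlg I) = 1 := rfl

theorem exists_smul_oneComp (a : comp I 0) : a = aug I a • oneComp I := by
  refine Subtype.ext ((eq_algebraMap_of_mem I a.2).trans ?_)
  rw [Algebra.algebraMap_eq_smul_one]; rfl

/-- All relations of degree two come from `I`. -/
theorem mem_of_mulTwo_eq_zero (s : V ⊗[R] V) (hs : mulTwo I s = 0) : s ∈ I := by
  let e := (compOneEquiv I).toLinearMap.lTensor V
  have h1 : TensorProduct.lift (lmul I 1) (e s) = 0 := by
    have h : ∀ s, (TensorProduct.lift (lmul I 1) (e s) : QuadAlg I) = mulTwo I s := by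
      intro s
      induction s using TensorProduct.induction_on with
      | zero => simp
      | tmul v w => simp [e]
      | add x y hx hy => simp [hx, hy]
    exact Subtype.ext ((h s).trans hs)
  obtain ⟨y, hy⟩ := mem_range_of_lift_lmul_eq_zero I 0 _ h1
  have h2 : ∀ z : (V ⊗[R] V) ⊗[R] comp I 0, relComp I 0 z =
      e (TensorProduct.rid R _ ((compZeroEquiv I).toLinearMap.lTensor _ z)) := by
    intro z
    induction z using TensorProduct.induction_on with
    | zero => simp
    | tmul t a =>
      rw [exists_smul_oneComp I a, TensorProduct.tmul_smul]
      simp only [map_smul]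
      congr 1
      induction t using TensorProduct.induction_on with
      | zero => simp
      | tmul v w =>
        rw [relComp_tmul]
        simp only [LinearMap.lTensor_tmul, LinearEquiv.coe_coe, compZeroEquiv_apply, coe_oneComp,
          map_one, TensorProduct.rid_tmul, one_smul, e]
        congr 1
        exact Subtype.ext (by simp)
      | add x y hx hy => rw [TensorProduct.add_tmul, map_add, hx, hy, map_add, map_add, map_add]
    | add x y hx hy => simp only [map_add, hx, hy]
  have h3 : Function.Injective e := (LinearEquiv.lTensor V (compOneEquiv I)).injective
  rw [LinearMap.comp_apply, h2] at hy
  rw [← h3 hy]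
  clear h1 hy
  induction y using TensorProduct.induction_on with
  | zero => simp
  | tmul t a =>
    simp only [LinearMap.rTensor_tmul, LinearMap.lTensor_tmul, TensorProduct.rid_tmul]
    exact I.smul_mem _ t.2
  | add x y hx hy => simp only [map_add]; exact add_mem hx hy

/-- Left multiplication by elements of `V ⊗ V`, as a map between components. -/
noncomputable def lmulTwo (n : ℕ) : V ⊗[R] V →ₗ[R] comp I n →ₗ[R] comp I (n + 2) :=
  LinearMap.mk₂ R (fun t a => ⟨mulTwo I t * a, by
      have := SetLike.GradedMul.mul_mem (A := comp I) (mulTwo_mem I t) a.2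
      rwa [add_comm] at this⟩)
    (fun _ _ _ => Subtype.ext (by simp [add_mul])) (fun _ _ _ => Subtype.ext (by simp))
    (fun _ _ _ => Subtype.ext (by simp [mul_add])) (fun _ _ _ => Subtype.ext (by simp))

/-- Right multiplication by elements of `V ⊗ V`, as a map between components. -/
noncomputable def rmulTwo (n : ℕ) : V ⊗[R] V →ₗ[R] comp I n →ₗ[R] comp I (n + 2) :=
  LinearMap.mk₂ R (fun t a => ⟨a * mulTwo I t,
      SetLike.GradedMul.mul_mem (A := comp I) a.2 (mulTwo_mem I t)⟩)
    (fun _ _ _ => Subtype.ext (by simp [mul_add])) (fun _ _ _ => Subtype.ext (by simp))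
    (fun _ _ _ => Subtype.ext (by simp [add_mul])) (fun _ _ _ => Subtype.ext (by simp))

@[simp]
theorem coe_lmulTwo (n : ℕ) (t : V ⊗[R] V) (a : comp I n) :
    (lmulTwo I n t a : QuadAlg I) = mulTwo I t * a := rfl

@[simp]
theorem coe_rmulTwo (n : ℕ) (t : V ⊗[R] V) (a : comp I n) :
    (rmulTwo I n t a : QuadAlg I) = a * mulTwo I t := rfl

variable {I} in
theorem exists_sum_lmul {κ : Type*} [Fintype κ] (v : Module.Basis κ R V) (n : ℕ)
    (x : comp I (n + 1)) : ∃ a : κ → comp I n, x = ∑ k, lmul I n (v k) (a k) := by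
  obtain ⟨t, rfl⟩ := lift_lmul_surjective I n x
  induction t using TensorProduct.induction_on with
  | zero => exact ⟨0, by simp⟩
  | tmul u a =>
    refine ⟨fun k => v.repr u k • a, ?_⟩
    calc TensorProduct.lift (lmul I n) (u ⊗ₜ a) = lmul I n (∑ k, v.repr u k • v k) a := by
          rw [v.sum_repr, TensorProduct.lift.tmul]
      _ = _ := by simp only [map_sum, LinearMap.sum_apply, map_smul, LinearMap.smul_apply]
  | add x y hx hy =>
    obtain ⟨a, ha⟩ := hx
    obtain ⟨b, hb⟩ := hy
    exact ⟨a + b, by simp [ha, hb, Finset.sum_add_distrib]⟩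

variable {I} in
theorem exists_sum_rmul {κ : Type*} [Fintype κ] (v : Module.Basis κ R V) (n : ℕ)
    (x : comp I (n + 1)) : ∃ a : κ → comp I n, x = ∑ k, rmul I n (v k) (a k) := by
  obtain ⟨t, rfl⟩ := lift_rmul_surjective I n x
  induction t using TensorProduct.induction_on with
  | zero => exact ⟨0, by simp⟩
  | tmul u a =>
    refine ⟨fun k => v.repr u k • a, ?_⟩
    calc TensorProduct.lift (rmul I n) (u ⊗ₜ a) = rmul I n (∑ k, v.repr u k • v k) a := by
          rw [v.sum_repr, TensorProduct.lift.tmul]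
      _ = _ := by simp only [map_sum, LinearMap.sum_apply, map_smul, LinearMap.smul_apply]
  | add x y hx hy =>
    obtain ⟨a, ha⟩ := hx
    obtain ⟨b, hb⟩ := hy
    exact ⟨a + b, by simp [ha, hb, Finset.sum_add_distrib]⟩

end QuadAlg

/-! ### Exactness of the Koszul complexes in low degrees -/

namespace QuadDual

open QuadAlg

variable {R V W : Type u} [CommRing R] [AddCommGroup V] [Module R V] [AddCommGroup W]
  [Module R W] {I : Submodule R (V ⊗[R] V)} {J : Submodule R (W ⊗[R] W)} (D : QuadDual I J)

section SquareZero

variable [IsDomain R] [IsPrincipalIdealRing R]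

theorem dl_dl {i p : ℕ} (ψ : comp J (i + 2) →ₗ[R] comp I p) : D.dl (D.dl ψ) = 0 := by
  refine LinearMap.ext fun b => ?_
  have h := D.sum_eq_zero (LinearMap.mk₂ R (fun t s => rmulTwo I p s (ψ (lmulTwo J i t b)))
    (fun _ _ _ => by simp) (fun _ _ _ => by simp) (fun _ _ _ => by simp) (fun _ _ _ => by simp))
    (fun t ht s => Subtype.ext (by
      have : lmulTwo J i t b = 0 := Subtype.ext (by simp [mulTwo_eq_zero J ht])
      simp [this]))
    (fun t s hs => Subtype.ext (by simp [mulTwo_eq_zero I hs]))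
  simp only [dl_apply, map_sum, LinearMap.zero_apply]
  rw [Finset.sum_comm, ← h]
  refine Finset.sum_congr rfl fun k _ => Finset.sum_congr rfl fun l _ => Subtype.ext ?_
  have e : lmulTwo J i (D.w k ⊗ₜ D.w l) b = lmul J (i + 1) (D.w k) (lmul J i (D.w l) b) :=
    Subtype.ext (by simp [mul_assoc])
  simp [mul_assoc, e]

theorem dr_dr {i p : ℕ} (ψ : comp J (i + 2) →ₗ[R] comp I p) : D.dr (D.dr ψ) = 0 := by
  refine LinearMap.ext fun b => ?_
  have h := D.sum_eq_zero (LinearMap.mk₂ R (fun t s => lmulTwo I p s (ψ (rmulTwo J i t b)))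
    (fun _ _ _ => by simp) (fun _ _ _ => by simp) (fun _ _ _ => by simp) (fun _ _ _ => by simp))
    (fun t ht s => Subtype.ext (by
      have : rmulTwo J i t b = 0 := Subtype.ext (by simp [mulTwo_eq_zero J ht])
      simp [this]))
    (fun t s hs => Subtype.ext (by simp [mulTwo_eq_zero I hs]))
  simp only [dr_apply, map_sum, LinearMap.zero_apply]
  rw [← h]
  refine Finset.sum_congr rfl fun k _ => Finset.sum_congr rfl fun l _ => Subtype.ext ?_
  have e : rmulTwo J i (D.w k ⊗ₜ D.w l) b = rmul J (i + 1) (D.w l) (rmul J i (D.w k) b) :=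
    Subtype.ext (by simp [mul_assoc])
  simp [mul_assoc, e]

end SquareZero

theorem eq_zero_of_sum_ι_eq_zero (r : Fin D.rank → R) (h : ∑ k, r k • ι I (D.v k) = 0) : r = 0 := by
  have h1 : ι I (∑ k, r k • D.v k) = 0 := by simpa using h
  rw [map_eq_zero_iff _ (ι_injective I)] at h1
  exact funext (Fintype.linearIndependent_iff.1 D.v.linearIndependent r h1)

theorem hom_ext_lmul {N : Type*} [AddCommGroup N] [Module R N] {i : ℕ}
    {f g : comp J (i + 1) →ₗ[R] N} (h : ∀ k b, f (lmul J i (D.w k) b) = g (lmul J i (D.w k) b)) :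
    f = g := by
  refine LinearMap.ext fun x => ?_
  obtain ⟨a, rfl⟩ := exists_sum_lmul D.w i x
  simp only [map_sum, h]

theorem hom_ext_rmul {N : Type*} [AddCommGroup N] [Module R N] {i : ℕ}
    {f g : comp J (i + 1) →ₗ[R] N} (h : ∀ k b, f (rmul J i (D.w k) b) = g (rmul J i (D.w k) b)) :
    f = g := by
  refine LinearMap.ext fun x => ?_
  obtain ⟨a, rfl⟩ := exists_sum_rmul D.w i x
  simp only [map_sum, h]

theorem coe_eq_zero_of_aug {a : comp I 0} (h : aug I a = 0) : a = 0 := by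
  rw [exists_smul_oneComp I a, h, zero_smul]

/-- Exactness of the left Koszul complex at `Hom(Bᵢ₊₁, A₀)`. -/
theorem dl_injective {i : ℕ} (ψ : comp J (i + 1) →ₗ[R] comp I 0) (h : D.dl ψ = 0) : ψ = 0 := by
  refine D.hom_ext_lmul fun k b => coe_eq_zero_of_aug ?_
  have h1 := congrArg Subtype.val (LinearMap.congr_fun h b)
  rw [dl_apply] at h1
  refine congrFun (D.eq_zero_of_sum_ι_eq_zero
    (fun k => aug I (ψ (lmul J i (D.w k) b))) (Eq.trans ?_ h1)) k
  rw [Submodule.coe_sum]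
  refine Finset.sum_congr rfl fun k _ => ?_
  rw [exists_smul_oneComp I (ψ (lmul J i (D.w k) b))]
  simp

/-- Exactness of the right Koszul complex at `Hom(Bᵢ₊₁, A₀)`. -/
theorem dr_injective {i : ℕ} (ψ : comp J (i + 1) →ₗ[R] comp I 0) (h : D.dr ψ = 0) : ψ = 0 := by
  refine D.hom_ext_rmul fun k b => coe_eq_zero_of_aug ?_
  have h1 := congrArg Subtype.val (LinearMap.congr_fun h b)
  rw [dr_apply] at h1
  refine congrFun (D.eq_zero_of_sum_ι_eq_zero
    (fun k => aug I (ψ (rmul J i (D.w k) b))) (Eq.trans ?_ h1)) k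
  rw [Submodule.coe_sum]
  refine Finset.sum_congr rfl fun k _ => ?_
  rw [exists_smul_oneComp I (ψ (rmul J i (D.w k) b))]
  simp

/-- The basis of the component of degree one. -/
noncomputable def basisOne : Module.Basis (Fin D.rank) R (comp J 1) :=
  D.w.map (compOneEquiv J)

theorem basisOne_eq_lmul (k : Fin D.rank) : D.basisOne k = lmul J 0 (D.w k) (oneComp J) :=
  Subtype.ext (by simp [basisOne])

theorem basisOne_eq_rmul (k : Fin D.rank) : D.basisOne k = rmul J 0 (D.w k) (oneComp J) :=
  Subtype.ext (by simp [basisOne])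

theorem hom_ext_one {N : Type*} [AddCommGroup N] [Module R N] {f g : comp J 0 →ₗ[R] N}
    (h : f (oneComp J) = g (oneComp J)) : f = g := by
  refine LinearMap.ext fun x => ?_
  rw [exists_smul_oneComp J x, map_smul, map_smul, h]

/-- Exactness of the left Koszul complex at `Hom(B₀, Aₚ₊₁)`. -/
theorem dl_surjective {p : ℕ} (ψ : comp J 0 →ₗ[R] comp I (p + 1)) :
    ∃ χ : comp J 1 →ₗ[R] comp I p, D.dl χ = ψ := by
  obtain ⟨a, ha⟩ := exists_sum_rmul D.v p (ψ (oneComp J))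
  refine ⟨D.basisOne.constr R a, hom_ext_one ?_⟩
  rw [dl_apply, ha]
  refine Finset.sum_congr rfl fun k _ => ?_
  rw [← basisOne_eq_lmul, Module.Basis.constr_basis]

/-- Exactness of the right Koszul complex at `Hom(B₀, Aₚ₊₁)`. -/
theorem dr_surjective {p : ℕ} (ψ : comp J 0 →ₗ[R] comp I (p + 1)) :
    ∃ χ : comp J 1 →ₗ[R] comp I p, D.dr χ = ψ := by
  obtain ⟨a, ha⟩ := exists_sum_lmul D.v p (ψ (oneComp J))
  refine ⟨D.basisOne.constr R a, hom_ext_one ?_⟩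
  rw [dr_apply, ha]
  refine Finset.sum_congr rfl fun k _ => ?_
  rw [← basisOne_eq_rmul, Module.Basis.constr_basis]

/-- Exactness of the left Koszul complex at `Hom(Bᵢ₊₁, A₁)` follows from the presentation of `B`: a
cycle `ψ` with values in `A₁ = V` is a bilinear form on `W × Bᵢ₊₁` that is compatible with the
relations of `B`, since `∑ₖ ψ(wₖ b) ⊗ vₖ` lies in `I`, the annihilator of `J`. -/
theorem exists_dl_eq_of_degree_one {i : ℕ} (ψ : comp J (i + 1) →ₗ[R] comp I 1)
    (h : D.dl ψ = 0) : ∃ χ : comp J (i + 2) →ₗ[R] comp I 0, D.dl χ = ψ := by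
  let ψ' : comp J (i + 1) →ₗ[R] V := (compOneEquiv I).symm.toLinearMap ∘ₗ ψ
  have hψ : ∀ b, (ψ b : QuadAlg I) = ι I (ψ' b) := fun b => by
    rw [← coe_compOneEquiv]; simp [ψ']
  let s : comp J i → V ⊗[R] V := fun b => ∑ k, ψ' (lmul J i (D.w k) b) ⊗ₜ D.v k
  have hs : ∀ b, s b ∈ I := fun b => by
    refine mem_of_mulTwo_eq_zero I _ ?_
    have h1 := congrArg Subtype.val (LinearMap.congr_fun h b)
    rw [dl_apply] at h1
    refine Eq.trans ?_ h1
    simp only [s, map_sum, Submodule.coe_sum, mulTwo_tmul, coe_rmul, hψ]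
  let f : W →ₗ[R] comp J (i + 1) →ₗ[R] R :=
    LinearMap.mk₂ R (fun w b => ∑ k, D.w.repr w k * D.v.repr (ψ' b) k)
      (fun _ _ _ => by simp [add_mul, Finset.sum_add_distrib])
      (fun _ _ _ => by simp [Finset.mul_sum, mul_assoc])
      (fun _ _ _ => by simp [mul_add, Finset.sum_add_distrib])
      (fun _ _ _ => by simp [Finset.mul_sum, mul_left_comm])
  have hf : ∀ t, ∀ b : comp J i,
      TensorProduct.lift f (relComp J i (t ⊗ₜ b)) = D.pair t (s b) := by
    intro t b
    induction t using TensorProduct.induction_on with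
    | zero => simp
    | tmul x y =>
      rw [relComp_tmul, TensorProduct.lift.tmul]
      have : lmul J i y b = ∑ l, D.w.repr y l • lmul J i (D.w l) b := by
        conv_lhs => rw [← D.w.sum_repr y]
        simp only [map_sum, LinearMap.sum_apply, map_smul, LinearMap.smul_apply]
      rw [this]
      simp only [s, map_sum, pair_v_right, map_smul, smul_eq_mul]
      exact Finset.sum_congr rfl fun k _ => mul_comm _ _
    | add x y hx hy => rw [TensorProduct.add_tmul, map_add, map_add, hx, hy, map_add]; rfl
  obtain ⟨g, hg⟩ := exists_comp_lift J i f fun t ht b =>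
    (hf t b).trans (D.pair_eq_zero ht (hs b))
  refine ⟨(compZeroEquiv I).symm.toLinearMap ∘ₗ g, LinearMap.ext fun b => Subtype.ext ?_⟩
  rw [dl_apply, hψ, Submodule.coe_sum]
  conv_rhs => rw [← D.v.sum_repr (ψ' b), map_sum]
  refine Finset.sum_congr rfl fun k _ => ?_
  simp only [LinearMap.comp_apply, hg, LinearEquiv.coe_coe, coe_rmul, compZeroEquiv_symm_coe,
    map_smul, Algebra.smul_def]
  congr 2
  simp [f, Finsupp.single_apply]

/-- A linear map on `W ⊗ W` that vanishes on `J` factors through `B₂`. -/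
theorem exists_factor_degree_two {N : Type*} [AddCommGroup N] [Module R N] (g : W ⊗[R] W →ₗ[R] N)
    (hg : ∀ t ∈ J, g t = 0) :
    ∃ χ : comp J 2 →ₗ[R] N, ∀ x y, χ (lmul J 1 x (compOneEquiv J y)) = g (x ⊗ₜ y) := by
  let f : W →ₗ[R] comp J 1 →ₗ[R] N :=
    (LinearMap.lcomp R N (compOneEquiv J).symm.toLinearMap) ∘ₗ TensorProduct.curry g
  have hf : ∀ t, ∀ b : comp J 0, TensorProduct.lift f (relComp J 0 (t ⊗ₜ b)) = aug J b • g t := by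
    intro t b
    induction t using TensorProduct.induction_on with
    | zero => simp
    | tmul x y =>
      have : lmul J 0 y b = aug J b • compOneEquiv J y := by
        conv_lhs => rw [exists_smul_oneComp J b]
        rw [map_smul]
        congr 1
        exact Subtype.ext (by simp)
      rw [relComp_tmul, TensorProduct.lift.tmul, this]
      simp [f]
    | add x y hx hy => rw [TensorProduct.add_tmul, map_add, map_add, hx, hy, map_add, smul_add]
  obtain ⟨χ, hχ⟩ := exists_comp_lift J 0 f fun t ht b => by rw [hf, hg t ht, smul_zero]
  exact ⟨χ, fun x y => by rw [hχ]; simp [f]⟩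

/-- Exactness of the right Koszul complex at `Hom(B₁, A)` follows from the presentation of `A`: a
cycle is an element of `V ⊗ A` with product zero, hence comes from `I ⊗ A`, and elements of `I` are
functionals on `B₂`. -/
theorem exists_dr_eq_of_degree_one {q : ℕ} (ψ : comp J 1 →ₗ[R] comp I (q + 1))
    (h : D.dr ψ = 0) : ∃ χ : comp J 2 →ₗ[R] comp I q, D.dr χ = ψ := by
  let x : V ⊗[R] comp I (q + 1) := ∑ k, D.v k ⊗ₜ ψ (D.basisOne k)
  have hx : TensorProduct.lift (lmul I (q + 1)) x = 0 := by
    have h1 := LinearMap.congr_fun h (oneComp J)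
    rw [dr_apply] at h1
    refine Eq.trans ?_ h1
    simp [x, basisOne_eq_rmul]
  obtain ⟨y, hy⟩ := mem_range_of_lift_lmul_eq_zero I q x hx
  let G : (V ⊗[R] V) ⊗[R] comp I q →ₗ[R] W ⊗[R] W →ₗ[R] comp I q :=
    TensorProduct.lift (LinearMap.mk₂ R (fun s a => (D.pair.flip s).smulRight a)
      (fun _ _ _ => by ext; simp [add_smul]) (fun _ _ _ => by ext; simp [smul_smul])
      (fun _ _ _ => by ext; simp) (fun _ _ _ => by ext; simp; exact smul_comm _ _ _))
  have hG : ∀ s a t, G (s ⊗ₜ a) t = D.pair t s • a := fun s a t => by simp [G]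
  have hG0 : ∀ t ∈ J, ∀ y, G (I.subtype.rTensor (comp I q) y) t = 0 := by
    intro t ht y
    induction y using TensorProduct.induction_on with
    | zero => simp
    | tmul s a => simp [hG, D.pair_eq_zero ht s.2]
    | add x y hx hy => rw [map_add, map_add, LinearMap.add_apply, hx, hy, add_zero]
  obtain ⟨χ, hχ⟩ := exists_factor_degree_two (G (I.subtype.rTensor (comp I q) y))
    fun t ht => hG0 t ht y
  refine ⟨χ, D.basisOne.ext fun k => ?_⟩
  have h1 : ∀ z : (V ⊗[R] V) ⊗[R] comp I q,
      ∑ l, lmul I q (D.v l) (G z (D.w k ⊗ₜ D.w l)) =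
        TensorProduct.lid R _ ((D.v.coord k).rTensor _ (relComp I q z)) := by
    intro z
    induction z using TensorProduct.induction_on with
    | zero => simp
    | tmul s a =>
      induction s using TensorProduct.induction_on with
      | zero => simp
      | tmul u u' =>
        rw [relComp_tmul]
        simp only [hG, pair_w_right, map_smul]
        have h2 : ∑ j, D.w.repr (D.w k) j * D.v.repr u j = D.v.repr u k := by
          simp [Finsupp.single_apply]
        simp only [h2, mul_smul, ← Finset.smul_sum, LinearMap.rTensor_tmul, TensorProduct.lid_tmul,
          Module.Basis.coord_apply]
        congr 1
        calc _ = lmul I q (∑ l, D.v.repr u' l • D.v l) a := by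
              simp only [map_sum, LinearMap.sum_apply, map_smul, LinearMap.smul_apply]
          _ = _ := by rw [D.v.sum_repr]
      | add x y hx hy =>
        rw [TensorProduct.add_tmul]
        simp only [map_add, LinearMap.add_apply, Finset.sum_add_distrib, hx, hy]
    | add x y hx hy => simp only [map_add, LinearMap.add_apply, Finset.sum_add_distrib, hx, hy]
  have h3 := h1 (I.subtype.rTensor (comp I q) y)
  rw [← LinearMap.comp_apply (relComp I q), hy] at h3
  rw [dr_apply]
  have h4 : ∀ l, rmul J 1 (D.w l) (D.basisOne k) = lmul J 1 (D.w k) (compOneEquiv J (D.w l)) :=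
    fun l => Subtype.ext (by simp [basisOne])
  simp only [h4, hχ, h3, x, map_sum, LinearMap.rTensor_tmul, TensorProduct.lid_tmul,
    Module.Basis.coord_apply, Module.Basis.repr_self]
  rw [Finset.sum_eq_single k (fun b _ hb => by simp [hb]) (by simp)]
  simp

end QuadDual

/-! ### The Koszul complex of bimodules -/

namespace QuadDual

open QuadAlg

variable {R V W : Type u} [CommRing R] [AddCommGroup V] [Module R V] [AddCommGroup W]
  [Module R W] {I : Submodule R (V ⊗[R] V)} {J : Submodule R (W ⊗[R] W)} (D : QuadDual I J)

section Contraction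

variable {p q : ℕ}

variable (I) in
/-- Contraction of the right tensor factor with a functional. -/
noncomputable def contractRight (f : comp I q →ₗ[R] R) : comp I p ⊗[R] comp I q →ₗ[R] comp I p :=
  (TensorProduct.rid R _).toLinearMap ∘ₗ f.lTensor _

variable (I) in
/-- Contraction of the left tensor factor with a functional. -/
noncomputable def contractLeft (f : comp I p →ₗ[R] R) : comp I p ⊗[R] comp I q →ₗ[R] comp I q :=
  (TensorProduct.lid R _).toLinearMap ∘ₗ f.rTensor _

@[simp]
theorem contractRight_tmul (f : comp I q →ₗ[R] R) (a : comp I p) (b : comp I q) :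
    contractRight I f (a ⊗ₜ b) = f b • a := by simp [contractRight]

@[simp]
theorem contractLeft_tmul (f : comp I p →ₗ[R] R) (a : comp I p) (b : comp I q) :
    contractLeft I f (a ⊗ₜ b) = f a • b := by simp [contractLeft]

theorem contractRight_rTensor {p' : ℕ} (f : comp I q →ₗ[R] R) (g : comp I p →ₗ[R] comp I p')
    (x : comp I p ⊗[R] comp I q) :
    contractRight I f (g.rTensor _ x) = g (contractRight I f x) := by
  induction x using TensorProduct.induction_on with
  | zero => simp
  | tmul a b => simp
  | add x y hx hy => simp only [map_add, hx, hy]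

theorem contractLeft_lTensor {q' : ℕ} (f : comp I p →ₗ[R] R) (g : comp I q →ₗ[R] comp I q')
    (x : comp I p ⊗[R] comp I q) :
    contractLeft I f (g.lTensor _ x) = g (contractLeft I f x) := by
  induction x using TensorProduct.induction_on with
  | zero => simp
  | tmul a b => simp
  | add x y hx hy => simp only [map_add, hx, hy]

theorem sum_contractRight {σ : Type*} [Fintype σ] (c : Module.Basis σ R (comp I q))
    (x : comp I p ⊗[R] comp I q) : ∑ s, contractRight I (c.coord s) x ⊗ₜ c s = x := by
  induction x using TensorProduct.induction_on with
  | zero => simp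
  | tmul a b =>
    simp only [contractRight_tmul, TensorProduct.smul_tmul, ← TensorProduct.tmul_sum,
      Module.Basis.coord_apply, c.sum_repr]
  | add x y hx hy => simp only [map_add, TensorProduct.add_tmul, Finset.sum_add_distrib, hx, hy]

theorem sum_contractLeft {σ : Type*} [Fintype σ] (c : Module.Basis σ R (comp I p))
    (x : comp I p ⊗[R] comp I q) : ∑ s, c s ⊗ₜ contractLeft I (c.coord s) x = x := by
  induction x using TensorProduct.induction_on with
  | zero => simp
  | tmul a b =>
    simp only [contractLeft_tmul, ← TensorProduct.smul_tmul, ← TensorProduct.sum_tmul,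
      Module.Basis.coord_apply, c.sum_repr]
  | add x y hx hy => simp only [map_add, TensorProduct.tmul_add, Finset.sum_add_distrib, hx, hy]

end Contraction

/-- The term `Hom(Bᵢ, Aₚ ⊗ A_q) = Aₚ ⊗ Bᵢ* ⊗ A_q` of the Koszul complex of bimodules. -/
abbrev Bi (I : Submodule R (V ⊗[R] V)) (J : Submodule R (W ⊗[R] W)) (i p q : ℕ) : Type u :=
  comp J i →ₗ[R] comp I p ⊗[R] comp I q

/-- The left differential of the Koszul complex of bimodules. -/
noncomputable def d₁ {i p q : ℕ} : Bi I J (i + 1) p q →ₗ[R] Bi I J i (p + 1) q :=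
  ∑ k, (LinearMap.lcomp R _ (lmul J i (D.w k))).comp
    (LinearMap.compRight R ((rmul I p (D.v k)).rTensor _))

/-- The right differential of the Koszul complex of bimodules. -/
noncomputable def d₂ {i p q : ℕ} : Bi I J (i + 1) p q →ₗ[R] Bi I J i p (q + 1) :=
  ∑ k, (LinearMap.lcomp R _ (rmul J i (D.w k))).comp
    (LinearMap.compRight R ((lmul I q (D.v k)).lTensor _))

theorem d₁_apply {i p q : ℕ} (ψ : Bi I J (i + 1) p q) (b : comp J i) :
    D.d₁ ψ b = ∑ k, (rmul I p (D.v k)).rTensor _ (ψ (lmul J i (D.w k) b)) := by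
  simp [d₁, LinearMap.sum_apply]

theorem d₂_apply {i p q : ℕ} (ψ : Bi I J (i + 1) p q) (b : comp J i) :
    D.d₂ ψ b = ∑ k, (lmul I q (D.v k)).lTensor _ (ψ (rmul J i (D.w k) b)) := by
  simp [d₂, LinearMap.sum_apply]

theorem d₁_d₂ {i p q : ℕ} (ψ : Bi I J (i + 2) p q) : D.d₁ (D.d₂ ψ) = D.d₂ (D.d₁ ψ) := by
  refine LinearMap.ext fun b => ?_
  simp only [d₁_apply, d₂_apply, map_sum]
  rw [Finset.sum_comm]
  refine Finset.sum_congr rfl fun k _ => Finset.sum_congr rfl fun l _ => ?_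
  rw [lmul_rmul_comm]
  exact LinearMap.congr_fun ((LinearMap.rTensor_comp_lTensor _ _ _).trans
    (LinearMap.lTensor_comp_rTensor _ _ _).symm) _

theorem contractRight_comp_d₁ {i p q : ℕ} (f : comp I q →ₗ[R] R) (ψ : Bi I J (i + 1) p q) :
    contractRight I f ∘ₗ D.d₁ ψ = D.dl (contractRight I f ∘ₗ ψ) :=
  LinearMap.ext fun b => by simp [d₁_apply, dl_apply, contractRight_rTensor]

theorem contractLeft_comp_d₂ {i p q : ℕ} (f : comp I p →ₗ[R] R) (ψ : Bi I J (i + 1) p q) :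
    contractLeft I f ∘ₗ D.d₂ ψ = D.dr (contractLeft I f ∘ₗ ψ) :=
  LinearMap.ext fun b => by simp [d₂_apply, dr_apply, contractLeft_lTensor]

theorem bi_ext_right {i p q : ℕ} {σ : Type*} [Fintype σ] (c : Module.Basis σ R (comp I q))
    {ψ ψ' : Bi I J i p q}
    (h : ∀ s, contractRight I (c.coord s) ∘ₗ ψ = contractRight I (c.coord s) ∘ₗ ψ') : ψ = ψ' :=
  LinearMap.ext fun b => by
    rw [← sum_contractRight c (ψ b), ← sum_contractRight c (ψ' b)]
    exact Finset.sum_congr rfl fun s _ => congrArg (· ⊗ₜ[R] _) (LinearMap.congr_fun (h s) b)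

theorem bi_ext_left {i p q : ℕ} {σ : Type*} [Fintype σ] (c : Module.Basis σ R (comp I p))
    {ψ ψ' : Bi I J i p q}
    (h : ∀ s, contractLeft I (c.coord s) ∘ₗ ψ = contractLeft I (c.coord s) ∘ₗ ψ') : ψ = ψ' :=
  LinearMap.ext fun b => by
    rw [← sum_contractLeft c (ψ b), ← sum_contractLeft c (ψ' b)]
    exact Finset.sum_congr rfl fun s _ => congrArg (_ ⊗ₜ[R] ·) (LinearMap.congr_fun (h s) b)

/-- The image of `d₁` in `Hom(Bᵢ₊₁, Aₚ ⊗ A_q)`; it is zero for `p = 0`. -/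
noncomputable def im₁ (i : ℕ) : ∀ p q : ℕ, Submodule R (Bi I J (i + 1) p q)
  | 0, _ => ⊥
  | _ + 1, _ => LinearMap.range D.d₁

/-- The image of `d₂` in `Hom(Bᵢ₊₁, Aₚ ⊗ A_q)`; it is zero for `q = 0`. -/
noncomputable def im₂ (i : ℕ) : ∀ p q : ℕ, Submodule R (Bi I J (i + 1) p q)
  | _, 0 => ⊥
  | _, _ + 1 => LinearMap.range D.d₂

/-- Exactness of the Koszul complex of right `A`-modules at `Hom(Bᵢ₊₁, A_{q+1})`. -/
def RightExactAt (i q : ℕ) : Prop :=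
  ∀ ψ : comp J (i + 1) →ₗ[R] comp I (q + 1), D.dr ψ = 0 →
    ∃ χ : comp J (i + 2) →ₗ[R] comp I q, D.dr χ = ψ

theorem finite_comp (D : QuadDual I J) (n : ℕ) : Module.Finite R (comp I n) :=
  have : Module.Finite R V := Module.Finite.of_basis D.v
  inferInstance

section Exactness

variable [hA : ∀ n, Module.Free R (comp I n)]

/-- Exactness of the rows of the double complex. -/
theorem mem_im₁ (hL : D.LeftExact) {i p q : ℕ} (z : Bi I J (i + 1) p q) (hz : D.d₁ z = 0) :
    z ∈ D.im₁ i p q := by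
  have := D.finite_comp q
  let c := Module.Free.chooseBasis R (comp I q)
  have h1 : ∀ s, D.dl (contractRight I (c.coord s) ∘ₗ z) = 0 := fun s => by
    rw [← contractRight_comp_d₁, hz, LinearMap.comp_zero]
  cases p with
  | zero =>
    change z = 0
    refine bi_ext_right c fun s => ?_
    rw [LinearMap.comp_zero]
    exact D.dl_injective _ (h1 s)
  | succ p =>
    choose χ hχ using fun s => hL i p _ (h1 s)
    have h2 : ∀ s, contractRight I (c.coord s) ∘ₗ
        (∑ t, (TensorProduct.mk R _ _).flip (c t) ∘ₗ χ t) = χ s := fun s => by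
      classical
      refine LinearMap.ext fun b => ?_
      simp only [LinearMap.comp_apply, LinearMap.sum_apply, LinearMap.flip_apply,
        TensorProduct.mk_apply, map_sum, contractRight_tmul, Module.Basis.coord_apply,
        Module.Basis.repr_self]
      rw [Finset.sum_eq_single s (fun t _ ht => by rw [Finsupp.single_eq_of_ne' ht, zero_smul])
        (by simp)]
      simp
    refine ⟨∑ t, (TensorProduct.mk R _ _).flip (c t) ∘ₗ χ t, bi_ext_right c fun s => ?_⟩
    rw [contractRight_comp_d₁, h2, hχ]

/-- Exactness of the columns of the double complex, where it is known for the right Koszul complex.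
-/
theorem mem_im₂ {i p q : ℕ} (hR : ∀ q', q = q' + 1 → D.RightExactAt i q')
    (z : Bi I J (i + 1) p q) (hz : D.d₂ z = 0) : z ∈ D.im₂ i p q := by
  have := D.finite_comp p
  let c := Module.Free.chooseBasis R (comp I p)
  have h1 : ∀ s, D.dr (contractLeft I (c.coord s) ∘ₗ z) = 0 := fun s => by
    rw [← contractLeft_comp_d₂, hz, LinearMap.comp_zero]
  cases q with
  | zero =>
    change z = 0
    refine bi_ext_left c fun s => ?_
    rw [LinearMap.comp_zero]
    exact D.dr_injective _ (h1 s)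
  | succ q =>
    choose χ hχ using fun s => hR q rfl _ (h1 s)
    have h2 : ∀ s, contractLeft I (c.coord s) ∘ₗ
        (∑ t, TensorProduct.mk R _ _ (c t) ∘ₗ χ t) = χ s := fun s => by
      classical
      refine LinearMap.ext fun b => ?_
      simp only [LinearMap.comp_apply, LinearMap.sum_apply,
        TensorProduct.mk_apply, map_sum, contractLeft_tmul, Module.Basis.coord_apply,
        Module.Basis.repr_self]
      rw [Finset.sum_eq_single s (fun t _ ht => by rw [Finsupp.single_eq_of_ne' ht, zero_smul])
        (by simp)]
      simp
    refine ⟨∑ t, TensorProduct.mk R _ _ (c t) ∘ₗ χ t, bi_ext_left c fun s => ?_⟩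
    rw [contractLeft_comp_d₂, h2, hχ]

/-- A substitute for negation in modules that are only known to be additive monoids. -/
theorem add_neg_one_smul_self {S X : Type*} [Ring S] [AddCommMonoid X] [Module S X] (x : X) :
    x + (-1 : S) • x = 0 := by
  nth_rewrite 1 [← one_smul S x]
  rw [← add_smul, add_neg_cancel, zero_smul]

variable [IsDomain R] [IsPrincipalIdealRing R]

theorem d₁_d₁ {i p q : ℕ} (ψ : Bi I J (i + 2) p q) : D.d₁ (D.d₁ ψ) = 0 := by
  have := D.finite_comp q
  refine bi_ext_right (Module.Free.chooseBasis R (comp I q)) fun s => ?_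
  rw [contractRight_comp_d₁, contractRight_comp_d₁, dl_dl, LinearMap.comp_zero]

theorem d₂_d₂ {i p q : ℕ} (ψ : Bi I J (i + 2) p q) : D.d₂ (D.d₂ ψ) = 0 := by
  have := D.finite_comp p
  refine bi_ext_left (Module.Free.chooseBasis R (comp I p)) fun s => ?_
  rw [contractLeft_comp_d₂, contractLeft_comp_d₂, dr_dr, LinearMap.comp_zero]

/-- A diagram chase in the double complex `Hom(Bᵢ, Aₚ ⊗ A_q)`: an element killed by `d₁ d₂` is a sum
of a `d₁`-boundary and a `d₂`-boundary. -/
theorem mem_im₁_sup_im₂ (hL : D.LeftExact) (N : ℕ)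
    (hR : ∀ i q, i + q < N → D.RightExactAt i q) (i q p : ℕ) (hN : i + q ≤ N)
    (z : Bi I J (i + 2) p q) (hz : D.d₂ (D.d₁ z) = 0) :
    z ∈ D.im₁ (i + 1) p q ⊔ D.im₂ (i + 1) p q := by
  have h1 := D.mem_im₂ (fun q' hq' => hR i q' (by lia)) _ hz
  induction q generalizing p with
  | zero => exact Submodule.mem_sup_left (D.mem_im₁ hL z h1)
  | succ q ih =>
    obtain ⟨x, hx⟩ := h1
    have h2 : D.d₂ (D.d₁ x) = 0 := by rw [← d₁_d₂, hx, d₁_d₁]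
    obtain ⟨x₁, ⟨y, rfl⟩, x₂, hx₂, rfl⟩ := Submodule.mem_sup.1
      (ih (p + 1) (by lia) x h2 (D.mem_im₂ (fun q' hq' => hR i q' (by lia)) _ h2))
    have h3 : D.d₂ x₂ = 0 := by
      cases q with
      | zero => rw [(hx₂ : x₂ = 0), map_zero]
      | succ q =>
        obtain ⟨x₃, rfl⟩ := hx₂
        exact D.d₂_d₂ x₃
    rw [map_add, h3, add_zero, ← d₁_d₂] at hx
    have h4 : z + (-1 : R) • D.d₂ y ∈ D.im₁ (i + 1) p (q + 1) :=
      D.mem_im₁ hL _ (by rw [map_add, map_smul, hx, add_neg_one_smul_self])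
    have h5 : z = z + (-1 : R) • D.d₂ y + D.d₂ y := by
      rw [add_assoc, add_comm (_ • _) (D.d₂ y), add_neg_one_smul_self, add_zero]
    rw [h5]
    exact add_mem (Submodule.mem_sup_left h4) (Submodule.mem_sup_right ⟨y, rfl⟩)

/-- Exactness of the Koszul complex of left modules implies that of right modules, by comparison of
the two differentials of the Koszul complex of bimodules. -/
theorem rightExactAt_of_leftExact (hL : D.LeftExact) (i q : ℕ) : D.RightExactAt i q := by
  have key : ∀ N i q, i + q < N → D.RightExactAt i q := by
    intro N
    induction N with
    | zero => intro i q h; lia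
    | succ N ih =>
      intro i q h
      cases i with
      | zero => exact fun ψ hψ => D.exists_dr_eq_of_degree_one ψ hψ
      | succ i =>
        intro ψ hψ
        -- a cycle `ψ` of the right complex is the cycle `1 ⊗ ψ` in the column `p = 0`, where all
        -- `d₁`-boundaries vanish
        let z : Bi I J (i + 2) 0 (q + 1) := TensorProduct.mk R _ _ (oneComp I) ∘ₗ ψ
        have hz : D.d₂ z = 0 := by
          have : D.d₂ z = TensorProduct.mk R _ _ (oneComp I) ∘ₗ D.dr ψ :=
            LinearMap.ext fun b => by simp [d₂_apply, dr_apply, z]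
          rw [this, hψ, LinearMap.comp_zero]
        have h1 := D.mem_im₁_sup_im₂ hL N ih i (q + 1) 0 (by lia) z
          (by rw [← d₁_d₂, hz, map_zero])
        obtain ⟨x, hx, _, ⟨y, rfl⟩, hy⟩ := Submodule.mem_sup.1 h1
        rw [(hx : x = 0), zero_add] at hy
        refine ⟨contractLeft I ((compZeroEquiv I).toLinearMap) ∘ₗ y, ?_⟩
        rw [← contractLeft_comp_d₂, hy]
        refine LinearMap.ext fun b => ?_
        simp [z, compZeroEquiv_apply]
  exact key _ i q (Nat.lt_succ_self _)

end Exactness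

end QuadDual

/-! ### Exchanging the two algebras -/

namespace QuadDual

open QuadAlg

variable {R V W : Type u} [CommRing R] [AddCommGroup V] [Module R V] [AddCommGroup W]
  [Module R W] {I : Submodule R (V ⊗[R] V)} {J : Submodule R (W ⊗[R] W)} (D : QuadDual I J)
  [hA : ∀ n, Module.Free R (comp I n)]

/-- With respect to the trace pairing the differential of the right Koszul complex of `A` is the
transpose of the differential of the left Koszul complex of `B`. -/
theorem trace_comp_dr {q i : ℕ} [Module.Free R (comp J i)] (θ : comp I (q + 1) →ₗ[R] comp J i)
    (φ : comp J (i + 1) →ₗ[R] comp I q) :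
    LinearMap.trace R (comp J i) (θ ∘ₗ D.dr φ) =
      LinearMap.trace R (comp I q) (φ ∘ₗ D.symm.dl θ) := by
  have := D.finite_comp q
  have := D.symm.finite_comp i
  have h1 : θ ∘ₗ D.dr φ = ∑ k, (θ ∘ₗ lmul I q (D.v k)) ∘ₗ (φ ∘ₗ rmul J i (D.w k)) :=
    LinearMap.ext fun b => by simp [dr_apply, LinearMap.sum_apply]
  have h2 : φ ∘ₗ D.symm.dl θ = ∑ k, (φ ∘ₗ rmul J i (D.w k)) ∘ₗ (θ ∘ₗ lmul I q (D.v k)) :=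
    LinearMap.ext fun b => by simp [dl_apply, LinearMap.sum_apply]; rfl
  rw [h1, h2, map_sum, map_sum]
  exact Finset.sum_congr rfl fun k _ => LinearMap.trace_comp_comm' _ _

variable [IsDomain R] [IsPrincipalIdealRing R]

/-- The boundaries of the right Koszul complex are saturated, being kernels. -/
theorem hom_saturated (hL : D.LeftExact) {i q : ℕ} (r : R)
    (x : comp J i →ₗ[R] comp I (q + 1)) (hr : r ≠ 0)
    (hx : r • x ∈ LinearMap.range (D.dr (i := i) (p := q))) :
    x ∈ LinearMap.range (D.dr (i := i) (p := q)) := by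
  cases i with
  | zero => exact D.dr_surjective x
  | succ i =>
    refine D.rightExactAt_of_leftExact hL i q x ?_
    obtain ⟨y, hy⟩ := hx
    have h1 : r • D.dr x = 0 := by rw [← map_smul, ← hy, dr_dr]
    refine LinearMap.ext fun b => ?_
    have h2 : r • D.dr x b = 0 := by rw [← LinearMap.smul_apply, h1, LinearMap.zero_apply]
    exact (smul_eq_zero.1 h2).resolve_left hr

/-- If the functional `ψ ↦ tr (θ ψ)` vanishes on the boundaries of the right Koszul complex of `A`,
then `θ` is a boundary of the left Koszul complex of `B`. -/
theorem exists_dl_symm_eq (hL : D.LeftExact) {q i : ℕ} [Module.Free R (comp J i)]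
    [Module.Free R (comp J (i + 1))] (θ : comp I (q + 1) →ₗ[R] comp J (i + 1))
    (hθ : ∀ φ : comp J (i + 2) →ₗ[R] comp I q,
      LinearMap.trace R (comp J (i + 1)) (θ ∘ₗ D.dr φ) = 0) :
    ∃ θ' : comp I (q + 2) →ₗ[R] comp J i, D.symm.dl θ' = θ := by
  have := D.finite_comp (q + 1)
  have := D.finite_comp (q + 2)
  have := D.symm.finite_comp i
  have := D.symm.finite_comp (i + 1)
  let l₀ : (comp J (i + 1) →ₗ[R] comp I (q + 1)) →ₗ[R] R :=
    LinearMap.trace R (comp J (i + 1)) ∘ₗ LinearMap.compRight R θ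
  have h0 : ∀ ψ, D.dr ψ = 0 → l₀ ψ = 0 := fun ψ hψ => by
    obtain ⟨φ, rfl⟩ := D.rightExactAt_of_leftExact hL i q ψ hψ
    exact hθ φ
  have hfin : Module.Finite R (comp J i →ₗ[R] comp I (q + 2)) := inferInstance
  obtain ⟨l, hl⟩ := exists_functional_comp_eq (D.dr (i := i) (p := q + 1))
    (fun r x hr hx => D.hom_saturated hL r x hr hx) l₀ h0
  obtain ⟨θ', hθ'⟩ := exists_trace_comp_eq l
  refine ⟨θ', eq_of_trace_comp_eq _ _ fun ψ => ?_⟩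
  rw [← LinearMap.trace_comp_comm', ← D.trace_comp_dr, ← hθ']
  exact LinearMap.congr_fun hl ψ

/-- If `A` has free components and an exact Koszul complex, then `B` has free components: a torsion
element `∑ₖ bₖ wₖ` of `Bₙ₊₂` is the boundary of `θ : A₁ → Bₙ₊₁`, `vₖ ↦ bₖ`, the functional of `θ`
vanishes on boundaries, so `θ` is itself a boundary. -/
theorem free_comp_of_leftExact (hL : D.LeftExact) (n : ℕ) : Module.Free R (comp J n) := by
  induction n using Nat.strong_induction_on with
  | _ n ih =>
    match n with
    | 0 => exact Module.Free.of_equiv (compZeroEquiv J).symm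
    | 1 => exact Module.Free.of_basis D.basisOne
    | n + 2 =>
      have := ih n (by lia)
      have := ih (n + 1) (by lia)
      have := D.symm.finite_comp (n + 2)
      have := D.symm.finite_comp (n + 1)
      have : Module.IsTorsionFree R (comp J (n + 2)) := by
        refine Module.IsTorsionFree.of_smul_eq_zero fun r β hβ => or_iff_not_imp_left.2 fun hr => ?_
        obtain ⟨b, rfl⟩ := exists_sum_rmul D.w (n + 1) β
        let θ : comp I 1 →ₗ[R] comp J (n + 1) := D.symm.basisOne.constr R b
        have h1 : D.symm.dl θ (oneComp I) = ∑ k, rmul J (n + 1) (D.w k) (b k) := by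
          rw [dl_apply]
          refine Finset.sum_congr rfl fun k _ => ?_
          rw [← basisOne_eq_lmul]
          exact congrArg (rmul J (n + 1) (D.w k)) (D.symm.basisOne.constr_basis R b k)
        obtain ⟨θ', hθ'⟩ := D.exists_dl_symm_eq hL θ fun φ => by
          rw [D.trace_comp_dr]
          -- a map from `Bₙ₊₂` to a torsion-free module kills the torsion element
          have : φ ∘ₗ D.symm.dl θ = 0 := hom_ext_one (by
            rw [LinearMap.comp_apply, h1, LinearMap.zero_apply]
            refine (smul_eq_zero.1 (?_ : r • _ = _)).resolve_left hr
            rw [← map_smul, hβ, map_zero])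
          rw [this, map_zero]
        rw [← h1, ← hθ', dl_dl, LinearMap.zero_apply]
      exact Module.free_of_finite_type_torsion_free'

/-- If `A` has free components and an exact Koszul complex, then the Koszul complex of `B` is
exact. -/
theorem LeftExact.symm (hL : D.LeftExact) : D.symm.LeftExact := by
  intro i p θ hθ
  have := D.free_comp_of_leftExact hL
  refine D.exists_dl_symm_eq hL θ fun φ => ?_
  rw [D.trace_comp_dr, hθ, LinearMap.comp_zero, map_zero]

end QuadDual

universe w v u'

/-! ### Resolutions cut into short exact sequences -/

/-- A sequence of short exact sequences `0 → Zₙ₊₁ → Kₙ → Zₙ → 0` with `Kₙ` projective: a projective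
resolution of `Z₀`, cut into its syzygies. -/
structure SyzygySeq (C : Type u') [Category.{v} C] [Abelian C] where
  Z : ℕ → C
  K : ℕ → C
  i : ∀ n, Z (n + 1) ⟶ K n
  p : ∀ n, K n ⟶ Z n
  w : ∀ n, i n ≫ p n = 0
  exact : ∀ n, (ShortComplex.mk (i n) (p n) (w n)).ShortExact
  projective : ∀ n, Projective (K n)

namespace SyzygySeq

variable {C : Type u'} [Category.{v} C] [Abelian C]

/-- Dimension shifting along finitely many short exact sequences: if `Extⁿ⁺¹(Z₀, Y) = 0`, then all
maps `Zₙ₊₁ → Y` extend to `Kₙ`. -/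
theorem exists_factor_of_subsingleton_ext [HasExt.{w} C] (n : ℕ) (Z K : ℕ → C)
    (i : ∀ n, Z (n + 1) ⟶ K n) (p : ∀ n, K n ⟶ Z n) (w : ∀ n, i n ≫ p n = 0)
    (hS : ∀ m ≤ n, (ShortComplex.mk (i m) (p m) (w m)).ShortExact)
    (hK : ∀ m, Projective (K m)) (Y : C) (hY : Subsingleton (Ext.{w} (Z 0) Y (n + 1)))
    (f : Z (n + 1) ⟶ Y) : ∃ g : K n ⟶ Y, i n ≫ g = f := by
  induction n generalizing Z K with
  | zero =>
    obtain ⟨x, hx⟩ := Ext.contravariant_sequence_exact₁ (hS 0 le_rfl) Y (Ext.mk₀ f) (add_zero 1)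
      (Subsingleton.elim _ _)
    obtain ⟨g, rfl⟩ := (Ext.mk₀_bijective _ _).surjective x
    refine ⟨g, (Ext.mk₀_bijective _ _).injective ?_⟩
    rw [← hx, Ext.mk₀_comp_mk₀]
  | succ n ih =>
    refine ih (fun m => Z (m + 1)) (fun m => K (m + 1)) (fun m => i (m + 1)) (fun m => p (m + 1))
      (fun m => w (m + 1)) (fun m hm => hS (m + 1) (by lia)) (fun m => hK (m + 1)) ⟨fun x y => ?_⟩ f
    rw [← sub_eq_zero]
    obtain ⟨z, hz⟩ := Ext.contravariant_sequence_exact₁ (hS 0 (by lia)) Y (x - y) (add_comm 1 _)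
      (Subsingleton.elim _ _)
    have := hK 0
    have hz0 : z = 0 := Ext.eq_zero_of_projective z
    rw [← hz, hz0, Ext.comp_zero]

variable (S : SyzygySeq C)

/-- The resolution of the first syzygy. -/
abbrev tail : SyzygySeq C where
  Z n := S.Z (n + 1)
  K n := S.K (n + 1)
  i n := S.i (n + 1)
  p n := S.p (n + 1)
  w n := S.w (n + 1)
  exact n := S.exact (n + 1)
  projective n := S.projective (n + 1)

/-- The resolution of the `m`-th syzygy. -/
abbrev shift (m : ℕ) : SyzygySeq C where
  Z n := S.Z (m + n)
  K n := S.K (m + n)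
  i n := S.i (m + n)
  p n := S.p (m + n)
  w n := S.w (m + n)
  exact n := S.exact (m + n)
  projective n := S.projective (m + n)

theorem epi_p (n : ℕ) : Epi (S.p n) := (S.exact n).epi_g

section Resolution

/-- The complex `⋯ → K₂ → K₁ → K₀`. -/
noncomputable def complex : ChainComplex C ℕ :=
  ChainComplex.of S.K (fun n => S.p (n + 1) ≫ S.i n) fun n => by
    rw [Category.assoc, ← Category.assoc (S.i (n + 1)), S.w (n + 1), zero_comp, comp_zero]

theorem complex_d (n : ℕ) : S.complex.d (n + 1) n = S.p (n + 1) ≫ S.i n :=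
  ChainComplex.of_d S.K (fun n => S.p (n + 1) ≫ S.i n) n

theorem exact_p_i_p (n : ℕ) :
    (ShortComplex.mk (S.p (n + 1) ≫ S.i n) (S.p n)
      (by rw [Category.assoc, S.w, comp_zero])).Exact :=
  have := S.epi_p (n + 1)
  (ShortComplex.exact_iff_of_epi_of_isIso_of_mono
    (S₁ := ShortComplex.mk (S.p (n + 1) ≫ S.i n) (S.p n) (by rw [Category.assoc, S.w, comp_zero]))
    (S₂ := ShortComplex.mk (S.i n) (S.p n) (S.w n))
    { τ₁ := S.p (n + 1), τ₂ := 𝟙 _, τ₃ := 𝟙 _ }).2 (S.exact n).exact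

theorem complex_exactAt_succ (n : ℕ) : S.complex.ExactAt (n + 1) := by
  rw [HomologicalComplex.exactAt_iff' _ (n + 1 + 1) (n + 1) n (by simp) (by simp)]
  have := (S.exact n).mono_f
  have h := (ShortComplex.exact_iff_of_epi_of_isIso_of_mono
    (S₁ := ShortComplex.mk (S.p (n + 1 + 1) ≫ S.i (n + 1)) (S.p (n + 1))
      (by rw [Category.assoc, S.w, comp_zero]))
    (S₂ := ShortComplex.mk (S.p (n + 1 + 1) ≫ S.i (n + 1)) (S.p (n + 1) ≫ S.i n)
      (by rw [Category.assoc, ← Category.assoc (S.i (n + 1)), S.w (n + 1), zero_comp, comp_zero]))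
    { τ₁ := 𝟙 _, τ₂ := 𝟙 _, τ₃ := S.i n }).1 (S.exact_p_i_p (n + 1))
  refine (ShortComplex.exact_iff_of_iso ?_).1 h
  exact ShortComplex.isoMk (Iso.refl _) (Iso.refl _) (Iso.refl _)
    ((Category.id_comp _).trans ((S.complex_d (n + 1)).trans (Category.comp_id _).symm))
    ((Category.id_comp _).trans ((S.complex_d n).trans (Category.comp_id _).symm))

/-- The augmentation of the complex `⋯ → K₂ → K₁ → K₀`. -/
noncomputable def complexπ : S.complex ⟶ (ChainComplex.single₀ C).obj (S.Z 0) :=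
  (ChainComplex.toSingle₀Equiv _ _).symm ⟨S.p 0, by
    rw [complex_d]
    exact (ShortComplex.mk (S.p 1 ≫ S.i 0) (S.p 0) (by rw [Category.assoc, S.w, comp_zero])).zero⟩

theorem complexπ_f_zero : S.complexπ.f 0 = S.p 0 :=
  ChainComplex.toSingle₀Equiv_symm_apply_f_zero _ _

/-- The projective resolution obtained by splicing the short exact sequences. -/
noncomputable def projectiveResolution : ProjectiveResolution (S.Z 0) where
  complex := S.complex
  projective := S.projective
  π := S.complexπ
  quasiIso := ⟨fun n => by
    cases n
    · rw [ChainComplex.quasiIsoAt₀_iff, ShortComplex.quasiIso_iff_of_zeros']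
      · refine (ShortComplex.exact_and_epi_g_iff_of_iso ?_).2 ⟨S.exact_p_i_p 0, S.epi_p 0⟩
        exact ShortComplex.isoMk (Iso.refl _) (Iso.refl _) (Iso.refl _)
          ((Category.id_comp _).trans ((S.complex_d 0).symm.trans (Category.comp_id _).symm))
          ((Category.id_comp _).trans (S.complexπ_f_zero.symm.trans (Category.comp_id _).symm))
      all_goals rfl
    · rw [quasiIsoAt_iff_exactAt']
      · apply S.complex_exactAt_succ
      · apply ChainComplex.exactAt_succ_single_obj⟩

end Resolution

variable [HasExt.{w} C]

/-- The class of the extension `0 → Zₙ₊₁ → Kₙ → Zₙ → 0`. -/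
noncomputable def δ (n : ℕ) : Ext.{w} (S.Z n) (S.Z (n + 1)) 1 := (S.exact n).extClass

/-- The class of the `n`-fold extension `0 → Zₙ → Kₙ₋₁ → ⋯ → K₀ → Z₀ → 0`. -/
noncomputable def cls (S : SyzygySeq C) : ∀ n : ℕ, Ext.{w} (S.Z 0) (S.Z n) n
  | 0 => Ext.mk₀ (𝟙 _)
  | n + 1 => (cls S n).comp (S.δ n) rfl

theorem cls_zero : S.cls 0 = Ext.mk₀ (𝟙 _) := rfl

theorem cls_succ (n : ℕ) : S.cls (n + 1) = (S.cls n).comp (S.δ n) rfl := rfl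

theorem cls_succ' (n : ℕ) : S.cls (n + 1) = (S.δ 0).comp (S.tail.cls n) (add_comm 1 n) := by
  induction n with
  | zero => exact (Ext.mk₀_id_comp _).trans (Ext.comp_mk₀_id _).symm
  | succ n ih =>
    rw [cls_succ, ih]
    exact Ext.comp_assoc (S.δ 0) (S.tail.cls n) (S.tail.δ n) (add_comm 1 n) rfl (by lia)

theorem cls_add (m n : ℕ) : S.cls (m + n) = (S.cls m).comp ((S.shift m).cls n) rfl := by
  induction n with
  | zero => exact (Ext.comp_mk₀_id _).symm
  | succ n ih =>
    refine (congrArg (fun x => Ext.comp x (S.δ (m + n)) rfl) ih).trans ?_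
    exact Ext.comp_assoc (S.cls m) ((S.shift m).cls n) ((S.shift m).δ n) rfl rfl (by lia)

/-- All elements of `Extⁿ(Z₀, Y)` come from maps `Zₙ → Y`. -/
theorem exists_cls_comp {Y : C} (n : ℕ) (S : SyzygySeq C) (x : Ext.{w} (S.Z 0) Y n) :
    ∃ f : S.Z n ⟶ Y, (S.cls n).comp (Ext.mk₀ f) (add_zero n) = x := by
  induction n generalizing S with
  | zero =>
    obtain ⟨f, rfl⟩ := (Ext.mk₀_bijective _ _).surjective x
    exact ⟨f, Ext.mk₀_id_comp _⟩
  | succ n ih =>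
    have := S.projective 0
    obtain ⟨y, rfl⟩ := Ext.contravariant_sequence_exact₃ (S.exact 0) Y x
      (Ext.eq_zero_of_projective _) (add_comm 1 n)
    obtain ⟨f, rfl⟩ := ih S.tail y
    refine ⟨f, ?_⟩
    rw [cls_succ']
    exact Ext.comp_assoc (S.δ 0) (S.tail.cls n) (Ext.mk₀ f) (add_comm 1 n) (add_zero n) (by lia)

/-- A map `Zₙ₊₁ → Y` with trivial class in `Extⁿ⁺¹(Z₀, Y)` extends to `Kₙ`. -/
theorem exists_factor_of_cls_comp_eq_zero {Y : C} (n : ℕ) (S : SyzygySeq C) (f : S.Z (n + 1) ⟶ Y)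
    (hf : (S.cls (n + 1)).comp (Ext.mk₀ f) (add_zero _) = 0) :
    ∃ g : S.K n ⟶ Y, S.i n ≫ g = f := by
  rw [cls_succ'] at hf
  have hf' : (S.exact 0).extClass.comp ((S.tail.cls n).comp (Ext.mk₀ f) (add_zero n))
      (add_comm 1 n) = 0 :=
    (Ext.comp_assoc (S.δ 0) (S.tail.cls n) (Ext.mk₀ f) (add_comm 1 n) (add_zero n)
      (by lia)).symm.trans hf
  obtain ⟨x, hx⟩ := Ext.contravariant_sequence_exact₁ (S.exact 0) Y _ _ hf'
  cases n with
  | zero =>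
    obtain ⟨g, rfl⟩ := (Ext.mk₀_bijective _ _).surjective x
    refine ⟨g, (Ext.mk₀_bijective _ _).injective ?_⟩
    rw [cls_zero, Ext.mk₀_id_comp] at hx
    rw [← Ext.mk₀_comp_mk₀]
    exact hx
  | succ n =>
    have := S.projective 0
    have hx0 : x = 0 := Ext.eq_zero_of_projective x
    rw [hx0, Ext.comp_zero] at hx
    exact exists_factor_of_cls_comp_eq_zero n S.tail f hx.symm

/-- If every map from `Kₙ` to `Y` vanishes on `Zₙ₊₁`, for all `n`, then `Extⁿ(Z₀, Y)` is the module
of maps from `Zₙ` to `Y`. -/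
noncomputable def extEquiv {R : Type*} [CommRing R] [Linear R C] {Y : C}
    (hY : ∀ n (g : S.K n ⟶ Y), S.i n ≫ g = 0) (n : ℕ) :
    (S.Z n ⟶ Y) ≃ₗ[R] Ext.{w} (S.Z 0) Y n :=
  LinearEquiv.ofBijective
    { toFun f := (S.cls n).comp (Ext.mk₀ f) (add_zero n)
      map_add' f g := by rw [Ext.mk₀_add, Ext.comp_add]
      map_smul' r f := by rw [Ext.mk₀_smul, Ext.comp_smul]; rfl }
    ⟨by
      rw [injective_iff_map_eq_zero]
      intro f hf
      cases n with
      | zero =>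
        refine (Ext.mk₀_bijective _ _).injective ?_
        rw [Ext.mk₀_zero, ← hf]
        exact (Ext.mk₀_id_comp _).symm
      | succ n =>
        obtain ⟨g, rfl⟩ := exists_factor_of_cls_comp_eq_zero n S f hf
        exact hY n g, fun x => exists_cls_comp n S x⟩

theorem extEquiv_apply {R : Type*} [CommRing R] [Linear R C] {Y : C}
    (hY : ∀ n (g : S.K n ⟶ Y), S.i n ≫ g = 0) (n : ℕ) (f : S.Z n ⟶ Y) :
    S.extEquiv (R := R) hY n f = (S.cls n).comp (Ext.mk₀ f) (add_zero n) := rfl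

/-- The Yoneda product in terms of lifts: if `φ` lifts the map `φ₀ : Zₘ → Z₀` to a map between the
resolutions of `Zₘ` and `Z₀`, then the product of the classes of `φ₀` and `g` is the class of
`φₙ ≫ g`. -/
theorem cls_comp_cls {Y : C} (m : ℕ) (φ : ∀ n, S.Z (m + n) ⟶ S.Z n)
    (κ : ∀ n, S.K (m + n) ⟶ S.K n) (hi : ∀ n, S.i (m + n) ≫ κ n = φ (n + 1) ≫ S.i n)
    (hp : ∀ n, S.p (m + n) ≫ φ n = κ n ≫ S.p n) (n : ℕ) (g : S.Z n ⟶ Y) :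
    ((S.cls m).comp (Ext.mk₀ (φ 0)) (add_zero m)).comp ((S.cls n).comp (Ext.mk₀ g) (add_zero n))
      rfl = (S.cls (m + n)).comp (Ext.mk₀ (φ n ≫ g)) (add_zero _) := by
  have key : ∀ n, (Ext.mk₀ (φ 0)).comp (S.cls n) (zero_add n) =
      ((S.shift m).cls n).comp (Ext.mk₀ (φ n)) (add_zero n) := by
    intro n
    induction n with
    | zero =>
      rw [cls_zero, Ext.comp_mk₀_id]
      exact (Ext.mk₀_id_comp _).symm
    | succ n ih =>
      have h : (S.δ (m + n)).comp (Ext.mk₀ (φ (n + 1))) (add_zero 1) =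
          (Ext.mk₀ (φ n)).comp (S.δ n) (zero_add 1) :=
        ShortComplex.ShortExact.extClass_naturality (S.exact (m + n)) (S.exact n)
          { τ₁ := φ (n + 1), τ₂ := κ n, τ₃ := φ n, comm₁₂ := (hi n).symm, comm₂₃ := (hp n).symm }
      calc (Ext.mk₀ (φ 0)).comp (S.cls (n + 1)) (zero_add _)
          = ((Ext.mk₀ (φ 0)).comp (S.cls n) (zero_add n)).comp (S.δ n) rfl :=
            (Ext.comp_assoc _ _ _ (zero_add n) rfl (by lia)).symm
        _ = (((S.shift m).cls n).comp (Ext.mk₀ (φ n)) (add_zero n)).comp (S.δ n) rfl := by rw [ih]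
        _ = ((S.shift m).cls n).comp ((Ext.mk₀ (φ n)).comp (S.δ n) (zero_add 1)) rfl :=
            Ext.comp_assoc ((S.shift m).cls n) (Ext.mk₀ (φ n)) (S.δ n) (add_zero n) (zero_add 1)
              (by lia)
        _ = ((S.shift m).cls n).comp ((S.δ (m + n)).comp (Ext.mk₀ (φ (n + 1))) (add_zero 1))
              rfl := by rw [h]
        _ = ((S.shift m).cls (n + 1)).comp (Ext.mk₀ (φ (n + 1))) (add_zero _) :=
            (Ext.comp_assoc ((S.shift m).cls n) ((S.shift m).δ n) (Ext.mk₀ (φ (n + 1))) rfl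
              (add_zero 1) (by lia)).symm
  calc ((S.cls m).comp (Ext.mk₀ (φ 0)) (add_zero m)).comp
        ((S.cls n).comp (Ext.mk₀ g) (add_zero n)) rfl
      = (((S.cls m).comp (Ext.mk₀ (φ 0)) (add_zero m)).comp (S.cls n) rfl).comp (Ext.mk₀ g)
          (add_zero _) := (Ext.comp_assoc _ _ _ rfl (add_zero n) (by lia)).symm
    _ = ((S.cls m).comp ((Ext.mk₀ (φ 0)).comp (S.cls n) (zero_add n)) rfl).comp (Ext.mk₀ g)
          (add_zero _) := by
        rw [Ext.comp_assoc (S.cls m) (Ext.mk₀ (φ 0)) (S.cls n) (add_zero m) (zero_add n) (by lia)]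
    _ = ((S.cls m).comp (((S.shift m).cls n).comp (Ext.mk₀ (φ n)) (add_zero n)) rfl).comp
          (Ext.mk₀ g) (add_zero _) := by rw [key]
    _ = (((S.cls m).comp ((S.shift m).cls n) rfl).comp (Ext.mk₀ (φ n)) (add_zero _)).comp
          (Ext.mk₀ g) (add_zero _) :=
        congrArg (fun x => Ext.comp x (Ext.mk₀ g) (add_zero _))
          (Ext.comp_assoc (S.cls m) ((S.shift m).cls n) (Ext.mk₀ (φ n)) rfl (add_zero n)
            (by lia)).symm
    _ = ((S.cls (m + n)).comp (Ext.mk₀ (φ n)) (add_zero _)).comp (Ext.mk₀ g) (add_zero _) := by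
        rw [cls_add]
    _ = (S.cls (m + n)).comp ((Ext.mk₀ (φ n)).comp (Ext.mk₀ g) (zero_add 0)) (add_zero _) :=
        Ext.comp_assoc _ _ _ (add_zero _) (zero_add 0) (by lia)
    _ = _ := by rw [Ext.mk₀_comp_mk₀]

section Hom

variable {R : Type*} [CommRing R] [Linear R C] {Y : C} (hY : ∀ n (g : S.K n ⟶ Y), S.i n ≫ g = 0)

/-- If every map from `Kₙ` to `Y` vanishes on `Zₙ₊₁`, for all `n`, then `Extⁿ(Z₀, Y)` is the module
of maps from `Kₙ` to `Y`. -/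
noncomputable def extHomEquiv (n : ℕ) : (S.K n ⟶ Y) ≃ₗ[R] Ext.{w} (S.Z 0) Y n :=
  (LinearEquiv.ofBijective (Linear.leftComp R Y (S.p n))
    ⟨fun f g h => by
      have := S.epi_p n
      exact (cancel_epi (S.p n)).1 h,
    fun g => ⟨(S.exact n).gIsCokernel.desc (CokernelCofork.ofπ g (hY n g)),
      (S.exact n).gIsCokernel.fac (CokernelCofork.ofπ g (hY n g)) WalkingParallelPair.one⟩⟩).symm
    ≪≫ₗ S.extEquiv hY n

theorem extHomEquiv_p_comp (n : ℕ) (f : S.Z n ⟶ Y) :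
    S.extHomEquiv (R := R) hY n (S.p n ≫ f) = (S.cls n).comp (Ext.mk₀ f) (add_zero n) := by
  rw [extHomEquiv, LinearEquiv.trans_apply, ← extEquiv_apply (R := R) S hY]
  congr 1
  exact (LinearEquiv.symm_apply_eq _).2 rfl

theorem extHomEquiv_p_zero (hY : ∀ n (g : S.K n ⟶ S.Z 0), S.i n ≫ g = 0) :
    S.extHomEquiv (R := R) hY 0 (S.p 0) = Ext.mk₀ (𝟙 _) := by
  have := S.extHomEquiv_p_comp (R := R) hY 0 (𝟙 _)
  rw [Category.comp_id] at this
  rw [this, cls_zero]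
  exact Ext.mk₀_id_comp _

/-- The Yoneda product of `Extᵐ(Z₀, Z₀)` and `Extⁿ(Z₀, Y)`, computed by lifting the first factor to
a map of complexes `K_{m + n} → Kₙ`. -/
theorem extHomEquiv_comp (hZ : ∀ n (g : S.K n ⟶ S.Z 0), S.i n ≫ g = 0) (m : ℕ)
    (κ : ∀ n, S.K (m + n) ⟶ S.K n)
    (hκ : ∀ n, κ (n + 1) ≫ S.p (n + 1) ≫ S.i n = (S.p (m + n + 1) ≫ S.i (m + n)) ≫ κ n)
    (n : ℕ) (g : S.K n ⟶ Y) :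
    (S.extHomEquiv (R := R) hZ m (κ 0 ≫ S.p 0)).comp (S.extHomEquiv (R := R) hY n g) rfl =
      S.extHomEquiv (R := R) hY (m + n) (κ n ≫ g) := by
  have hφ : ∀ n, ∃ φ : S.Z (m + n) ⟶ S.Z n, S.p (m + n) ≫ φ = κ n ≫ S.p n := by
    intro n
    refine ⟨(S.exact (m + n)).gIsCokernel.desc (CokernelCofork.ofπ (κ n ≫ S.p n) ?_),
      (S.exact (m + n)).gIsCokernel.fac (CokernelCofork.ofπ (κ n ≫ S.p n) _)
        WalkingParallelPair.one⟩
    cases n with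
    | zero => exact hZ m _
    | succ n =>
      have := (S.exact n).mono_f
      refine (cancel_mono (S.i n)).1 ?_
      have h := hκ n
      change (S.i (m + (n + 1)) ≫ κ (n + 1) ≫ S.p (n + 1)) ≫ S.i n = 0 ≫ S.i n
      rw [zero_comp, Category.assoc, Category.assoc, h]
      have h0 : S.i (m + (n + 1)) ≫ S.p (m + n + 1) = 0 := S.w (m + (n + 1))
      rw [Category.assoc, ← Category.assoc, h0, zero_comp]
  choose φ hp using hφ
  have hi : ∀ n, S.i (m + n) ≫ κ n = φ (n + 1) ≫ S.i n := by
    intro n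
    have := S.epi_p (m + n + 1)
    refine (cancel_epi (S.p (m + n + 1))).1 ?_
    have h : S.p (m + n + 1) ≫ φ (n + 1) = κ (n + 1) ≫ S.p (n + 1) := hp (n + 1)
    rw [← Category.assoc, ← hκ n, ← Category.assoc (S.p (m + n + 1)), h, Category.assoc]
  obtain ⟨f, rfl⟩ : ∃ f, S.p n ≫ f = g := ⟨(S.exact n).gIsCokernel.desc
    (CokernelCofork.ofπ g (hY n g)), (S.exact n).gIsCokernel.fac
      (CokernelCofork.ofπ g (hY n g)) WalkingParallelPair.one⟩
  have h0 : κ 0 ≫ S.p 0 = S.p m ≫ φ 0 := (hp 0).symm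
  rw [h0, extHomEquiv_p_comp, extHomEquiv_p_comp, ← Category.assoc, ← hp, Category.assoc,
    extHomEquiv_p_comp]
  exact S.cls_comp_cls m φ κ hi hp n f

end Hom

end SyzygySeq

/-! ### The Koszul complex of modules over the whole algebra -/

namespace QuadDual

open QuadAlg

variable {R V W : Type u} [CommRing R] [AddCommGroup V] [Module R V] [AddCommGroup W]
  [Module R W] {I : Submodule R (V ⊗[R] V)} {J : Submodule R (W ⊗[R] W)} (D : QuadDual I J)

/-- The differential `Hom(Bᵢ₊₁, A) → Hom(Bᵢ, A)`, `ψ ↦ ∑ₖ ψ(wₖ ·) vₖ`, of the Koszul complex of left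
`A`-modules. -/
noncomputable def dK (i : ℕ) :
    (comp J (i + 1) →ₗ[R] QuadAlg I) →ₗ[QuadAlg I] (comp J i →ₗ[R] QuadAlg I) where
  toFun ψ := ∑ k, (LinearMap.mulRight R (ι I (D.v k))) ∘ₗ ψ ∘ₗ lmul J i (D.w k)
  map_add' ψ χ := by
    ext b; simp [LinearMap.sum_apply, add_mul, Finset.sum_add_distrib]
  map_smul' a ψ := by
    ext b; simp [LinearMap.sum_apply, Finset.mul_sum, mul_assoc]

theorem dK_apply {i : ℕ} (ψ : comp J (i + 1) →ₗ[R] QuadAlg I) (b : comp J i) :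
    D.dK i ψ b = ∑ k, ψ (lmul J i (D.w k) b) * ι I (D.v k) := by
  simp [dK, LinearMap.sum_apply]

variable (I J) in
/-- The augmentation `Hom(B₀, A) → A₀`. -/
noncomputable def augK : (comp J 0 →ₗ[R] QuadAlg I) →ₗ[R] R :=
  (aug I).toLinearMap ∘ₗ LinearMap.applyₗ (oneComp J)

theorem augK_apply (ψ : comp J 0 →ₗ[R] QuadAlg I) : augK I J ψ = aug I (ψ (oneComp J)) := rfl

theorem augK_smul (a : QuadAlg I) (ψ : comp J 0 →ₗ[R] QuadAlg I) :
    augK I J (a • ψ) = aug I a * augK I J ψ := by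
  simp [augK_apply]

/-- The syzygies of the Koszul complex: the kernel of the augmentation and the kernels of the
differentials. -/
noncomputable def syz : ∀ i : ℕ, Submodule (QuadAlg I) (comp J i →ₗ[R] QuadAlg I)
  | 0 => { carrier := {ψ | augK I J ψ = 0}
           add_mem' := fun {a b} (ha : augK I J a = 0) (hb : augK I J b = 0) =>
             show augK I J (a + b) = 0 by rw [map_add, ha, hb, add_zero]
           zero_mem' := map_zero _
           smul_mem' := fun a ψ (h : augK I J ψ = 0) =>
             show augK I J (a • ψ) = 0 by rw [augK_smul, h, mul_zero] }
  | i + 1 => LinearMap.ker (D.dK i)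

theorem mem_syz_zero (ψ : comp J 0 →ₗ[R] QuadAlg I) : ψ ∈ D.syz 0 ↔ augK I J ψ = 0 := Iff.rfl

theorem mem_syz_succ {i : ℕ} (ψ : comp J (i + 1) →ₗ[R] QuadAlg I) :
    ψ ∈ D.syz (i + 1) ↔ D.dK i ψ = 0 := Iff.rfl

theorem dK_subtype {i p : ℕ} (ψ : comp J (i + 1) →ₗ[R] comp I p) :
    D.dK i ((comp I p).subtype ∘ₗ ψ) = (comp I (p + 1)).subtype ∘ₗ D.dl ψ := by
  refine LinearMap.ext fun b => ?_
  rw [dK_apply, LinearMap.comp_apply, dl_apply, map_sum]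
  rfl

variable (I) in
theorem toComp_mul_ι (p : ℕ) (a : QuadAlg I) (v : V) :
    toComp I (p + 1) (a * ι I v) = rmul I p v (toComp I p a) := by
  induction a using DirectSum.Decomposition.inductionOn (comp I) with
  | zero => simp
  | homogeneous a =>
    rename_i q
    by_cases h : q = p
    · subst h
      rw [toComp_coe]
      exact toComp_coe I (q + 1) (rmul I q v a)
    · rw [toComp_of_ne I h a.2, map_zero]
      exact toComp_of_ne I (by lia) (rmul I q v a).2
  | add a b ha hb => rw [add_mul, map_add, ha, hb, map_add, map_add]

theorem toComp_comp_dK {i : ℕ} (p : ℕ) (ψ : comp J (i + 1) →ₗ[R] QuadAlg I) :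
    toComp I (p + 1) ∘ₗ D.dK i ψ = D.dl (toComp I p ∘ₗ ψ) := by
  refine LinearMap.ext fun b => ?_
  rw [dl_apply, LinearMap.comp_apply, dK_apply, map_sum]
  exact Finset.sum_congr rfl fun k _ => toComp_mul_ι I p _ _

variable (I) in
theorem aug_eq_aug_toComp (a : QuadAlg I) : aug I a = aug I (toComp I 0 a : QuadAlg I) := by
  induction a using DirectSum.Decomposition.inductionOn (comp I) with
  | zero => simp
  | homogeneous a =>
    rename_i q
    by_cases h : q = 0
    · subst h
      rw [toComp_coe]
    · rw [toComp_of_ne I h a.2, aug_eq_zero I q h _ a.2]; simp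
  | add a b ha hb => rw [map_add, map_add, ha, hb, Submodule.coe_add, map_add]

/-- An element of `Hom(Bᵢ, A)` is the sum of its components, finitely many of which are nonzero as
`Bᵢ` is finitely generated. -/
theorem eventually_eq_sum_toComp {i : ℕ} [Module.Finite R (comp J i)]
    (ψ : comp J i →ₗ[R] QuadAlg I) :
    ∀ᶠ N in Filter.atTop,
      ψ = ∑ p ∈ Finset.range N, (comp I p).subtype ∘ₗ toComp I p ∘ₗ ψ := by
  have h1 : ∀ a : QuadAlg I, ∀ᶠ N in Filter.atTop,
      a = ∑ p ∈ Finset.range N, (toComp I p a : QuadAlg I) := by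
    intro a
    induction a using DirectSum.Decomposition.inductionOn (comp I) with
    | zero => simp
    | homogeneous a =>
      rename_i q
      filter_upwards [Filter.eventually_gt_atTop q] with N hN
      rw [Finset.sum_eq_single q (fun p _ hp => by rw [toComp_of_ne I (Ne.symm hp) a.2]; rfl)
        (fun h => absurd (Finset.mem_range.2 hN) h), toComp_coe]
    | add a b ha hb =>
      filter_upwards [ha, hb] with N h h'
      conv_lhs => rw [h, h']
      simp [Finset.sum_add_distrib]
  obtain ⟨s, hs⟩ := Module.Finite.fg_top (R := R) (M := comp J i)
  filter_upwards [(Filter.eventually_all_finset s).2 fun b _ => h1 (ψ b)] with N hN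
  refine LinearMap.ext_on hs fun b hb => ?_
  rw [LinearMap.sum_apply]
  exact hN b hb

/-- The Koszul complex is minimal: the values of the syzygies have zero augmentation. -/
theorem aug_apply_eq_zero_of_mem_syz {i : ℕ} {ψ : comp J i →ₗ[R] QuadAlg I} (h : ψ ∈ D.syz i)
    (b : comp J i) : aug I (ψ b) = 0 := by
  cases i with
  | zero =>
    have h' : aug I (ψ (oneComp J)) = 0 := h
    rw [exists_smul_oneComp J b, map_smul, map_smul, h', smul_zero]
  | succ i =>
    have h1 : D.dl (toComp I 0 ∘ₗ ψ) = 0 := by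
      rw [← toComp_comp_dK, (D.mem_syz_succ ψ).1 h, LinearMap.comp_zero]
    have h2 := LinearMap.congr_fun (D.dl_injective _ h1) b
    rw [LinearMap.comp_apply] at h2
    rw [aug_eq_aug_toComp, h2]
    simp

theorem toComp_zero_comp_of_mem_syz {i : ℕ} {ψ : comp J i →ₗ[R] QuadAlg I} (h : ψ ∈ D.syz i) :
    toComp I 0 ∘ₗ ψ = 0 :=
  LinearMap.ext fun b => coe_eq_zero_of_aug ((aug_eq_aug_toComp I (ψ b)).symm.trans
    (D.aug_apply_eq_zero_of_mem_syz h b))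

theorem exists_dl_eq_toComp_comp {i : ℕ} (hL : ∀ i', i = i' + 1 → D.LeftExactAt i')
    {ψ : comp J i →ₗ[R] QuadAlg I} (h : ψ ∈ D.syz i) (p : ℕ) :
    ∃ χ : comp J (i + 1) →ₗ[R] comp I p, D.dl χ = toComp I (p + 1) ∘ₗ ψ := by
  cases i with
  | zero => exact D.dl_surjective _
  | succ i =>
    refine hL i rfl p _ ?_
    rw [← toComp_comp_dK, (D.mem_syz_succ ψ).1 h, LinearMap.comp_zero]

/-- Exactness of the Koszul complex of left `A`-modules. -/
theorem exists_dK_eq (hL : D.LeftExact) {i : ℕ} {ψ : comp J i →ₗ[R] QuadAlg I} (h : ψ ∈ D.syz i) :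
    ∃ χ, D.dK i χ = ψ := by
  have key : ∀ p, ∃ χ : comp J (i + 1) →ₗ[R] QuadAlg I,
      D.dK i χ = (comp I p).subtype ∘ₗ toComp I p ∘ₗ ψ := by
    intro p
    cases p with
    | zero => exact ⟨0, by rw [D.toComp_zero_comp_of_mem_syz h, map_zero, LinearMap.comp_zero]⟩
    | succ p =>
      obtain ⟨χ, hχ⟩ := D.exists_dl_eq_toComp_comp (fun i _ => hL i) h p
      exact ⟨(comp I p).subtype ∘ₗ χ, by rw [dK_subtype, hχ]⟩
  choose χ hχ using key
  have := D.symm.finite_comp i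
  obtain ⟨N, hN⟩ := (eventually_eq_sum_toComp ψ).exists
  refine ⟨∑ p ∈ Finset.range N, χ p, ?_⟩
  rw [map_sum]
  exact (Finset.sum_congr rfl fun p _ => hχ p).trans hN.symm

theorem dK_mem_syz [IsDomain R] [IsPrincipalIdealRing R] {i : ℕ}
    (ψ : comp J (i + 1) →ₗ[R] QuadAlg I) : D.dK i ψ ∈ D.syz i := by
  cases i with
  | zero =>
    rw [mem_syz_zero, augK_apply, dK_apply, map_sum]
    simp [aug_ι]
  | succ i =>
    rw [mem_syz_succ]
    have := D.symm.finite_comp (i + 2)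
    obtain ⟨N, hN⟩ := (eventually_eq_sum_toComp ψ).exists
    rw [hN, map_sum, map_sum]
    refine Finset.sum_eq_zero fun p _ => ?_
    rw [dK_subtype, dK_subtype, dl_dl, LinearMap.comp_zero]

end QuadDual

/-! ### The Yoneda algebra -/

namespace QuadDual

open QuadAlg

variable {R V W : Type u} [CommRing R] [AddCommGroup V] [Module R V] [AddCommGroup W]
  [Module R W] {I : Submodule R (V ⊗[R] V)} {J : Submodule R (W ⊗[R] W)} (D : QuadDual I J)

section EvalAug

variable (I J)

/-- The left `A`-module `Hom(Bₙ, A)`. -/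
noncomputable abbrev modK (n : ℕ) : ModuleCat.{u} (QuadAlg I) :=
  ModuleCat.of (QuadAlg I) (comp J n →ₗ[R] QuadAlg I)

variable {J}

/-- The map `Hom(Bₙ, A) → A₀`, `ψ ↦ ε(ψ(β))`, for `β ∈ Bₙ`. -/
noncomputable def evalAug {n : ℕ} (β : comp J n) : modK I J n ⟶ baseModule I :=
  ModuleCat.ofHom (Y := baseModule I)
    { toFun := fun ψ => (aug I (ψ β) : R)
      map_add' := fun ψ χ => map_add (aug I) (ψ β) (χ β)
      map_smul' := fun a ψ => map_mul (aug I) a (ψ β) }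

theorem evalAug_apply {n : ℕ} (β : comp J n) (ψ : comp J n →ₗ[R] QuadAlg I) :
    (evalAug I β).hom ψ = aug I (ψ β) := rfl

/-- All maps `Hom(Bₙ, A) → A₀` are evaluations at elements of `Bₙ`, if `Bₙ` is free. -/
noncomputable def evalAugEquiv (n : ℕ) [Module.Free R (comp J n)] [Module.Finite R (comp J n)] :
    comp J n ≃ₗ[R] (modK I J n ⟶ baseModule I) :=
  LinearEquiv.ofBijective
    { toFun := evalAug I
      map_add' := fun β γ => ModuleCat.hom_ext (LinearMap.ext fun ψ =>
        (congrArg (aug I) (map_add ψ β γ)).trans (map_add (aug I) (ψ β) (ψ γ)))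
      map_smul' := fun r β => ModuleCat.hom_ext (LinearMap.ext fun ψ => by
        refine (congrArg (aug I) (map_smul ψ r β)).trans ?_
        rw [Algebra.smul_def, map_mul]
        rfl) } <| by
    let b := Module.Free.chooseBasis R (comp J n)
    let φ : ∀ k, comp J n →ₗ[R] QuadAlg I := fun k => (Algebra.linearMap R _) ∘ₗ b.coord k
    have hφ : ∀ k β, aug I (φ k β) = b.repr β k := fun k β => (aug I).commutes _
    refine ⟨(injective_iff_map_eq_zero _).2 fun β hβ => ?_, fun g => ?_⟩
    · refine b.ext_elem fun k => ?_
      rw [map_zero, Finsupp.zero_apply, ← hφ]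
      exact congrArg (fun f => f.hom (φ k)) hβ
    · let c : Module.Free.ChooseBasisIndex R (comp J n) → R := fun k => g.hom (φ k)
      refine ⟨∑ k, c k • b k, ModuleCat.hom_ext (LinearMap.ext fun ψ => ?_)⟩
      have hψ : ψ = ∑ k, ψ (b k) • φ k := b.ext fun l => by
        rw [LinearMap.sum_apply, Finset.sum_eq_single l (fun k _ hk => ?_) (by simp)]
        · simp [φ]
        · simp [φ, hk.symm]
      have h1 : g.hom ψ = ∑ k, aug I (ψ (b k)) * c k := by
        conv_lhs => rw [hψ]
        rw [map_sum]
        exact Finset.sum_congr rfl fun k _ => map_smul g.hom (ψ (b k)) (φ k)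
      refine Eq.trans ?_ h1.symm
      refine (evalAug_apply I _ ψ).trans ?_
      simp only [map_sum, map_smul, smul_eq_mul]
      exact Finset.sum_congr rfl fun k _ => mul_comm (c k) _

end EvalAug

theorem projective_modK (n : ℕ) [Module.Free R (comp J n)] [Module.Finite R (comp J n)] :
    Projective (modK I J n) :=
  have : Module.Free (QuadAlg I) (comp J n →ₗ[R] QuadAlg I) :=
    Module.Free.of_equiv ((Module.Free.chooseBasis R (comp J n)).constr (QuadAlg I))
  ModuleCat.projective_of_free (Module.Free.chooseBasis (QuadAlg I) _)

/-- The map of complexes `Hom(Bₘ₊ₙ, A) → Hom(Bₙ, A)`, `ψ ↦ ψ(· β)`, for `β ∈ Bₘ`. -/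
noncomputable def mulK {m : ℕ} (β : comp J m) (n : ℕ) : modK I J (m + n) ⟶ modK I J n :=
  ModuleCat.ofHom
    { toFun := fun ψ => ψ ∘ₗ (LinearMap.mulRight R (β : QuadAlg J)).restrict (q := comp J (m + n))
        fun b hb => by
          rw [add_comm]
          exact SetLike.GradedMul.mul_mem hb β.2
      map_add' := fun _ _ => rfl
      map_smul' := fun _ _ => rfl }

theorem mulK_apply {m : ℕ} (β : comp J m) (n : ℕ) (ψ : comp J (m + n) →ₗ[R] QuadAlg I)
    (b : comp J n) (c : comp J (m + n)) (h : (c : QuadAlg J) = b * β) :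
    ((mulK β n).hom ψ : comp J n →ₗ[R] QuadAlg I) b = ψ c :=
  congrArg ψ (Subtype.ext h.symm)

theorem mulK_dK {m : ℕ} (β : comp J m) (n : ℕ) (ψ : comp J (m + n + 1) →ₗ[R] QuadAlg I) :
    D.dK n ((mulK (I := I) β (n + 1)).hom ψ) = (mulK β n).hom (D.dK (m + n) ψ) := by
  refine LinearMap.ext fun b => ?_
  have hb : (b * β : QuadAlg J) ∈ comp J (m + n) := by
    rw [add_comm]
    exact SetLike.GradedMul.mul_mem b.2 β.2
  rw [mulK_apply β n (D.dK (m + n) ψ) b ⟨b * β, hb⟩ rfl, dK_apply, dK_apply]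
  refine Finset.sum_congr rfl fun k _ => congrArg (· * _) ?_
  exact mulK_apply β (n + 1) ψ _ _ (mul_assoc _ _ _).symm

variable [IsDomain R] [IsPrincipalIdealRing R]

/-- The syzygies of the `A`-module `A₀` in the Koszul complex. -/
noncomputable def modZ : ℕ → ModuleCat.{u} (QuadAlg I)
  | 0 => baseModule I
  | n + 1 => ModuleCat.of (QuadAlg I) (D.syz n)

/-- The projection to the `n`-th syzygy: the augmentation or a differential. -/
noncomputable def modP : ∀ n, modK I J n ⟶ D.modZ n
  | 0 => evalAug I (oneComp J)
  | n + 1 => ModuleCat.ofHom ((D.dK n).codRestrict (D.syz n) D.dK_mem_syz)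

theorem modP_apply_eq_zero_iff (n : ℕ) (ψ : comp J n →ₗ[R] QuadAlg I) :
    (D.modP n).hom ψ = 0 ↔ ψ ∈ D.syz n := by
  cases n with
  | zero => exact Iff.rfl
  | succ n => exact Subtype.ext_iff

theorem modP_surjective (hL : D.LeftExact) (n : ℕ) : Function.Surjective (D.modP n).hom := by
  cases n with
  | zero =>
    rintro (r : R)
    refine ⟨LinearMap.toSpanSingleton R _ (r • (1 : QuadAlg I)) ∘ₗ
      (compZeroEquiv J).toLinearMap, ?_⟩
    refine (evalAug_apply I _ _).trans ?_
    simp [compZeroEquiv_apply]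
    rfl
  | succ n =>
    rintro ⟨ψ, hψ⟩
    obtain ⟨χ, hχ⟩ := D.exists_dK_eq hL hψ
    exact ⟨χ, Subtype.ext hχ⟩

variable [hB : ∀ n, Module.Free R (comp J n)]

/-- The Koszul complex, as a projective resolution of the `A`-module `A₀`. -/
noncomputable def modSyzygySeq (hL : D.LeftExact) : SyzygySeq (ModuleCat.{u} (QuadAlg I)) where
  Z := D.modZ
  K := modK I J
  i n := ModuleCat.ofHom (D.syz n).subtype
  p := D.modP
  w n := ModuleCat.hom_ext (LinearMap.ext fun ψ => (D.modP_apply_eq_zero_iff n ψ.1).2 ψ.2)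
  exact n := by
    refine ShortComplex.ShortExact.mk' ?_ ?_ ?_
    · rw [ShortComplex.moduleCat_exact_iff]
      exact fun ψ hψ => ⟨⟨ψ, (D.modP_apply_eq_zero_iff n ψ).1 hψ⟩, rfl⟩
    · rw [ModuleCat.mono_iff_injective]
      exact Subtype.val_injective
    · rw [ModuleCat.epi_iff_surjective]
      exact D.modP_surjective hL n
  projective n := by
    have := D.symm.finite_comp n
    exact projective_modK n

theorem modSyzygySeq_i_comp (hL : D.LeftExact) (n : ℕ) (g : modK I J n ⟶ baseModule I) :
    (D.modSyzygySeq hL).i n ≫ g = 0 := by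
  have := D.symm.finite_comp n
  obtain ⟨β, rfl⟩ := (evalAugEquiv I n).surjective g
  exact ModuleCat.hom_ext (LinearMap.ext fun ψ => D.aug_apply_eq_zero_of_mem_syz ψ.2 β)

/-- The isomorphism `Extⁿ(A₀, A₀) ≅ Bₙ`. -/
noncomputable def extEquivComp (hL : D.LeftExact) (n : ℕ) :
    comp J n ≃ₗ[R] Ext.{u} (baseModule I) (baseModule I) n :=
  have := D.symm.finite_comp n
  (evalAugEquiv I n).trans
    ((D.modSyzygySeq hL).extHomEquiv (R := R) (D.modSyzygySeq_i_comp hL) n)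

theorem extEquivComp_one (hL : D.LeftExact) :
    D.extEquivComp hL 0 (oneComp J) = Ext.mk₀ (𝟙 (baseModule I)) :=
  (D.modSyzygySeq hL).extHomEquiv_p_zero (R := R) (D.modSyzygySeq_i_comp hL)

/-- The class of `β ∈ Bₘ` lifts to the map of complexes `ψ ↦ ψ(· β)`, hence its product with the
class of `γ` is the class of `γ β`. -/
theorem extEquivComp_comp (hL : D.LeftExact) (m n : ℕ) (β : comp J m) (γ : comp J n)
    (c : comp J (m + n)) (hc : (c : QuadAlg J) = γ * β) :
    (D.extEquivComp hL m β).comp (D.extEquivComp hL n γ) rfl = D.extEquivComp hL (m + n) c := by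
  have h := (D.modSyzygySeq hL).extHomEquiv_comp (R := R) (D.modSyzygySeq_i_comp hL)
    (D.modSyzygySeq_i_comp hL) m (mulK β)
    (fun n => ModuleCat.hom_ext (LinearMap.ext fun ψ => D.mulK_dK β n ψ)) n (evalAug I γ)
  have h1 : mulK β 0 ≫ (D.modSyzygySeq hL).p 0 = evalAug I β :=
    ModuleCat.hom_ext (LinearMap.ext fun ψ => congrArg (aug I)
      (mulK_apply β 0 ψ (oneComp J) β (one_mul _).symm))
  have h2 : mulK β n ≫ evalAug I γ = evalAug I c :=
    ModuleCat.hom_ext (LinearMap.ext fun ψ => congrArg (aug I) (mulK_apply β n ψ γ c hc))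
  let E := fun n => (D.modSyzygySeq hL).extHomEquiv (R := R) (D.modSyzygySeq_i_comp hL) n
  exact (congrArg (fun f => Ext.comp (E m f) (E n (evalAug I γ)) rfl) h1.symm).trans
    (h.trans (congrArg (E (m + n)) h2))

/-- The Yoneda algebra of `A` is the opposite of `B`. -/
noncomputable def extAlgEquivOp (hL : D.LeftExact) : ExtAlgEquivOp I J where
  equiv n := (D.extEquivComp hL n).symm
  map_one := by
    rw [← D.extEquivComp_one hL, LinearEquiv.symm_apply_apply]
    rfl
  map_comp := by
    rintro m n _ rfl α α'
    obtain ⟨β, rfl⟩ := (D.extEquivComp hL m).surjective α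
    obtain ⟨γ, rfl⟩ := (D.extEquivComp hL n).surjective α'
    have hc : (γ * β : QuadAlg J) ∈ comp J (m + n) := by
      rw [add_comm]
      exact SetLike.GradedMul.mul_mem γ.2 β.2
    rw [D.extEquivComp_comp hL m n β γ ⟨γ * β, hc⟩ rfl, LinearEquiv.symm_apply_apply,
      LinearEquiv.symm_apply_apply, LinearEquiv.symm_apply_apply]

end QuadDual

/-! ### Graded modules -/

namespace GrMod

variable {R A : Type u} [CommRing R] [Ring A] [Algebra R A]
  {𝒜 : ℕ → Submodule R A} [SetLike.GradedMonoid 𝒜]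

theorem range_stable {M N : GrMod 𝒜} (f : M ⟶ N) {n : ℕ} {i j : ℤ} (h : (n : ℤ) + i = j) (a : 𝒜 n)
    (m : N.obj i) (hm : m ∈ LinearMap.range (f.app i)) :
    N.act h a m ∈ LinearMap.range (f.app j) := by
  obtain ⟨x, rfl⟩ := hm
  exact ⟨M.act h a x, f.app_act h a x⟩

/-- The cokernel of a morphism of graded modules. -/
def coker {M N : GrMod 𝒜} (f : M ⟶ N) : GrMod 𝒜 :=
  quot N (fun i => LinearMap.range (f.app i)) fun h a m hm => range_stable f h a m hm

/-- The projection to the cokernel. -/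
def cokerπ {M N : GrMod 𝒜} (f : M ⟶ N) : N ⟶ coker f where
  app i := (LinearMap.range (f.app i)).mkQ
  app_act _ _ _ := rfl

theorem cokerπ_app_eq_zero_iff {M N : GrMod 𝒜} (f : M ⟶ N) (i : ℤ) (m : N.obj i) :
    (cokerπ f).app i m = 0 ↔ m ∈ LinearMap.range (f.app i) :=
  Submodule.Quotient.mk_eq_zero _

theorem cokerπ_surjective {M N : GrMod 𝒜} (f : M ⟶ N) (i : ℤ) :
    Function.Surjective ((cokerπ f).app i) :=
  Submodule.mkQ_surjective _

theorem surjective_of_epi {M N : GrMod 𝒜} (f : M ⟶ N) [Epi f] (i : ℤ) :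
    Function.Surjective (f.app i) := by
  have h : f ≫ cokerπ f = f ≫ 0 := by
    rw [comp_zero]
    ext i m
    exact (cokerπ_app_eq_zero_iff f i _).2 ⟨m, rfl⟩
  intro x
  refine (cokerπ_app_eq_zero_iff f i x).1 ?_
  rw [(cancel_epi f).1 h]
  rfl

/-- Short exactness of graded modules can be checked degree by degree. -/
theorem shortExact {K M N : GrMod 𝒜} (k : K ⟶ M) (g : M ⟶ N) (w : k ≫ g = 0)
    (hk : ∀ i, Function.Injective (k.app i)) (hg : ∀ i, Function.Exact (k.app i) (g.app i))
    (hs : ∀ i, Function.Surjective (g.app i)) : (ShortComplex.mk k g w).ShortExact := by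
  obtain ⟨h1⟩ := isLimit_of_exact k g w hk hg
  obtain ⟨h2⟩ := isColimit_of_exact k g w hs hg
  exact { exact := ShortComplex.exact_of_f_is_kernel (ShortComplex.mk k g w) h1
          mono_f := mono_of_isLimit_fork h1
          epi_g := epi_of_isColimit_cofork h2 }

/-- A morphism from a module that is generated in degree `d` to a module that vanishes in degree `d`
is zero. -/
theorem hom_eq_zero {M N : GrMod 𝒜} {d : ℤ} (hM : M.FinGeneratedInDegree d)
    (hN : ∀ x : N.obj d, x = 0) (f : M ⟶ N) : f = 0 := by
  obtain ⟨s, hs⟩ := hM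
  ext j m
  have hm : m ∈ (⊤ : Submodule R (M.obj j)) := trivial
  rw [← hs j] at hm
  induction hm using Submodule.span_induction with
  | mem x hx =>
    obtain ⟨n, h, a, y, -, rfl⟩ := hx
    rw [f.app_act, hN (f.app d y), map_zero]
    rfl
  | zero => simp
  | add x y _ _ hx hy => rw [map_add, map_add, hx, hy]
  | smul r x _ hx => rw [map_smul, map_smul, hx]

end GrMod

/-- A finitely generated module over a principal ideal domain is free modulo torsion: a basis `b`
modulo torsion and its coordinates `φ` determine all maps to a torsion-free module. -/
theorem exists_dual_family {R : Type*} [CommRing R] [IsDomain R] [IsPrincipalIdealRing R]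
    (M : Type*) [AddCommGroup M] [Module R M] [Module.Finite R M] (N : Type*) [AddCommGroup N]
    [Module R N] [Module.IsTorsionFree R N] :
    ∃ (n : ℕ) (b : Fin n → M) (φ : Fin n → Module.Dual R M),
      (∀ k l, φ k (b l) = if k = l then 1 else 0) ∧
        ∀ (ψ : M →ₗ[R] N) (m : M), ψ m = ∑ k, φ k m • ψ (b k) := by
  let T := Submodule.torsion R M
  have : Module.IsTorsionFree R (M ⧸ T) := inferInstance
  let c := Module.finBasis R (M ⧸ T)
  choose b hb using fun k => T.mkQ_surjective (c k)
  refine ⟨_, b, fun k => c.coord k ∘ₗ T.mkQ, fun k l => ?_, fun ψ m => ?_⟩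
  · rw [LinearMap.comp_apply, hb, Module.Basis.coord_apply, Module.Basis.repr_self,
      Finsupp.single_apply]
    simp only [eq_comm]
  · have h1 : m - ∑ k, (c.coord k ∘ₗ T.mkQ) m • b k ∈ T := by
      refine (Submodule.Quotient.mk_eq_zero T).1 ?_
      rw [← Submodule.mkQ_apply, map_sub, map_sum, sub_eq_zero]
      simp only [map_smul, hb]
      exact (c.sum_repr (T.mkQ m)).symm
    obtain ⟨r, hr⟩ := h1
    have h2 : (r : R) • ψ (m - ∑ k, (c.coord k ∘ₗ T.mkQ) m • b k) = 0 := by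
      rw [← map_smul]
      exact (congrArg ψ hr).trans (map_zero ψ)
    have h3 := (smul_eq_zero.1 h2).resolve_left (nonZeroDivisors.coe_ne_zero r)
    rw [map_sub, sub_eq_zero] at h3
    simpa only [map_sum, map_smul] using h3

/-! ### The graded modules of the Koszul complex -/

namespace QuadAlg

variable {R V : Type u} [CommRing R] [AddCommGroup V] [Module R V] (I : Submodule R (V ⊗[R] V))

/-- The degree `j` part of the free module generated in degree `i`: the component of `A` of degree
`j - i`, which is zero if `j < i`. -/
noncomputable def compAt (i j : ℤ) : Submodule R (QuadAlg I) :=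
  if i ≤ j then comp I (j - i).toNat else ⊥

theorem compAt_eq {n : ℕ} {i j : ℤ} (h : (n : ℤ) + i = j) : compAt I i j = comp I n := by
  rw [compAt, if_pos (by lia), show (j - i).toNat = n by lia]

theorem compAt_eq_bot {i j : ℤ} (h : j < i) : compAt I i j = ⊥ := if_neg (by lia)

theorem compAt_cases (i j : ℤ) : (∃ n : ℕ, (n : ℤ) + i = j) ∨ j < i := by
  by_cases h : i ≤ j
  · exact Or.inl ⟨(j - i).toNat, by lia⟩
  · exact Or.inr (by lia)

variable {I} in
theorem mul_mem_compAt {n : ℕ} {i j k : ℤ} (h : (n : ℤ) + j = k) {a x : QuadAlg I}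
    (ha : a ∈ comp I n) (hx : x ∈ compAt I i j) : a * x ∈ compAt I i k := by
  obtain ⟨p, hp⟩ | hj := compAt_cases i j
  · rw [compAt_eq I hp] at hx
    rw [compAt_eq I (n := n + p) (by lia)]
    exact SetLike.GradedMul.mul_mem ha hx
  · rw [compAt_eq_bot I hj, Submodule.mem_bot] at hx
    rw [hx, mul_zero]
    exact zero_mem _

variable {I} in
theorem mul_ι_mem_compAt {i j : ℤ} {x : QuadAlg I} (hx : x ∈ compAt I (i + 1) j) (v : V) :
    x * ι I v ∈ compAt I i j := by
  obtain ⟨p, hp⟩ | hj := compAt_cases (i + 1) j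
  · rw [compAt_eq I hp] at hx
    rw [compAt_eq I (n := p + 1) (by lia)]
    exact SetLike.GradedMul.mul_mem hx (ι_mem I v)
  · rw [compAt_eq_bot I hj, Submodule.mem_bot] at hx
    rw [hx, zero_mul]
    exact zero_mem _

end QuadAlg

namespace QuadDual

open QuadAlg

variable {R V W : Type u} [CommRing R] [AddCommGroup V] [Module R V] [AddCommGroup W]
  [Module R W] (I : Submodule R (V ⊗[R] V)) (J : Submodule R (W ⊗[R] W))

/-- The maps `Bᵢ → A` of degree `j`, where `Bᵢ` is placed in degree `-i`. -/
def homAt (i : ℕ) (j : ℤ) : Submodule R (comp J i →ₗ[R] QuadAlg I) where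
  carrier := {ψ | ∀ b, ψ b ∈ compAt I i j}
  add_mem' hψ hχ b := add_mem (hψ b) (hχ b)
  zero_mem' _ := zero_mem _
  smul_mem' r _ hψ b := Submodule.smul_mem _ r (hψ b)

/-- The graded left `A`-module `Hom(Bᵢ, A)`, where `Bᵢ` is placed in degree `-i`. -/
noncomputable def grK (i : ℕ) : GrMod (comp I) where
  obj j := homAt I J i j
  act h := LinearMap.mk₂ R
    (fun a ψ => ⟨(a : QuadAlg I) • (ψ : comp J i →ₗ[R] QuadAlg I),
      fun b => mul_mem_compAt h a.2 (ψ.2 b)⟩)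
    (fun _ _ _ => Subtype.ext (add_smul _ _ _)) (fun _ _ _ => Subtype.ext (smul_assoc _ _ _))
    (fun _ _ _ => Subtype.ext (smul_add _ _ _)) (fun _ _ _ => Subtype.ext (smul_comm _ _ _))
  one_act _ _ := Subtype.ext (one_smul _ _)
  mul_act _ _ _ _ _ _ := Subtype.ext (mul_smul _ _ _)

variable {I J}

/-- The underlying linear map of a homogeneous element of `Hom(Bᵢ, A)`. -/
noncomputable def toHom {i : ℕ} {j : ℤ} : (grK I J i).obj j →ₗ[R] (comp J i →ₗ[R] QuadAlg I) :=
  (homAt I J i j).subtype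

theorem toHom_injective {i : ℕ} {j : ℤ} :
    Function.Injective (toHom (I := I) (J := J) (i := i) (j := j)) :=
  Subtype.val_injective

theorem toHom_apply_mem {i : ℕ} {j : ℤ} (ψ : (grK I J i).obj j) (b : comp J i) :
    toHom ψ b ∈ compAt I i j := ψ.2 b

theorem toHom_act {i n : ℕ} {j k : ℤ} (h : (n : ℤ) + j = k) (a : comp I n)
    (ψ : (grK I J i).obj j) : toHom ((grK I J i).act h a ψ) = (a : QuadAlg I) • toHom ψ := rfl

theorem grK_eq_zero_of_lt {i : ℕ} {j : ℤ} (h : j < i) (ψ : (grK I J i).obj j) : ψ = 0 := by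
  refine toHom_injective (LinearMap.ext fun b => ?_)
  have h1 := toHom_apply_mem ψ b
  rw [compAt_eq_bot I h] at h1
  exact h1

variable (I J) in
/-- A free family of generators of the graded module `Hom(Bᵢ, A)`, dual to a family of elements of
`Bᵢ`. If `A` is torsion free, a basis of `Bᵢ` modulo torsion gives such a family. -/
structure CoordFamily (i : ℕ) where
  rank : ℕ
  b : Fin rank → comp J i
  φ : Fin rank → Module.Dual R (comp J i)
  φ_b : ∀ k l, φ k (b l) = if k = l then 1 else 0
  eq_sum : ∀ (ψ : comp J i →ₗ[R] QuadAlg I) (m : comp J i), ψ m = ∑ k, φ k m • ψ (b k)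

namespace CoordFamily

variable {i : ℕ} (F : CoordFamily I J i)

theorem nonempty [IsDomain R] [IsPrincipalIdealRing R] [Module.Finite R (comp J i)]
    [Module.IsTorsionFree R (QuadAlg I)] : Nonempty (CoordFamily I J i) := by
  obtain ⟨n, b, φ, h1, h2⟩ := exists_dual_family (R := R) (comp J i) (QuadAlg I)
  exact ⟨⟨n, b, φ, h1, h2⟩⟩

/-- The generators of `Hom(Bᵢ, A)`. -/
noncomputable def gen (k : Fin F.rank) : (grK I J i).obj i :=
  ⟨Algebra.linearMap R (QuadAlg I) ∘ₗ F.φ k, fun b => by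
    rw [compAt_eq I (n := 0) (by simp)]
    exact algebraMap_mem I _⟩

theorem gen_apply (k : Fin F.rank) (b : comp J i) :
    toHom (F.gen k) b = algebraMap R _ (F.φ k b) := rfl

/-- The coordinates of an element of `Hom(Bᵢ, A)` of degree `n + i`. -/
noncomputable def coeff (n : ℕ) {j : ℤ} (k : Fin F.rank) : (grK I J i).obj j →ₗ[R] comp I n :=
  toComp I n ∘ₗ LinearMap.applyₗ (F.b k) ∘ₗ toHom

theorem coeff_apply {n : ℕ} {j : ℤ} (h : (n : ℤ) + i = j) (k : Fin F.rank)
    (ψ : (grK I J i).obj j) :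
    (F.coeff n k ψ : QuadAlg I) = toHom ψ (F.b k) := by
  have h1 := toHom_apply_mem ψ (F.b k)
  rw [compAt_eq I h] at h1
  exact congrArg Subtype.val (toComp_coe I n ⟨_, h1⟩)

theorem coeff_act {p n q : ℕ} {j j' : ℤ} (h : (n : ℤ) + i = j) (h' : (p : ℤ) + j = j')
    (hq : p + n = q) (k : Fin F.rank) (a : comp I p) (ψ : (grK I J i).obj j) :
    (F.coeff q k ((grK I J i).act h' a ψ) : QuadAlg I) = a * F.coeff n k ψ := by
  rw [F.coeff_apply (by lia), F.coeff_apply h]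
  rfl

/-- The generators span `Hom(Bᵢ, A)`. -/
theorem sum_act {n : ℕ} {j : ℤ} (h : (n : ℤ) + i = j) (ψ : (grK I J i).obj j) :
    ψ = ∑ k, (grK I J i).act h (F.coeff n k ψ) (F.gen k) := by
  refine toHom_injective (LinearMap.ext fun m => ?_)
  rw [map_sum, LinearMap.sum_apply]
  refine (F.eq_sum _ m).trans (Finset.sum_congr rfl fun k _ => ?_)
  rw [← F.coeff_apply h k ψ, toHom_act, LinearMap.smul_apply, gen_apply, smul_eq_mul,
    ← Algebra.commutes, Algebra.smul_def]

theorem finGeneratedInDegree (F : CoordFamily I J i) : (grK I J i).FinGeneratedInDegree i := by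
  classical
  refine ⟨Finset.univ.image F.gen, fun j => ?_⟩
  rw [eq_top_iff]
  rintro ψ -
  obtain ⟨n, h⟩ | h := compAt_cases i j
  · rw [F.sum_act h ψ]
    exact Submodule.sum_mem _ fun k _ =>
      Submodule.subset_span ⟨n, h, _, F.gen k, Finset.mem_image_of_mem _ (Finset.mem_univ k), rfl⟩
  · rw [grK_eq_zero_of_lt h ψ]
    exact zero_mem _

/-- Morphisms from `Hom(Bᵢ, A)` are determined by the images of the generators. -/
theorem hom_ext {N : GrMod (comp I)} {f g : grK I J i ⟶ N}
    (h : ∀ k, f.app i (F.gen k) = g.app i (F.gen k)) : f = g := by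
  ext j ψ
  obtain ⟨n, hn⟩ | hj := compAt_cases i j
  · rw [F.sum_act hn ψ, map_sum, map_sum]
    exact Finset.sum_congr rfl fun k _ => by rw [f.app_act, g.app_act, h]
  · rw [grK_eq_zero_of_lt hj ψ, map_zero, map_zero]

section Lift

variable {N : GrMod (comp I)} (x : Fin F.rank → N.obj i)

/-- The degree `j` part of the morphism that sends the generators to given elements. -/
noncomputable def liftApp (j : ℤ) : (grK I J i).obj j →ₗ[R] N.obj j :=
  if h : ((j - i).toNat : ℤ) + i = j then
    ∑ k, ((N.act h).flip (x k)) ∘ₗ F.coeff (j - i).toNat k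
  else 0

theorem liftApp_apply {n : ℕ} {j : ℤ} (h : (n : ℤ) + i = j) (ψ : (grK I J i).obj j) :
    F.liftApp x j ψ = ∑ k, N.act h (F.coeff n k ψ) (x k) := by
  have key : ∀ (p : ℕ) (hp : (p : ℤ) + i = j), p = n →
      (∑ k, ((N.act hp).flip (x k)) ∘ₗ F.coeff p k) ψ = ∑ k, N.act h (F.coeff n k ψ) (x k) := by
    rintro p hp rfl
    rw [LinearMap.sum_apply]
    rfl
  rw [liftApp, dif_pos (by lia)]
  exact key _ _ (by lia)

/-- The morphism that sends the generators to given elements. -/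
noncomputable def lift : grK I J i ⟶ N where
  app := F.liftApp x
  app_act {n j j'} h a ψ := by
    obtain ⟨p, hp⟩ | hj := compAt_cases i j
    · have hq : ((n + p : ℕ) : ℤ) + i = j' := by lia
      rw [F.liftApp_apply x hq, F.liftApp_apply x hp, map_sum]
      refine Finset.sum_congr rfl fun k _ => ?_
      rw [← N.mul_act hp h hq]
      congr 2
      exact Subtype.ext (F.coeff_act hp h rfl k a ψ)
    · rw [grK_eq_zero_of_lt hj ψ]
      simp

theorem lift_app_gen (k : Fin F.rank) : (F.lift x).app i (F.gen k) = x k := by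
  have h0 : ((0 : ℕ) : ℤ) + i = i := by simp
  refine (F.liftApp_apply x h0 _).trans ?_
  have h1 : ∀ l, F.coeff 0 l (F.gen k) = (if k = l then (1 : R) else 0) • oneComp I := fun l => by
    refine Subtype.ext ((F.coeff_apply h0 l _).trans ?_)
    rw [gen_apply, F.φ_b, Algebra.algebraMap_eq_smul_one]
    rfl
  rw [Finset.sum_eq_single k (fun l _ hl => by simp [h1, hl.symm]) (by simp), h1, if_pos rfl,
    one_smul]
  exact N.one_act h0 _

end Lift

theorem projective (F : CoordFamily I J i) : Projective (grK I J i) where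
  factors {E X} f e he := by
    choose x hx using fun k => GrMod.surjective_of_epi e i (f.app i (F.gen k))
    refine ⟨F.lift x, F.hom_ext fun k => ?_⟩
    rw [GrMod.comp_app, LinearMap.comp_apply, lift_app_gen, hx]

end CoordFamily

end QuadDual

/-! ### The graded Koszul complex -/

namespace QuadAlg

variable {R V : Type u} [CommRing R] [AddCommGroup V] [Module R V] (I : Submodule R (V ⊗[R] V))

theorem isTorsionFree [IsDomain R] [hA : ∀ n, Module.Free R (comp I n)] :
    Module.IsTorsionFree R (QuadAlg I) :=
  have : Module.Free R (QuadAlg I) :=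
    Module.Free.of_equiv (DirectSum.decomposeLinearEquiv (comp I)).symm
  inferInstance

/-- The element of `R` underlying a homogeneous element of `A₀[-d]`. -/
noncomputable def grBaseModuleVal {d j : ℤ} : (grBaseModule I d).obj j →ₗ[R] R :=
  (if j = d then ⊤ else ⊥ : Submodule R R).subtype

theorem grBaseModuleVal_injective {d j : ℤ} :
    Function.Injective (grBaseModuleVal I (d := d) (j := j)) := Subtype.val_injective

theorem grBaseModule_eq_zero {d j : ℤ} (h : j ≠ d) (x : (grBaseModule I d).obj j) : x = 0 := by
  have key : ∀ y ∈ (if j = d then ⊤ else ⊥ : Submodule R R), y = 0 := by simp [h]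
  exact Subtype.ext (key _ x.2)

end QuadAlg

namespace QuadDual

open QuadAlg

variable {R V W : Type u} [CommRing R] [AddCommGroup V] [Module R V] [AddCommGroup W]
  [Module R W] {I : Submodule R (V ⊗[R] V)} {J : Submodule R (W ⊗[R] W)} (D : QuadDual I J)

variable (I) in
theorem aug_toHom_mem {n : ℕ} {d : ℤ} (hd : (n : ℤ) = d) (β : comp J n) (j : ℤ)
    (ψ : (grK I J n).obj j) :
    aug I (toHom ψ β) ∈ (if j = d then ⊤ else ⊥ : Submodule R R) := by
  by_cases hj : j = d
  · simp [hj]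
  · rw [if_neg hj, Submodule.mem_bot]
    have h1 := toHom_apply_mem ψ β
    obtain ⟨p, hp⟩ | hlt := compAt_cases n j
    · rw [compAt_eq I hp] at h1
      exact aug_eq_zero I p (by lia) _ h1
    · rw [compAt_eq_bot I hlt, Submodule.mem_bot] at h1
      rw [h1, map_zero]

variable (I) in
/-- The map `Hom(Bₙ, A) → A₀[-n]`, `ψ ↦ ε(ψ(β))`, for `β ∈ Bₙ`. -/
noncomputable def grEvalAug {n : ℕ} {d : ℤ} (hd : (n : ℤ) = d) (β : comp J n) :
    grK I J n ⟶ grBaseModule I d where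
  app j := LinearMap.codRestrict _ ((aug I).toLinearMap ∘ₗ LinearMap.applyₗ β ∘ₗ toHom)
    (aug_toHom_mem I hd β j)
  app_act _ a ψ := Subtype.ext (map_mul (aug I) (a : QuadAlg I) (toHom ψ β))

@[simp]
theorem grEvalAug_app {n : ℕ} {d : ℤ} (hd : (n : ℤ) = d) (β : comp J n) {j : ℤ}
    (ψ : (grK I J n).obj j) :
    grBaseModuleVal I ((grEvalAug I hd β).app j ψ) = aug I (toHom ψ β) := rfl

theorem dK_toHom_mem {n : ℕ} {j : ℤ} (ψ : (grK I J (n + 1)).obj j) :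
    D.dK n (toHom ψ) ∈ homAt I J n j := fun b => by
  rw [dK_apply]
  exact sum_mem fun k _ => mul_ι_mem_compAt (toHom_apply_mem ψ _) _

/-- The differential `Hom(Bₙ₊₁, A) → Hom(Bₙ, A)` of graded modules. -/
noncomputable def grd (n : ℕ) : grK I J (n + 1) ⟶ grK I J n where
  app j := LinearMap.codRestrict (homAt I J n j) ((D.dK n).restrictScalars R ∘ₗ toHom)
    D.dK_toHom_mem
  app_act _ a ψ := toHom_injective (map_smul (D.dK n) (a : QuadAlg I) (toHom ψ))

/-- The syzygies of the graded `A`-module `A₀` in the Koszul complex. -/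
noncomputable def grZ : ℕ → GrMod (comp I)
  | 0 => grBaseModule I 0
  | n + 1 => (grK I J n).sub (fun _ => ((D.syz n).restrictScalars R).comap toHom)
      fun _ a _ hm => (D.syz n).smul_mem (a : QuadAlg I) hm

/-- The inclusion of the syzygies. -/
noncomputable def grI (n : ℕ) : D.grZ (n + 1) ⟶ grK I J n where
  app _ := (((D.syz n).restrictScalars R).comap toHom).subtype
  app_act _ _ _ := rfl

theorem grI_injective (n : ℕ) (j : ℤ) : Function.Injective ((D.grI n).app j) :=
  Subtype.val_injective

theorem toHom_grI_mem {n : ℕ} {j : ℤ} (ψ : (D.grZ (n + 1)).obj j) :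
    toHom ((D.grI n).app j ψ) ∈ D.syz n := ψ.2

theorem exists_grI_eq {n : ℕ} {j : ℤ} (ψ : (grK I J n).obj j) (h : toHom ψ ∈ D.syz n) :
    ∃ χ, (D.grI n).app j χ = ψ := ⟨⟨ψ, h⟩, rfl⟩

/-- Exactness of the Koszul complex of graded modules, in terms of its strands. Cycles of degree at
most `n` in `Hom(Bₙ, A)` vanish, and the other degrees are strands `Hom(Bₙ₊₁, Aₚ) → Hom(Bₙ, Aₚ₊₁)`.
-/
theorem exists_grd_eq {n : ℕ} (hL : ∀ i, n = i + 1 → D.LeftExactAt i) {j : ℤ}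
    (ψ : (grK I J n).obj j) (h : toHom ψ ∈ D.syz n) : ∃ χ, (D.grd n).app j χ = ψ := by
  obtain ⟨p, hp⟩ | hlt := compAt_cases ((n + 1 : ℕ) : ℤ) j
  · obtain ⟨χ, hχ⟩ := D.exists_dl_eq_toComp_comp hL h p
    have hmem : (comp I p).subtype ∘ₗ χ ∈ homAt I J (n + 1) j := fun b => by
      rw [compAt_eq I hp]
      exact (χ b).2
    refine ⟨⟨_, hmem⟩, toHom_injective ((D.dK_subtype χ).trans (LinearMap.ext fun b => ?_))⟩
    rw [hχ]
    have h1 := toHom_apply_mem ψ b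
    rw [compAt_eq I (n := p + 1) (by lia)] at h1
    exact congrArg Subtype.val (toComp_coe I (p + 1) ⟨_, h1⟩)
  · refine ⟨0, ?_⟩
    rw [map_zero]
    by_cases hj : j < n
    · exact (grK_eq_zero_of_lt hj ψ).symm
    · refine (toHom_injective (LinearMap.ext fun b => ?_)).symm
      have h1 := toHom_apply_mem ψ b
      rw [compAt_eq I (n := 0) (by lia)] at h1
      refine (congrArg Subtype.val (toComp_coe I 0 ⟨_, h1⟩)).symm.trans ?_
      exact congrArg Subtype.val (LinearMap.congr_fun (D.toComp_zero_comp_of_mem_syz h) b)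

section

variable [IsDomain R] [IsPrincipalIdealRing R]

/-- The projection to the `n`-th syzygy: the augmentation or a differential. -/
noncomputable def grP : ∀ n, grK I J n ⟶ D.grZ n
  | 0 => grEvalAug I (by rfl) (oneComp J)
  | n + 1 =>
    { app := fun j => LinearMap.codRestrict (((D.syz n).restrictScalars R).comap toHom)
        ((D.grd n).app j) fun ψ => D.dK_mem_syz (toHom ψ)
      app_act := fun h a ψ => Subtype.ext ((D.grd n).app_act h a ψ) }

theorem grP_app_eq_zero_iff (n : ℕ) (j : ℤ) (ψ : (grK I J n).obj j) :
    (D.grP n).app j ψ = 0 ↔ toHom ψ ∈ D.syz n := by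
  cases n with
  | zero => exact Subtype.ext_iff
  | succ n => exact Subtype.ext_iff.trans Subtype.ext_iff

theorem grI_comp_grP (n : ℕ) : D.grI n ≫ D.grP n = 0 := by
  ext j ψ
  exact (D.grP_app_eq_zero_iff n j _).2 (D.toHom_grI_mem ψ)

theorem grP_zero_surjective (j : ℤ) : Function.Surjective ((D.grP 0).app j) := by
  intro r
  by_cases hj : j = 0
  · subst hj
    obtain ⟨r, hr⟩ := r
    have hmem : LinearMap.toSpanSingleton R (QuadAlg I) (r • (1 : QuadAlg I)) ∘ₗ
        (compZeroEquiv J).toLinearMap ∈ homAt I J 0 0 := fun b => by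
      rw [compAt_eq I (n := 0) (by simp)]
      exact Submodule.smul_mem _ _ (Submodule.smul_mem _ _ SetLike.GradedOne.one_mem)
    refine ⟨⟨_, hmem⟩, grBaseModuleVal_injective I ?_⟩
    change aug I (compZeroEquiv J (oneComp J) • r • (1 : QuadAlg I)) = r
    simp [compZeroEquiv_apply]
  · exact ⟨0, ((map_zero _).trans (grBaseModule_eq_zero I hj r).symm)⟩

theorem grP_surjective (n : ℕ) (hL : ∀ i, n = i + 2 → D.LeftExactAt i) (j : ℤ) :
    Function.Surjective ((D.grP n).app j) := by
  cases n with
  | zero => exact D.grP_zero_surjective j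
  | succ n =>
    intro ψ
    obtain ⟨χ, hχ⟩ := D.exists_grd_eq (fun i hi => hL i (by lia)) _ (D.toHom_grI_mem ψ)
    exact ⟨χ, D.grI_injective n j hχ⟩

/-- Conversely, exactness of the complex of graded modules gives exactness of its strands. -/
theorem leftExactAt_of_surjective {i : ℕ}
    (h : ∀ j, Function.Surjective ((D.grP (i + 2)).app j)) : D.LeftExactAt i := by
  intro p ψ hψ
  let j : ℤ := ((p + 1 : ℕ) : ℤ) + ((i + 1 : ℕ) : ℤ)
  have hmem : (comp I (p + 1)).subtype ∘ₗ ψ ∈ homAt I J (i + 1) j := fun b => by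
    rw [compAt_eq I (n := p + 1) rfl]
    exact (ψ b).2
  obtain ⟨ψ', hψ'⟩ := D.exists_grI_eq (j := j) ⟨_, hmem⟩ ((D.mem_syz_succ _).2 (by
    refine (D.dK_subtype ψ).trans ?_
    rw [hψ, LinearMap.comp_zero]))
  obtain ⟨χ, rfl⟩ := h j ψ'
  refine ⟨toComp I p ∘ₗ toHom χ, ?_⟩
  have h1 : D.dK (i + 1) (toHom χ) = (comp I (p + 1)).subtype ∘ₗ ψ := congrArg toHom hψ'
  rw [← toComp_comp_dK, h1]
  exact LinearMap.ext fun b => toComp_coe I (p + 1) (ψ b)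

theorem grShortExact (n : ℕ) (hL : ∀ i, n = i + 2 → D.LeftExactAt i) :
    (ShortComplex.mk (D.grI n) (D.grP n) (D.grI_comp_grP n)).ShortExact :=
  GrMod.shortExact _ _ _ (D.grI_injective n)
    (fun j ψ => (D.grP_app_eq_zero_iff n j ψ).trans
      ⟨D.exists_grI_eq ψ, fun ⟨χ, hχ⟩ => hχ ▸ D.toHom_grI_mem χ⟩)
    (D.grP_surjective n hL)

end

/-! ### Koszul algebras and exactness of the Koszul complex -/

section Koszul

variable [IsDomain R] [IsPrincipalIdealRing R] [hA : ∀ n, Module.Free R (comp I n)]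

theorem nonempty_coordFamily (D : QuadDual I J) (n : ℕ) : Nonempty (CoordFamily I J n) :=
  have := isTorsionFree I
  have := D.symm.finite_comp n
  CoordFamily.nonempty

/-- The Koszul complex, as a projective resolution of the graded `A`-module `A₀`. -/
noncomputable def grSyzygySeq (hL : D.LeftExact) : SyzygySeq (GrMod (comp I)) where
  Z := D.grZ
  K := grK I J
  i := D.grI
  p := D.grP
  w := D.grI_comp_grP
  exact n := D.grShortExact n fun i _ => hL i
  projective n := (D.nonempty_coordFamily n).some.projective

theorem isKoszul_of_leftExact (hL : D.LeftExact) : IsKoszul I :=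
  ⟨(D.grSyzygySeq hL).projectiveResolution,
    fun n => (D.nonempty_coordFamily n).some.finGeneratedInDegree⟩

/-- If the Koszul complex is exact up to a certain place and `A₀` has a linear resolution, then the
Koszul complex is exact at the next place: the cokernel `N` of `Kₙ₊₁ → Zₙ₊₁` vanishes in degrees at
most `n + 1`, so `Extⁿ⁺¹(A₀, N) = 0` and `Zₙ₊₁ → N` extends to `Kₙ`, which is generated in degree
`n`. -/
theorem leftExactAt_of_isKoszul (hK : IsKoszul I) (m : ℕ) (hL : ∀ i < m, D.LeftExactAt i) :
    D.LeftExactAt m := by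
  obtain ⟨P, hP⟩ := hK
  let N := GrMod.coker (D.grP (m + 2))
  let q : D.grZ (m + 2) ⟶ N := GrMod.cokerπ (D.grP (m + 2))
  -- in degree `m + 2` every cycle is a boundary, by the presentation of `B`
  have hN2 : ∀ x : N.obj ((m + 2 : ℕ) : ℤ), x = 0 := by
    intro x
    obtain ⟨ψ, rfl⟩ := GrMod.cokerπ_surjective _ _ x
    refine (GrMod.cokerπ_app_eq_zero_iff _ _ _).2 ?_
    have hψ : ∀ b, toHom ((D.grI (m + 1)).app _ ψ) b ∈ comp I 1 := fun b => by
      have := toHom_apply_mem ((D.grI (m + 1)).app _ ψ) b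
      rwa [compAt_eq I (n := 1) (by lia)] at this
    let ψ' := (toHom ((D.grI (m + 1)).app _ ψ)).codRestrict (comp I 1) hψ
    have h1 : D.dl ψ' = 0 := by
      have h2 : D.dK m ((comp I 1).subtype ∘ₗ ψ') = 0 :=
        (D.mem_syz_succ _).1 (D.toHom_grI_mem ψ)
      rw [dK_subtype] at h2
      exact LinearMap.ext fun b => Subtype.ext (LinearMap.congr_fun h2 b)
    obtain ⟨χ, hχ⟩ := D.exists_dl_eq_of_degree_one ψ' h1
    have hmem : (comp I 0).subtype ∘ₗ χ ∈ homAt I J (m + 2) ((m + 2 : ℕ) : ℤ) := fun b => by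
      rw [compAt_eq I (n := 0) (by simp)]
      exact (χ b).2
    refine ⟨⟨_, hmem⟩, D.grI_injective _ _ (toHom_injective ?_)⟩
    refine (D.dK_subtype χ).trans ?_
    rw [hχ]
    rfl
  -- in degree `m + 1` there are no cycles, as the complex is minimal
  have hN1 : ∀ x : N.obj ((m + 1 : ℕ) : ℤ), x = 0 := by
    intro x
    obtain ⟨ψ, rfl⟩ := GrMod.cokerπ_surjective _ _ x
    obtain ⟨χ, hχ⟩ : ∃ χ, (D.grd (m + 1)).app _ χ = (D.grI (m + 1)).app _ ψ := by
      refine ⟨0, ?_⟩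
      rw [map_zero]
      refine (toHom_injective (LinearMap.ext fun b => ?_)).symm
      have h1 := toHom_apply_mem ((D.grI (m + 1)).app _ ψ) b
      rw [compAt_eq I (n := 0) (by simp)] at h1
      refine (congrArg Subtype.val (toComp_coe I 0 ⟨_, h1⟩)).symm.trans ?_
      exact congrArg Subtype.val
        (LinearMap.congr_fun (D.toComp_zero_comp_of_mem_syz (D.toHom_grI_mem ψ)) b)
    exact (GrMod.cokerπ_app_eq_zero_iff _ _ _).2 ⟨χ, D.grI_injective _ _ hχ⟩
  -- a linear resolution has no maps to `N` in position `m + 2`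
  have hext : Subsingleton (Ext.{u + 1} (D.grZ 0) N (m + 1 + 1)) := by
    refine subsingleton_of_forall_eq 0 fun x => ?_
    obtain ⟨f, hf, rfl⟩ := P.extMk_surjective x (m + 1 + 1 + 1) rfl
    have hf0 : f = 0 := GrMod.hom_eq_zero (hP (m + 1 + 1)) hN2 f
    subst hf0
    exact P.extMk_zero _ _
  obtain ⟨g, hg⟩ := SyzygySeq.exists_factor_of_subsingleton_ext (m + 1) D.grZ (grK I J) D.grI D.grP
    D.grI_comp_grP (fun n hn => D.grShortExact n fun i hi => hL i (by lia))
    (fun n => (D.nonempty_coordFamily n).some.projective) N hext q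
  have hg0 : g = 0 :=
    GrMod.hom_eq_zero (D.nonempty_coordFamily (m + 1)).some.finGeneratedInDegree hN1 g
  rw [hg0, comp_zero] at hg
  refine D.leftExactAt_of_surjective fun j ψ => ?_
  refine (GrMod.cokerπ_app_eq_zero_iff (D.grP (m + 2)) j ψ).1 ?_
  exact congrArg (fun f => GrMod.Hom.app f j ψ) hg.symm

theorem leftExact_of_isKoszul (hK : IsKoszul I) : D.LeftExact := fun m =>
  Nat.strong_induction_on m fun m ih => D.leftExactAt_of_isKoszul hK m ih

end Koszul

end QuadDual

/-! ### Ext groups of graded modules -/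

namespace QuadDual

open QuadAlg

variable {R V W : Type u} [CommRing R] [AddCommGroup V] [Module R V] [AddCommGroup W]
  [Module R W] {I : Submodule R (V ⊗[R] V)} {J : Submodule R (W ⊗[R] W)} (D : QuadDual I J)

/-- All maps `Hom(Bₙ, A) → A₀[-n]` of graded modules are evaluations at elements of `Bₙ`, if `Bₙ` is
free. -/
noncomputable def grEvalAugEquiv (n : ℕ) [Module.Free R (comp J n)] [Module.Finite R (comp J n)]
    (F : CoordFamily I J n) : comp J n ≃ₗ[R] (grK I J n ⟶ grBaseModule I (n : ℤ)) :=
  LinearEquiv.ofBijective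
    { toFun := grEvalAug I rfl
      map_add' := fun β γ => GrMod.hom_ext fun j ψ => grBaseModuleVal_injective I
        ((congrArg (aug I) (map_add (toHom ψ) β γ)).trans (map_add (aug I) _ _))
      map_smul' := fun r β => GrMod.hom_ext fun j ψ => grBaseModuleVal_injective I
        ((congrArg (aug I) (map_smul (toHom ψ) r β)).trans (map_smul (aug I) _ _)) } <| by
    constructor
    · refine (injective_iff_map_eq_zero _).2 fun β hβ => ?_
      let b := Module.Free.chooseBasis R (comp J n)
      refine b.ext_elem fun k => ?_
      have hmem : Algebra.linearMap R (QuadAlg I) ∘ₗ b.coord k ∈ homAt I J n n := fun b => by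
        rw [compAt_eq I (n := 0) (by simp)]
        exact algebraMap_mem I _
      let ψ : (grK I J n).obj n := ⟨_, hmem⟩
      have h : aug I (algebraMap R _ (b.repr β k)) = 0 :=
        congrArg (fun f => grBaseModuleVal I (GrMod.Hom.app f n ψ)) hβ
      rw [AlgHom.commutes] at h
      rw [map_zero, Finsupp.zero_apply]
      exact h
    · intro f
      refine ⟨∑ k, grBaseModuleVal I (f.app n (F.gen k)) • F.b k, F.hom_ext fun l =>
        grBaseModuleVal_injective I ?_⟩
      refine (grEvalAug_app rfl _ _).trans ?_
      rw [map_sum, map_sum, Finset.sum_eq_single l (fun k _ hk => ?_) (by simp)]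
      · rw [map_smul, map_smul, F.gen_apply, F.φ_b, if_pos rfl, map_one, map_one, smul_eq_mul,
          mul_one]
      · rw [map_smul, map_smul, F.gen_apply, F.φ_b, if_neg hk.symm, map_zero, map_zero, smul_zero]

section

variable [IsDomain R] [IsPrincipalIdealRing R] [hA : ∀ n, Module.Free R (comp I n)]

theorem grI_comp_eq_zero (D : QuadDual I J) (hB : ∀ n, Module.Free R (comp J n)) (d : ℤ) (n : ℕ)
    (g : grK I J n ⟶ grBaseModule I d) : D.grI n ≫ g = 0 := by
  have F := (D.nonempty_coordFamily n).some
  by_cases hd : (n : ℤ) = d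
  · subst hd
    have := D.symm.finite_comp n
    obtain ⟨β, rfl⟩ := (grEvalAugEquiv n F).surjective g
    exact GrMod.hom_ext fun j ψ => grBaseModuleVal_injective I
      (D.aug_apply_eq_zero_of_mem_syz (D.toHom_grI_mem ψ) β)
  · rw [GrMod.hom_eq_zero F.finGeneratedInDegree (fun x => grBaseModule_eq_zero I hd x) g,
      comp_zero]

/-- The graded `Ext` groups of `A₀` are diagonal, and isomorphic to the components of `B`. -/
theorem grExtIsDiagonal (hL : D.LeftExact) : GrExtIsDiagonal I J := by
  have hB := D.free_comp_of_leftExact hL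
  intro n
  have F := (D.nonempty_coordFamily n).some
  have := D.symm.finite_comp n
  refine ⟨fun d hd => ?_, ⟨?_⟩⟩
  · refine ((D.grSyzygySeq hL).extHomEquiv (R := R)
      (D.grI_comp_eq_zero hB d) n).symm.toEquiv.subsingleton_congr.2 ?_
    refine subsingleton_of_forall_eq 0 fun g => ?_
    exact GrMod.hom_eq_zero F.finGeneratedInDegree
      (fun x => grBaseModule_eq_zero I (Ne.symm hd) x) g
  · exact (((grEvalAugEquiv n F).trans
      ((D.grSyzygySeq hL).extHomEquiv (R := R) (D.grI_comp_eq_zero hB n) n))).symm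

end

end QuadDual

/-! ### The quadratic dual -/

section

variable {R V : Type u} [CommRing R] [AddCommGroup V] [Module R V]

/-- The pairing of `V* ⊗ V*` and `V ⊗ V` in coordinates. -/
theorem sum_repr_mul_repr_eq_dualDistrib {κ : Type*} [Fintype κ] [DecidableEq κ]
    (b : Module.Basis κ R V) (t : Module.Dual R V ⊗[R] Module.Dual R V) (s : V ⊗[R] V) :
    ∑ p, (b.dualBasis.tensorProduct b.dualBasis).repr t p * (b.tensorProduct b).repr s p =
      TensorProduct.dualDistrib R V V t s := by
  have h : ∀ (f : Module.Dual R V) (x : V), f x = ∑ k, f (b k) * b.repr x k := fun f x => by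
    conv_lhs => rw [← b.sum_repr x, map_sum]
    exact Finset.sum_congr rfl fun k _ => by rw [map_smul, smul_eq_mul, mul_comm]
  induction t using TensorProduct.induction_on with
  | zero => simp
  | tmul f g =>
    induction s using TensorProduct.induction_on with
    | zero => simp
    | tmul x y =>
      rw [TensorProduct.dualDistrib_apply, h f x, h g y, Fintype.sum_prod_type, Finset.sum_mul_sum]
      refine Finset.sum_congr rfl fun i _ => Finset.sum_congr rfl fun j _ => ?_
      simp
      ring
    | add x y hx hy =>
      simp only [map_add, Finsupp.add_apply, mul_add, Finset.sum_add_distrib, hx, hy]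
  | add x y hx hy =>
    simp only [map_add, Finsupp.add_apply, add_mul, Finset.sum_add_distrib, hx, hy,
      LinearMap.add_apply]

/-- A saturated module of relations and its annihilator form a dual pair. -/
noncomputable def QuadDual.ofDualRelations [Nontrivial R] [Module.Free R V] [Module.Finite R V]
    (I : Submodule R (V ⊗[R] V)) [Module.Free R ((V ⊗[R] V) ⧸ I)] :
    QuadDual I (dualRelations I) where
  rank := Module.finrank R V
  v := Module.finBasis R V
  w := (Module.finBasis R V).dualBasis
  mem_right t := by
    simp only [sum_repr_mul_repr_eq_dualDistrib]
    rw [dualRelations, Submodule.mem_comap, Submodule.mem_dualAnnihilator]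
  mem_left s := by
    simp only [sum_repr_mul_repr_eq_dualDistrib]
    -- functionals on the free module `(V ⊗ V) / I` separate points and are given by elements of
    -- `V* ⊗ V*` that annihilate `I`
    refine ⟨fun hs t ht => (Submodule.mem_dualAnnihilator _).1 ht s hs, fun h => ?_⟩
    rw [← Submodule.Quotient.mk_eq_zero, ← Module.forall_dual_apply_eq_zero_iff R]
    intro f
    obtain ⟨t, ht⟩ := (TensorProduct.dualDistribEquiv R V V).surjective (f ∘ₗ I.mkQ)
    have ht' : TensorProduct.dualDistrib R V V t = f ∘ₗ I.mkQ := ht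
    have h1 := h t ((Submodule.mem_dualAnnihilator _).2 fun x hx => by
      rw [ht', LinearMap.comp_apply, Submodule.mkQ_apply, (Submodule.Quotient.mk_eq_zero I).2 hx,
        map_zero])
    rwa [ht'] at h1

theorem QuadAlg.free_comp_of_hasFlatComponents [IsLocalRing R] [Module.Finite R V]
    {I : Submodule R (V ⊗[R] V)} (h : HasFlatComponents I) (n : ℕ) : Module.Free R (comp I n) :=
  have := h n
  Module.free_of_flat_of_isLocalRing

end

theorem mainTheorem3 {R V : Type u} [CommRing R] [IsDomain R] [IsDiscreteValuationRing R]
    [AddCommGroup V] [Module R V] [Module.Finite R V] [Module.Flat R V]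
    (I : Submodule R (V ⊗[R] V)) (hI : Module.Flat R I)
    (hI' : Module.Flat R ((V ⊗[R] V) ⧸ I)) :
    ((QuadAlg.IsKoszul I ∧ QuadAlg.HasFlatComponents I) ↔
      (QuadAlg.IsKoszul (dualRelations I) ∧ QuadAlg.HasFlatComponents (dualRelations I))) ∧
    ((QuadAlg.IsKoszul I ∧ QuadAlg.HasFlatComponents I) →
      Nonempty (ExtAlgEquivOp I (dualRelations I)) ∧
      Nonempty (ExtAlgEquivOp (dualRelations I) I) ∧
      GrExtIsDiagonal I (dualRelations I) ∧
      GrExtIsDiagonal (dualRelations I) I) := by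
  have : Module.Free R V := Module.free_of_flat_of_isLocalRing
  have : Module.Free R ((V ⊗[R] V) ⧸ I) := Module.free_of_flat_of_isLocalRing
  let D := QuadDual.ofDualRelations I
  refine ⟨⟨fun ⟨hK, hF⟩ => ?_, fun ⟨hK, hF⟩ => ?_⟩, fun ⟨hK, hF⟩ => ?_⟩
  · have := QuadAlg.free_comp_of_hasFlatComponents hF
    have hL := D.leftExact_of_isKoszul hK
    have := D.free_comp_of_leftExact hL
    exact ⟨D.symm.isKoszul_of_leftExact (QuadDual.LeftExact.symm D hL), fun n => inferInstance⟩
  · have := QuadAlg.free_comp_of_hasFlatComponents hF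
    have hL := D.symm.leftExact_of_isKoszul hK
    have := D.symm.free_comp_of_leftExact hL
    exact ⟨D.isKoszul_of_leftExact (QuadDual.LeftExact.symm D.symm hL), fun n => inferInstance⟩
  · have hA := QuadAlg.free_comp_of_hasFlatComponents hF
    have hL := D.leftExact_of_isKoszul hK
    have hB := D.free_comp_of_leftExact hL
    have hL' := QuadDual.LeftExact.symm D hL
    exact ⟨⟨D.extAlgEquivOp hL⟩, ⟨D.symm.extAlgEquivOp hL'⟩, D.grExtIsDiagonal hL,
      D.symm.grExtIsDiagonal hL'⟩
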